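/- Let $\sigma>0$, let $\mathbb{T}=\mathbb{R}/\mathbb{Z}$, and let $\mathrm{Diff}^k(\mathbb{T})$ be the set of orientation-preserving $C^k$-diffeomorphisms of $\mathbb{T}$; $\mathrm{Diff}^1(\mathbb{T})$ carries the $C^1$ topology. The group $\mathrm{PSL}(2,\mathbb{R})$ acts on $\phi\in\mathrm{Diff}^1(\mathbb{T})$ by post-composition, through $f\mapsto\frac{af+b}{cf+d}$ in the coordinate $f=\tan(\pi\phi-\frac{\pi}{2})\in\mathbb{R}\cup\{\infty\}$. It consists of the maps \[ \phi_{z,a}(t)=a-\frac{i}{2\pi}\ln\frac{e^{2\pi i t}-z}{1-\bar z e^{2\pi i t}}\pmod 1,\qquad z=\rho e^{2\pi i\theta},\ 0\le\rho<1,\ \theta,a\in\mathbb{T}, \] and $\nu_H$ is its Haar measure with the normalisation $d\nu_H(\phi_{z,a})=\frac{4\rho\,d\rho\,d\theta\,da}{(1-\rho^2)^2}$. The quotient $\mathrm{Diff}^1(\mathbb{T})/\mathrm{PSL}(2,\mathbb{R})$ carries the quotient topology, and $[\phi]$ denotes the class of $\phi$. Let $\mathcal{S}_\psi=(\psi''/\psi')'-\frac12(\psi''/\psi')^2$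 be the Schwarzian derivative. For $\alpha^2\in\mathbb{R}$, an unquotiented $\alpha$-orbital measure is a Radon measure $\mu$ on $\mathrm{Diff}^1(\mathbb{T})$ such that, for every $\psi\in\mathrm{Diff}^3(\mathbb{T})$, the measure $\psi^*\mu(A)=\mu(\psi\circ A)$ satisfies \[ \frac{d\psi^*\mu}{d\mu}(\phi)=\exp\Big\{\frac1{\sigma^2}\int_{\mathbb{T}}\big[\mathcal{S}_\psi(\phi(\tau))+2\alpha^2(\psi'(\phi(\tau))^2-1)\big]\phi'(\tau)^2\,d\tau\Big\}. \] Let $\mathcal{M}_{\sigma^2}$ be the Schwarzian measure, that is, a finite Borel measure on $\mathrm{Diff}^1(\mathbb{T})/\mathrm{PSL}(2,\mathbb{R})$ whose lift $\widetilde{\mathcal{M}}_{\sigma^2}$ to $\mathrm{Diff}^1(\mathbb{T})$, given by \[ \int F\,d\widetilde{\mathcal{M}}_{\sigma^2}=\int d\mathcal{M}_{\sigma^2}([\phi])\int_{\mathrm{PSL}(2,\mathbb{R})}d\nu_H(\psi)\,F(\psi\circ\phi)\qquad\text{for all continuous }F\colon\mathrm{Diff}^1(\mathbb{T})\to[0,\infty],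 \] is an unquotiented $\pi$-orbital measure, normalised so that $\mathcal{M}^0_{\sigma^2}$ has total mass $1/\sqrt{2\pi\sigma^2}$, where for real $\alpha$ \[ d\mathcal{M}^\alpha_{\sigma^2}(\phi)=\exp\Big\{\frac{2(\alpha^2-\pi^2)}{\sigma^2}\int_{\mathbb{T}}\phi'(\tau)^2\,d\tau\Big\}\,d\widetilde{\mathcal{M}}_{\sigma^2}(\phi). \] Let the pinned measure $\mathcal{M}^{\alpha,0}_{\sigma^2}$ be the image of $\mathcal{M}^\alpha_{\sigma^2}$ under $\phi\mapsto\phi-\phi(0)$. Then, for every continuous $F\colon\mathrm{Diff}^1(\mathbb{T})/\mathrm{PSL}(2,\mathbb{R})\to[0,\infty]$, \[ \int_{\mathrm{Diff}^1(\mathbb{T})/\mathrm{PSL}(2,\mathbb{R})}F([\phi])\,d\mathcal{M}_{\sigma^2}([\phi])=\lim_{\alpha\to\pi^-}\frac{4\pi(\pi-\alpha)}{\sigma^2}\int_{\mathrm{Diff}^1(\mathbb{T})}F([\phi])\,d\mathcal{M}^{\alpha,0}_{\sigma^2}(\phi) \] (both sides may be $+\infty$), and \[ \mathcal{M}_{\sigma^2}\big(\mathrm{Diff}^1(\mathbb{T})/\mathrm{PSL}(2,\mathbb{R})\big)=\Big(\frac{2\pi}{\sigma^2}\Big)^{3/2}\exp\Big(\frac{2\pi^2}{\sigma^2}\Big).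 \] -/

import Mathlib

open MeasureTheory Filter Topology
open scoped ENNReal MatrixGroups

noncomputable section

namespace SchwarzianTheory

/-! ### Circle diffeomorphisms -/

/-- The properties of a lift `f : ℝ → ℝ` of an orientation-preserving `C^k` diffeomorphism
(`k ≥ 1`) of the circle `𝕋 = ℝ / ℤ`. -/
structure IsDiffeoLift (k : ℕ) (f : ℝ → ℝ) : Prop where
  contDiff : ContDiff ℝ k f
  deriv_pos : ∀ x, 0 < deriv f x
  add_one : ∀ x, f (x + 1) = f x + 1

/-- `Diff^k(𝕋)`, `k ≥ 1`: the orientation-preserving `C^k` diffeomorphisms of the circle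
`𝕋 = ℝ / ℤ`, i.e. the self-maps of `𝕋` that lift to a `C^k` function `f` on `ℝ` with `f' > 0` and
`f (x + 1) = f x + 1`. (The inverse is then automatically `C^k`.) -/
@[ext]
structure CircleDiffeo (k : ℕ) where
  toFun : UnitAddCircle → UnitAddCircle
  exists_lift : ∃ f : ℝ → ℝ, IsDiffeoLift k f ∧ ∀ x : ℝ, toFun (x : UnitAddCircle) = (f x : ℝ)

namespace CircleDiffeo

variable {k : ℕ}

/-- A lift of `φ` to the real line (any two differ by an integer constant). -/
def lift (φ : CircleDiffeo k) : ℝ → ℝ := Classical.choose φ.exists_lift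

theorem isDiffeoLift (φ : CircleDiffeo k) : IsDiffeoLift k φ.lift :=
  (Classical.choose_spec φ.exists_lift).1

theorem toFun_coe (φ : CircleDiffeo k) (x : ℝ) :
    φ.toFun (x : UnitAddCircle) = (φ.lift x : ℝ) :=
  (Classical.choose_spec φ.exists_lift).2 x

theorem continuous_toFun (φ : CircleDiffeo k) : Continuous φ.toFun := by
  refine continuous_coinduced_dom.2 ?_
  have h : (φ.toFun ∘ fun x : ℝ => (x : UnitAddCircle)) =
      fun x : ℝ => ((φ.lift x : ℝ) : UnitAddCircle) := funext φ.toFun_coe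
  exact h ▸ (AddCircle.continuous_mk' 1).comp φ.isDiffeoLift.contDiff.continuous

theorem deriv_lift_periodic (φ : CircleDiffeo k) : Function.Periodic (deriv φ.lift) 1 := by
  intro x
  have h : (fun y => φ.lift (y + 1)) = fun y => φ.lift y + 1 := funext φ.isDiffeoLift.add_one
  have h2 := congrArg (fun g => deriv g x) h
  simpa [deriv_comp_add_const] using h2

/-- The derivative `φ' : 𝕋 → ℝ`. -/
def derivative (φ : CircleDiffeo k) : UnitAddCircle → ℝ := φ.deriv_lift_periodic.lift

theorem continuous_derivative (φ : CircleDiffeo 1) : Continuous φ.derivative :=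
  continuous_coinduced_dom.2 (φ.isDiffeoLift.contDiff.continuous_deriv le_rfl)

/-- The `C^1` topology on `Diff^1(𝕋)`: uniform convergence of `φ` and of `φ'`. -/
instance : TopologicalSpace (CircleDiffeo 1) :=
  TopologicalSpace.induced
    (fun φ => ((⟨φ.toFun, φ.continuous_toFun⟩, ⟨φ.derivative, φ.continuous_derivative⟩) :
      C(UnitAddCircle, UnitAddCircle) × C(UnitAddCircle, ℝ))) inferInstance

instance : MeasurableSpace (CircleDiffeo 1) := borel _

instance : BorelSpace (CircleDiffeo 1) := ⟨rfl⟩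

/-- Post-composition `φ ↦ ψ ∘ φ` on `Diff^1(𝕋)` by a `C^m` diffeomorphism `ψ`, `m ≥ 1`. -/
def postcomp {m : ℕ} [NeZero m] (ψ : CircleDiffeo m) (φ : CircleDiffeo 1) : CircleDiffeo 1 where
  toFun := ψ.toFun ∘ φ.toFun
  exists_lift := by
    have hm : ((1 : ℕ) : WithTop ℕ∞) ≤ ((m : ℕ) : WithTop ℕ∞) := by
      exact_mod_cast NeZero.one_le
    have hψ := ψ.isDiffeoLift.contDiff.of_le hm
    have hφ := φ.isDiffeoLift.contDiff
    refine ⟨ψ.lift ∘ φ.lift, ⟨hψ.comp hφ, fun x => ?_, fun x => ?_⟩, fun x => ?_⟩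
    · rw [deriv_comp x ((hψ.differentiable (by simp)) _) ((hφ.differentiable (by simp)) _)]
      exact mul_pos (ψ.isDiffeoLift.deriv_pos _) (φ.isDiffeoLift.deriv_pos _)
    · simp [φ.isDiffeoLift.add_one, ψ.isDiffeoLift.add_one]
    · simp [φ.toFun_coe, ψ.toFun_coe]

/-- `φ ↦ φ - φ(t₀)`. -/
def pin (t₀ : UnitAddCircle) (φ : CircleDiffeo 1) : CircleDiffeo 1 where
  toFun t := φ.toFun t - φ.toFun t₀
  exists_lift := by
    obtain ⟨x₀, rfl⟩ := QuotientAddGroup.mk_surjective t₀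
    refine ⟨fun x => φ.lift x - φ.lift x₀, ⟨?_, fun x => ?_, fun x => ?_⟩, fun x => ?_⟩
    · exact φ.isDiffeoLift.contDiff.sub contDiff_const
    · simpa using φ.isDiffeoLift.deriv_pos x
    · rw [φ.isDiffeoLift.add_one]; ring
    · rw [φ.toFun_coe, AddCircle.coe_sub]
      congr 1
      exact φ.toFun_coe x₀

end CircleDiffeo

/-! ### The action of `PSL(2, ℝ)` -/

/-- The coordinate `t ↦ tan (π t - π / 2)`, a bijection from `𝕋` to `ℝ ∪ {∞}` with `0 ↦ ∞`. -/
def tanCoord (t : UnitAddCircle) : OnePoint ℝ :=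
  open scoped Classical in
  if t = 0 then OnePoint.infty
  else ((Function.Periodic.lift (c := (1 : ℝ))
    (f := fun x : ℝ => Real.tan (Real.pi * x - Real.pi / 2))
    (fun x => by
      have h : Real.pi * (x + 1) - Real.pi / 2 = Real.pi * x - Real.pi / 2 + Real.pi := by ring
      simp only [h, Real.tan_add_pi]) t : ℝ) : OnePoint ℝ)

/-- Two elements of `Diff^1(𝕋)` are equivalent if they lie on the same orbit of `PSL(2, ℝ)`, acting
by `f ↦ (a f + b) / (c f + d)` on `f = tan (π φ - π / 2) ∈ ℝ ∪ {∞}`. -/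
instance pslSetoid : Setoid (CircleDiffeo 1) where
  r φ χ := ∃ g : SL(2, ℝ), ∀ t : UnitAddCircle,
    tanCoord (χ.toFun t) = (g : GL (Fin 2) ℝ) • tanCoord (φ.toFun t)
  iseqv :=
    { refl := fun φ => ⟨1, fun t => by simp⟩
      symm := fun {φ χ} ⟨g, h⟩ => ⟨g⁻¹, fun t => by simp [h]⟩
      trans := fun {φ χ ω} ⟨g, h⟩ ⟨g', h'⟩ => ⟨g' * g, fun t => by
        simp [h, h', mul_smul]⟩ }

/-- The quotient space `Diff^1(𝕋) / PSL(2, ℝ)`. -/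
def DiffModPSL : Type := Quotient pslSetoid

/-- The projection `φ ↦ [φ]`. -/
def DiffModPSL.mk (φ : CircleDiffeo 1) : DiffModPSL := Quotient.mk pslSetoid φ

/-- A representative of a class. -/
def DiffModPSL.rep (q : DiffModPSL) : CircleDiffeo 1 := Quotient.out q

/-- The quotient topology. -/
instance : TopologicalSpace DiffModPSL :=
  TopologicalSpace.coinduced DiffModPSL.mk inferInstance

instance : MeasurableSpace DiffModPSL := borel _

instance : BorelSpace DiffModPSL := ⟨rfl⟩

/-! ### The Haar measure of `PSL(2, ℝ)` -/

/-- The disk automorphism `w ↦ (w - z) / (1 - z̄ w)` at the boundary point `w = e^{2πit}`. -/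
def diskMap (z : Complex.UnitDisc) (t : UnitAddCircle) : ℂ :=
  ((AddCircle.toCircle t : ℂ) - z) / (1 - (starRingEnd ℂ (z : ℂ)) * (AddCircle.toCircle t : ℂ))

/-- A smooth real lift of `t ↦ (2π)⁻¹ arg (diskMap z t)`. -/
def diskAngle (z : ℂ) (x : ℝ) : ℝ :=
  x + (1 / Real.pi) * (Complex.arg (1 - z * Complex.exp (-(2 * Real.pi * x * Complex.I))))

theorem norm_mul_exp_lt (z : Complex.UnitDisc) (x : ℝ) :
    ‖(z : ℂ) * Complex.exp (-(2 * Real.pi * x * Complex.I))‖ < 1 := by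
  have h : -(2 * (Real.pi : ℂ) * x * Complex.I) = ((-(2 * Real.pi * x) : ℝ) : ℂ) * Complex.I := by
    push_cast; ring
  rw [norm_mul, h, Complex.norm_exp_ofReal_mul_I, mul_one]
  exact z.norm_lt_one

theorem hasDerivAt_diskAngle (z : Complex.UnitDisc) (x : ℝ) :
    HasDerivAt (diskAngle z)
      (1 + (1 / Real.pi) * ((2 * Real.pi * Complex.I *
        ((z : ℂ) * Complex.exp (-(2 * Real.pi * x * Complex.I)))) /
        (1 - (z : ℂ) * Complex.exp (-(2 * Real.pi * x * Complex.I)))).im) x := by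
  have hslit : 1 - (z : ℂ) * Complex.exp (-(2 * Real.pi * x * Complex.I)) ∈ Complex.slitPlane := by
    left
    have := (Complex.re_le_norm _).trans_lt (norm_mul_exp_lt z x)
    simpa using this
  have h1 : HasDerivAt (fun y : ℝ => 1 - (z : ℂ) * Complex.exp (-(2 * Real.pi * y * Complex.I)))
      (2 * Real.pi * Complex.I * ((z : ℂ) * Complex.exp (-(2 * Real.pi * x * Complex.I)))) x := by
    have h0 : HasDerivAt (fun y : ℝ => -(2 * (Real.pi : ℂ) * y * Complex.I))
        (-(2 * (Real.pi : ℂ) * 1 * Complex.I)) x :=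
      (((Complex.ofRealCLM.hasDerivAt (x := x)).const_mul _).mul_const _).neg
    have := ((h0.cexp).const_mul (z : ℂ)).const_sub 1
    refine this.congr_deriv ?_
    ring
  have h2 := h1.clog_real hslit
  have h3 := Complex.imCLM.hasFDerivAt.comp_hasDerivAt x h2
  have h4 := (hasDerivAt_id x).add (h3.const_mul (1 / Real.pi))
  refine (h4.congr_deriv rfl).congr_of_eventuallyEq (Eventually.of_forall fun y => ?_)
  simp [diskAngle, Complex.log_im]

theorem isDiffeoLift_diskAngle (z : Complex.UnitDisc) : IsDiffeoLift 1 (diskAngle z) where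
  contDiff := by
    rw [Nat.cast_one, contDiff_one_iff_deriv]
    refine ⟨fun x => (hasDerivAt_diskAngle z x).differentiableAt, ?_⟩
    rw [funext fun x => (hasDerivAt_diskAngle z x).deriv]
    have hne : ∀ x : ℝ, 1 - (z : ℂ) * Complex.exp (-(2 * Real.pi * x * Complex.I)) ≠ 0 := by
      intro x h
      have := norm_mul_exp_lt z x
      rw [← sub_eq_zero.1 h] at this
      simp at this
    refine continuous_const.add (continuous_const.mul (Complex.continuous_im.comp ?_))
    exact Continuous.div (by fun_prop) (by fun_prop) hne
  deriv_pos := by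
    intro x
    rw [(hasDerivAt_diskAngle z x).deriv]
    have hlt := norm_mul_exp_lt z x
    set u : ℂ := (z : ℂ) * Complex.exp (-(2 * Real.pi * x * Complex.I))
    have hne : 1 - u ≠ 0 := by
      intro h
      rw [← sub_eq_zero.1 h] at hlt
      simp at hlt
    have hpos : 0 < Complex.normSq (1 - u) := Complex.normSq_pos.2 hne
    have hu : Complex.normSq u < 1 := by
      rw [Complex.normSq_eq_norm_sq]
      nlinarith [norm_nonneg u]
    have hpi := Real.pi_pos
    have e : 1 + (1 / Real.pi) * ((2 * Real.pi * Complex.I * u) / (1 - u)).im =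
        (1 - Complex.normSq u) / Complex.normSq (1 - u) := by
      rw [Complex.div_im]
      simp only [Complex.mul_re, Complex.mul_im, Complex.I_re, Complex.I_im, Complex.ofReal_re,
        Complex.ofReal_im, Complex.sub_re, Complex.sub_im, Complex.one_re, Complex.one_im,
        Complex.re_ofNat, Complex.im_ofNat]
      field_simp
      simp only [Complex.normSq_apply, Complex.sub_re, Complex.sub_im, Complex.one_re,
        Complex.one_im]
      ring
    rw [e]
    exact div_pos (by linarith) hpos
  add_one := by
    intro x
    have h : Complex.exp (-(2 * Real.pi * ((x + 1 : ℝ) : ℂ) * Complex.I)) =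
        Complex.exp (-(2 * Real.pi * x * Complex.I)) := by
      rw [Complex.exp_eq_exp_iff_exists_int]
      exact ⟨-1, by push_cast; ring⟩
    simp only [diskAngle, h]
    ring

theorem diskMap_coe (z : Complex.UnitDisc) (x : ℝ) :
    diskMap z (x : UnitAddCircle) = Complex.exp ((2 * Real.pi * diskAngle z x : ℝ) * Complex.I) := by
  have hlt := norm_mul_exp_lt z x
  have harg := Complex.norm_mul_exp_arg_mul_I
    (1 - (z : ℂ) * Complex.exp (-(2 * Real.pi * x * Complex.I)))
  have hE : (AddCircle.toCircle (x : UnitAddCircle) : ℂ) =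
      Complex.exp (2 * Real.pi * x * Complex.I) := by
    rw [AddCircle.toCircle_apply_mk, Circle.coe_exp]
    push_cast
    congr 1
    ring
  have hEE : Complex.exp (-(2 * Real.pi * x * Complex.I)) *
      Complex.exp (2 * Real.pi * x * Complex.I) = 1 := by
    rw [← Complex.exp_add]; simp
  have hconj : starRingEnd ℂ (Complex.exp (-(2 * Real.pi * x * Complex.I))) =
      Complex.exp (2 * Real.pi * x * Complex.I) := by
    rw [← Complex.exp_conj]
    congr 1
    simp only [map_neg, map_mul, Complex.conj_ofReal, Complex.conj_I, map_ofNat]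
    ring
  have hne : 1 - (z : ℂ) * Complex.exp (-(2 * Real.pi * x * Complex.I)) ≠ 0 := by
    intro h
    rw [← sub_eq_zero.1 h] at hlt
    simp at hlt
  have hpow : Complex.exp ((2 * Real.pi * diskAngle z x : ℝ) * Complex.I) =
      Complex.exp (2 * Real.pi * x * Complex.I) *
        Complex.exp (Complex.arg (1 - (z : ℂ) * Complex.exp (-(2 * Real.pi * x * Complex.I))) *
          Complex.I) ^ 2 := by
    rw [← Complex.exp_nat_mul, ← Complex.exp_add]
    congr 1
    have : (Real.pi : ℂ) ≠ 0 := by exact_mod_cast Real.pi_ne_zero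
    simp only [diskAngle]
    push_cast
    field_simp
  rw [hpow, diskMap, hE]
  set E := Complex.exp (2 * Real.pi * x * Complex.I)
  set E' := Complex.exp (-(2 * Real.pi * x * Complex.I))
  set w : ℂ := 1 - (z : ℂ) * E' with hw
  have hcw : starRingEnd ℂ w = 1 - (starRingEnd ℂ (z : ℂ)) * E := by
    rw [hw, map_sub, map_mul, hconj, map_one]
  have hcne : starRingEnd ℂ w ≠ 0 := (map_ne_zero _).2 hne
  set A := Complex.exp (Complex.arg w * Complex.I)
  have hnn : ((‖w‖ : ℝ) : ℂ) ≠ 0 := by exact_mod_cast norm_ne_zero_iff.2 hne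
  have hmul : w * starRingEnd ℂ w = (‖w‖ : ℂ) ^ 2 := by
    rw [Complex.mul_conj, Complex.normSq_eq_norm_sq]; push_cast; rfl
  rw [← hcw, div_eq_iff hcne]
  have h1 : E - z = E * w := by rw [hw]; linear_combination (-(z : ℂ)) * hEE * (-1)
  rw [h1]
  have h2 : A ^ 2 * starRingEnd ℂ w * w = w * w := by
    calc A ^ 2 * starRingEnd ℂ w * w = ((‖w‖ : ℂ) * A) ^ 2 := by
          linear_combination A ^ 2 * hmul
      _ = w * w := by rw [harg]; ring
  have h3 := mul_right_cancel₀ hne h2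
  rw [mul_assoc, h3]

/-- The element `φ_{z,a}(t) = a - (i / 2π) log ((e^{2πit} - z) / (1 - z̄ e^{2πit})) (mod 1)` of
`PSL(2, ℝ) ⊆ Diff^1(𝕋)`. As the argument of the logarithm has modulus one, `-i log` of it is its
complex argument (mod `2π`). -/
def mobius (z : Complex.UnitDisc) (a : UnitAddCircle) : CircleDiffeo 1 where
  toFun t := a + ((Complex.arg (diskMap z t) / (2 * Real.pi) : ℝ) : UnitAddCircle)
  exists_lift := by
    obtain ⟨b, rfl⟩ := QuotientAddGroup.mk_surjective a
    have hL := isDiffeoLift_diskAngle z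
    refine ⟨fun x => b + diskAngle z x, ⟨contDiff_const.add hL.contDiff, fun x => ?_, fun x => ?_⟩,
      fun x => ?_⟩
    · simpa using hL.deriv_pos x
    · rw [hL.add_one]; ring
    · rw [AddCircle.coe_add]
      congr 1
      have hn : ‖diskMap z (x : UnitAddCircle)‖ = 1 := by
        rw [diskMap_coe, Complex.norm_exp_ofReal_mul_I]
      have h := Complex.norm_mul_exp_arg_mul_I (diskMap z (x : UnitAddCircle))
      rw [hn, Complex.ofReal_one, one_mul] at h
      nth_rewrite 2 [diskMap_coe] at h
      obtain ⟨n, hn⟩ := Complex.exp_eq_exp_iff_exists_int.1 h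
      have hpi := Real.pi_ne_zero
      have hre : Complex.arg (diskMap z (x : UnitAddCircle)) =
          2 * Real.pi * diskAngle z x + n * (2 * Real.pi) := by
        have := congrArg Complex.im hn
        simpa using this
      have hq : Complex.arg (diskMap z (x : UnitAddCircle)) / (2 * Real.pi) =
          diskAngle z x + n := by
        rw [hre]; field_simp
      rw [hq, AddCircle.coe_add]
      have : ((n : ℝ) : UnitAddCircle) = 0 := by
        rw [AddCircle.coe_eq_zero_iff]
        exact ⟨n, by simp⟩
      rw [this, add_zero]

/-- Coordinates `(ρ, θ, a)` on `PSL(2, ℝ)`, with `0 ≤ ρ < 1` and `θ, a ∈ 𝕋`. -/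
abbrev PSLCoord : Type := Set.Ico (0 : ℝ) 1 × UnitAddCircle × UnitAddCircle

/-- The point `z = ρ e^{2πiθ}` of the open unit disk. -/
def diskPoint (ρ : Set.Ico (0 : ℝ) 1) (θ : UnitAddCircle) : Complex.UnitDisc :=
  Complex.UnitDisc.mk (((ρ : ℝ) : ℂ) * (AddCircle.toCircle θ : ℂ)) (by
    rw [norm_mul, Circle.norm_coe, mul_one, Complex.norm_real, Real.norm_eq_abs,
      abs_of_nonneg ρ.2.1]
    exact ρ.2.2)

/-- The element `φ_{z,a}`, `z = ρ e^{2πiθ}`, of `PSL(2, ℝ)` with coordinates `(ρ, θ, a)`. -/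
def PSLCoord.toDiffeo (p : PSLCoord) : CircleDiffeo 1 := mobius (diskPoint p.1 p.2.1) p.2.2

/-- The Haar measure `4 ρ dρ dθ da / (1 - ρ²)²` of `PSL(2, ℝ)` in the coordinates `(ρ, θ, a)`. -/
def haarPSL : Measure PSLCoord :=
  (((volume : Measure ℝ).comap ((↑) : Set.Ico (0 : ℝ) 1 → ℝ)).withDensity
    (fun ρ => ENNReal.ofReal (4 * (ρ : ℝ) / (1 - (ρ : ℝ) ^ 2) ^ 2))).prod
      ((volume : Measure UnitAddCircle).prod (volume : Measure UnitAddCircle))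

/-! ### Orbital measures and the Schwarzian measure -/

/-- The Schwarzian derivative `(f''/f')' - (1/2) (f''/f')²`. -/
def schwarzian (f : ℝ → ℝ) (x : ℝ) : ℝ :=
  deriv (fun y => deriv (deriv f) y / deriv f y) x - 1 / 2 * (deriv (deriv f) x / deriv f x) ^ 2

/-- `exp {σ⁻² ∫_𝕋 [S_ψ(φ(τ)) + 2 α² (ψ'(φ(τ))² - 1)] φ'(τ)² dτ}`, with `α2` standing for `α²`. -/
def changeDensity (σ α2 : ℝ) (ψ : CircleDiffeo 3) (φ : CircleDiffeo 1) : ℝ≥0∞ :=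
  ENNReal.ofReal (Real.exp ((1 / σ ^ 2) * ∫ τ in (0 : ℝ)..1,
    (schwarzian ψ.lift (φ.lift τ) + 2 * α2 * (deriv ψ.lift (φ.lift τ) ^ 2 - 1)) *
      deriv φ.lift τ ^ 2))

/-- `μ` is an unquotiented Virasoro `α`-orbital measure (`α2` stands for `α²`): a Radon measure on
`Diff^1(𝕋)` such that, for every `ψ ∈ Diff^3(𝕋)`, the measure `ψ^*μ : A ↦ μ(ψ ∘ A)` has density
`changeDensity σ α2 ψ` with respect to `μ`. -/
structure IsOrbitalMeasure (σ α2 : ℝ) (μ : Measure (CircleDiffeo 1)) : Prop where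
  locallyFinite : IsLocallyFiniteMeasure μ
  innerRegular : μ.InnerRegular
  change_of_variables : ∀ (ψ : CircleDiffeo 3) (A : Set (CircleDiffeo 1)), MeasurableSet A →
    μ (CircleDiffeo.postcomp ψ '' A) = ∫⁻ φ in A, changeDensity σ α2 ψ φ ∂μ

/-- `L` is the lift to `Diff^1(𝕋)` of the measure `M` on `Diff^1(𝕋) / PSL(2, ℝ)`:
`∫ F dL = ∫ dM([φ]) ∫ dν_H(ψ) F(ψ ∘ φ)` for all continuous `F : Diff^1(𝕋) → [0, ∞]`. The inner
integral does not depend on the representative `φ`, as `ν_H` is bi-invariant. -/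
def IsPSLLift (M : Measure DiffModPSL) (L : Measure (CircleDiffeo 1)) : Prop :=
  ∀ F : CircleDiffeo 1 → ℝ≥0∞, Continuous F →
    ∫⁻ φ, F φ ∂L = ∫⁻ q, ∫⁻ p, F (CircleDiffeo.postcomp p.toDiffeo q.rep) ∂haarPSL ∂M

/-- The measure `exp {2 (α² - π²) σ⁻² ∫_𝕋 φ'² dτ} dL(φ)`: the `α`-orbital measure that belongs to
the `π`-orbital measure `L` (`α2` stands for `α²`). -/
def changeOrbit (σ α2 : ℝ) (L : Measure (CircleDiffeo 1)) : Measure (CircleDiffeo 1) :=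
  L.withDensity fun φ => ENNReal.ofReal (Real.exp
    (2 * (α2 - Real.pi ^ 2) / σ ^ 2 * ∫ τ in (0 : ℝ)..1, deriv φ.lift τ ^ 2))

/-- The pinned measure: the image of `μ` under `φ ↦ φ - φ(t₀)`. -/
def pinned (t₀ : UnitAddCircle) (μ : Measure (CircleDiffeo 1)) : Measure (CircleDiffeo 1) :=
  μ.map (CircleDiffeo.pin t₀)

/-- `M` is the Schwarzian measure with parameter `σ²` on `Diff^1(𝕋) / PSL(2, ℝ)`, and `L` is its
lift to `Diff^1(𝕋)`: `M` is finite, `L` is a `π`-orbital measure, and the normalisation is such that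
the corresponding `0`-orbital measure has total mass `1 / √(2πσ²)`. -/
structure IsSchwarzianMeasure (σ : ℝ) (M : Measure DiffModPSL) (L : Measure (CircleDiffeo 1)) :
    Prop where
  finite : IsFiniteMeasure M
  lift : IsPSLLift M L
  orbital : IsOrbitalMeasure σ (Real.pi ^ 2) L
  normalised : changeOrbit σ 0 L Set.univ = ENNReal.ofReal (1 / Real.sqrt (2 * Real.pi * σ ^ 2))

end SchwarzianTheory

end

open SchwarzianTheory

namespace SchwarzianTheory

/-! ### Basic properties of circle diffeomorphisms -/

/-! Limit formula. Put `l = 2 (π² - α²) / σ²`. Pinning is a rotation, so it does not change classes,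
and unfolding the lift turns the integral on the right into `∫ h_l F dM`, where `h_l(φ)`
(`haarWeight`) is the Haar integral of `exp (-l ∫ (ψ ∘ φ)'²)` over `ψ`. Everything rests on `l h_l ≤
1` (`haarWeight_le`) and `l h_l → 1` as `l → 0` (`tendsto_mul_haarWeight`). In the coordinate `u =
(1 + ρ²) / (1 - ρ²)` the Haar measure is `du dθ da`. For `z = ρ e(φ(s))` the energy of `φ_{z,a} ∘ φ`
is `∫ P_z(φ)² φ'²` with `P_z` the Poisson kernel; since `P_z²` has mass `u` and concentrates at
`φ(s)`, this energy is about `u φ'(s)`. Hence `h_l` is about `∫ φ'(s) ds ∫ exp (-l u φ'(s)) du`,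
which is about `1 / l`. Jensen's inequality makes the upper bound exact, and uniform continuity of
`φ'` gives the lower one. Fatou's lemma and the uniform bound then finish the argument, also for
infinite integrals. Since the lift is written with representatives, `h_l` must be shown to be
constant on orbits: `PSL(2, ℝ)` moves `z` by disk automorphisms, which preserve hyperbolic area
(`haarWeight_eq_of_rel`).

Total mass. With `F = 1` it remains to find the mass `Z(β)` of the `β`-orbital measure for `0 < β <
π`. Its derivative is `4 β / σ²` times the integrated energy. To compute the latter,
quasi-invariance under `x ↦ x + ε sin (2πnx - c) / (2πn)` is expanded to first order in `ε`, tested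
on `∫ cos (2πnφ - c)`. Adding the phases `c = 0` and `c = π / 2` gives, for the integral of `∬
φ'(s)² cos (2πn(φ(s) - φ(t))) ds dt`, the value `σ² Z / (4 (β² - π²n²))` (`integral_modePair`). Now
`2 ∑ cos (2πnx) = δ(x) - 1`, and `∬ φ'(s)² δ(φ(s) - φ(t)) ds dt = ∫ φ' = 1`, so twice the sum of the
left sides is the integral of `1 - ∫ φ'²`. On the right the cotangent series appears, and `Z - ∫
energy = (σ² / 2) Z (cot β - 1 / β) / (2 β)` (`measureReal_sub_integral_energy`).

This says that `Z (sin β / β) exp (-2 β² / σ²)` is constant; its value is read off at `β = 0` from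
the normalisation (`massRatio_eq`), and the pole of `1 / sin β` at `π` cancels the factor `π - β`.

To justify the summation, the delta function is replaced by the Poisson kernel of radius `r`, and
the constant `1` in the test function by `φ' / (φ' + δ)`, which keeps the Poisson average bounded by
`1 / δ`. One lets `r → 1` and afterwards `δ → 0`. -/

instance isProbabilityMeasure_unitAddCircle :
    IsProbabilityMeasure (volume : Measure UnitAddCircle) :=
  ⟨UnitAddCircle.measure_univ⟩

theorem integrable_of_continuous_circle {f : UnitAddCircle → ℝ} (hf : Continuous f) :
    Integrable f :=
  hf.integrable_of_hasCompactSupport (HasCompactSupport.of_compactSpace f)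

theorem intervalIntegral_circle (f : UnitAddCircle → ℝ) :
    ∫ x in (0 : ℝ)..1, f (x : UnitAddCircle) = ∫ t, f t := by
  simpa only [zero_add] using UnitAddCircle.intervalIntegral_preimage 0 f

namespace CircleDiffeo

variable {k : ℕ}

/-- The difference of two lifts is continuous and integer-valued, hence constant. This makes
derivatives independent of the choice hidden in `lift`. -/
theorem lift_eq_add_int (φ : CircleDiffeo k) {f : ℝ → ℝ} (hf : Continuous f)
    (h : ∀ x : ℝ, φ.toFun (x : UnitAddCircle) = (f x : ℝ)) : ∃ n : ℤ, ∀ x, φ.lift x = f x + n := by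
  have h1 : ∀ x : ℝ, ∃ n : ℤ, φ.lift x - f x = n := by
    intro x
    have h2 : ((φ.lift x - f x : ℝ) : UnitAddCircle) = 0 := by
      rw [AddCircle.coe_sub, ← h, ← φ.toFun_coe, sub_self]
    obtain ⟨n, hn⟩ := (AddCircle.coe_eq_zero_iff (p := (1 : ℝ))).1 h2
    exact ⟨n, by simpa using hn.symm⟩
  choose N hN using h1
  have hNc : Continuous N := by
    rw [Int.isClosedEmbedding_coe_real.isInducing.continuous_iff]
    have : (fun n : ℤ => (n : ℝ)) ∘ N = fun x => φ.lift x - f x := by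
      funext x
      simp [hN]
    exact this ▸ φ.isDiffeoLift.contDiff.continuous.sub hf
  refine ⟨N 0, fun x => ?_⟩
  have := PreconnectedSpace.constant inferInstance hNc (x := x) (y := 0)
  rw [← this, ← hN x]
  ring

theorem deriv_lift_eq (φ : CircleDiffeo k) {f : ℝ → ℝ} (hf : Continuous f)
    (h : ∀ x : ℝ, φ.toFun (x : UnitAddCircle) = (f x : ℝ)) : deriv φ.lift = deriv f := by
  obtain ⟨n, hn⟩ := φ.lift_eq_add_int hf h
  rw [funext hn]
  funext x
  simp

theorem derivative_coe (φ : CircleDiffeo k) (x : ℝ) :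
    φ.derivative (x : UnitAddCircle) = deriv φ.lift x := rfl

theorem derivative_pos (φ : CircleDiffeo k) (t : UnitAddCircle) : 0 < φ.derivative t := by
  obtain ⟨x, rfl⟩ := QuotientAddGroup.mk_surjective t
  exact φ.isDiffeoLift.deriv_pos x

theorem hasDerivAt_lift (φ : CircleDiffeo 1) (x : ℝ) :
    HasDerivAt φ.lift (φ.derivative (x : UnitAddCircle)) x :=
  ((φ.isDiffeoLift.contDiff.differentiable (by simp)) x).hasDerivAt

theorem postcomp_toFun {m : ℕ} [NeZero m] (ψ : CircleDiffeo m) (φ : CircleDiffeo 1)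
    (t : UnitAddCircle) : (postcomp ψ φ).toFun t = ψ.toFun (φ.toFun t) := rfl

theorem postcomp_derivative {m : ℕ} [NeZero m] (ψ : CircleDiffeo m) (φ : CircleDiffeo 1)
    (t : UnitAddCircle) :
    (postcomp ψ φ).derivative t = ψ.derivative (φ.toFun t) * φ.derivative t := by
  obtain ⟨x, rfl⟩ := QuotientAddGroup.mk_surjective t
  have hm : ((1 : ℕ) : WithTop ℕ∞) ≤ ((m : ℕ) : WithTop ℕ∞) := by
    exact_mod_cast NeZero.one_le
  have hψ := ψ.isDiffeoLift.contDiff.of_le hm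
  have hφ := φ.isDiffeoLift.contDiff
  have h := (postcomp ψ φ).deriv_lift_eq (f := ψ.lift ∘ φ.lift)
    (hψ.continuous.comp hφ.continuous) (fun x => by
      rw [postcomp_toFun, φ.toFun_coe, ψ.toFun_coe]; rfl)
  change deriv (postcomp ψ φ).lift x = ψ.derivative (φ.toFun (x : UnitAddCircle)) * deriv φ.lift x
  rw [h, φ.toFun_coe, ψ.derivative_coe,
    deriv_comp x ((hψ.differentiable (by simp)) _) ((hφ.differentiable (by simp)) _)]

/-- Substitution `s = φ(t)` on the circle. -/
theorem integral_comp_mul_derivative (φ : CircleDiffeo 1) {q : UnitAddCircle → ℝ}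
    (hq : Continuous q) : ∫ t, q (φ.toFun t) * φ.derivative t = ∫ t, q t := by
  rw [← UnitAddCircle.intervalIntegral_preimage 0,
    ← UnitAddCircle.intervalIntegral_preimage (φ.lift 0)]
  have h1 : φ.lift 0 + 1 = φ.lift (0 + 1) := (φ.isDiffeoLift.add_one 0).symm
  rw [h1, ← intervalIntegral.integral_comp_mul_deriv
    (g := fun x : ℝ => q (x : UnitAddCircle)) (f := φ.lift)
    (f' := fun x => φ.derivative (x : UnitAddCircle)) (fun x _ => φ.hasDerivAt_lift x)
    (φ.continuous_derivative.comp (AddCircle.continuous_mk' 1)).continuousOn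
    (hq.comp (AddCircle.continuous_mk' 1))]
  simp only [Function.comp_apply, φ.toFun_coe]

theorem integral_derivative (φ : CircleDiffeo 1) : ∫ t, φ.derivative t = 1 := by
  simpa using φ.integral_comp_mul_derivative (q := fun _ => 1) continuous_const

theorem strictMono_lift (φ : CircleDiffeo k) : StrictMono φ.lift :=
  strictMono_of_deriv_pos φ.isDiffeoLift.deriv_pos

theorem lift_add_int (φ : CircleDiffeo k) (x : ℝ) (n : ℤ) : φ.lift (x + n) = φ.lift x + n := by
  induction n using Int.induction_on with
  | zero => simp
  | succ n ih =>
    have := φ.isDiffeoLift.add_one (x + n)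
    push_cast at ih ⊢
    rw [← add_assoc, this, ih]; ring
  | pred n ih =>
    have := φ.isDiffeoLift.add_one (x + (-n - 1))
    push_cast at ih ⊢
    rw [show x + (-(n : ℝ) - 1) + 1 = x + -n by ring, ih] at this
    linarith

theorem surjective_lift (φ : CircleDiffeo k) : Function.Surjective φ.lift := by
  intro y
  have hc := φ.isDiffeoLift.contDiff.continuous
  set n := ⌊y - φ.lift 0⌋
  have h1 : φ.lift n ≤ y := by
    have := φ.lift_add_int 0 n
    rw [zero_add] at this
    rw [this]
    linarith [Int.floor_le (y - φ.lift 0)]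
  have h2 : y ≤ φ.lift (n + 1 : ℤ) := by
    have := φ.lift_add_int 0 (n + 1)
    rw [zero_add] at this
    rw [this]
    push_cast
    linarith [Int.lt_floor_add_one (y - φ.lift 0)]
  obtain ⟨x, -, hx⟩ := intermediate_value_Icc
    (show (n : ℝ) ≤ ((n + 1 : ℤ) : ℝ) by push_cast; linarith) hc.continuousOn ⟨h1, h2⟩
  exact ⟨x, hx⟩

/-- A circle diffeomorphism has an inverse in the same class. -/
theorem exists_inverse {m : ℕ} [NeZero m] (ψ : CircleDiffeo m) : ∃ χ : CircleDiffeo m,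
    (∀ t, ψ.toFun (χ.toFun t) = t) ∧ ∀ t, χ.toFun (ψ.toFun t) = t := by
  have hm : (m : WithTop ℕ∞) ≠ 0 := by exact_mod_cast NeZero.ne m
  let e : ℝ ≃ₜ ℝ := (ψ.strictMono_lift.orderIsoOfSurjective ψ.lift ψ.surjective_lift).toHomeomorph
  have he : ∀ x, e x = ψ.lift x := fun x => rfl
  have hd : ∀ x, HasDerivAt e (deriv ψ.lift x) x := fun x =>
    ((ψ.isDiffeoLift.contDiff.differentiable hm) x).hasDerivAt
  have hsc : ContDiff ℝ m e.symm :=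
    e.contDiff_symm_deriv (fun x => (ψ.isDiffeoLift.deriv_pos x).ne') hd ψ.isDiffeoLift.contDiff
  have hadd : ∀ x, e.symm (x + 1) = e.symm x + 1 := by
    intro x
    rw [e.symm_apply_eq, he, ψ.isDiffeoLift.add_one, ← he, e.apply_symm_apply]
  have hint : ∀ (n : ℤ) x, e.symm (x + n) = e.symm x + n := by
    intro n x
    rw [e.symm_apply_eq, he, ψ.lift_add_int, ← he, e.apply_symm_apply]
  have hper : Function.Periodic (fun x => ((e.symm x : ℝ) : UnitAddCircle)) 1 := by
    intro x
    simp only [hadd]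
    exact AddCircle.coe_add_period 1 _
  refine ⟨⟨hper.lift, e.symm, ⟨hsc, fun x => ?_, hadd⟩, fun x => rfl⟩, fun t => ?_, fun t => ?_⟩
  · have h := HasDerivAt.of_local_left_inverse (f := e) (g := e.symm) (a := x)
      e.symm.continuous.continuousAt (hd _) (ψ.isDiffeoLift.deriv_pos _).ne'
      (Eventually.of_forall e.apply_symm_apply)
    rw [h.deriv]
    exact inv_pos.2 (ψ.isDiffeoLift.deriv_pos _)
  · obtain ⟨x, rfl⟩ := QuotientAddGroup.mk_surjective t
    change ψ.toFun ((e.symm x : ℝ) : UnitAddCircle) = (x : UnitAddCircle)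
    rw [ψ.toFun_coe, ← he, e.apply_symm_apply]
  · obtain ⟨x, rfl⟩ := QuotientAddGroup.mk_surjective t
    change hper.lift (ψ.toFun (x : UnitAddCircle)) = (x : UnitAddCircle)
    rw [ψ.toFun_coe, ← he]
    change ((e.symm (e x) : ℝ) : UnitAddCircle) = (x : UnitAddCircle)
    rw [e.symm_apply_apply]

/-- Surjectivity lets the images in `change_of_variables` be exchanged for preimages, and so for a
push-forward of measures. -/
theorem postcomp_bijective {m : ℕ} [NeZero m] (ψ : CircleDiffeo m) :
    Function.Bijective (postcomp ψ) := by
  obtain ⟨χ, h1, h2⟩ := ψ.exists_inverse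
  refine Function.bijective_iff_has_inverse.2 ⟨postcomp χ, fun φ => ?_, fun φ => ?_⟩
  · ext t
    simp [postcomp_toFun, h2]
  · ext t
    simp [postcomp_toFun, h1]

/-! ### Continuity in the `C^1` topology -/

/-- The pair `(φ, φ')` as a continuous function. -/
noncomputable def jet (φ : CircleDiffeo 1) : C(UnitAddCircle, UnitAddCircle × ℝ) :=
  ⟨fun t => (φ.toFun t, φ.derivative t), φ.continuous_toFun.prodMk φ.continuous_derivative⟩

theorem isInducing_coordinates : IsInducing
    (fun φ : CircleDiffeo 1 => ((⟨φ.toFun, φ.continuous_toFun⟩,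
      ⟨φ.derivative, φ.continuous_derivative⟩) :
      C(UnitAddCircle, UnitAddCircle) × C(UnitAddCircle, ℝ))) := ⟨rfl⟩

instance : FirstCountableTopology (CircleDiffeo 1) :=
  isInducing_coordinates.firstCountableTopology

theorem continuous_jet : Continuous jet := by
  have h : (jet : CircleDiffeo 1 → _) =
      (fun p : C(UnitAddCircle, UnitAddCircle) × C(UnitAddCircle, ℝ) => p.1.prodMk p.2) ∘
      (fun φ : CircleDiffeo 1 => ((⟨φ.toFun, φ.continuous_toFun⟩,
      ⟨φ.derivative, φ.continuous_derivative⟩) :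
      C(UnitAddCircle, UnitAddCircle) × C(UnitAddCircle, ℝ))) := rfl
  rw [h]
  refine (ContinuousMap.continuous_of_continuous_uncurry _ ?_).comp
    isInducing_coordinates.continuous
  exact (continuous_eval.comp ((continuous_fst.comp continuous_fst).prodMk continuous_snd)).prodMk
    (continuous_eval.comp ((continuous_snd.comp continuous_fst).prodMk continuous_snd))

theorem continuous_integral_circle :
    Continuous fun f : C(UnitAddCircle, ℝ) => ∫ t, f t := by
  refine (LipschitzWith.of_dist_le_mul (K := 1) fun f g => ?_).continuous
  rw [dist_eq_norm, dist_eq_norm, ← integral_sub (integrable_of_continuous_circle f.continuous)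
    (integrable_of_continuous_circle g.continuous)]
  have := norm_integral_le_of_norm_le_const (μ := (volume : Measure UnitAddCircle))
    (f := fun t => f t - g t) (C := ‖f - g‖)
    (Eventually.of_forall fun t => (f - g).norm_coe_le_norm t)
  simpa using this

/-- Integrals of continuous functions of `(φ, φ')` depend continuously on `φ`. -/
theorem continuous_integral_comp {K : UnitAddCircle × ℝ → ℝ} (hK : Continuous K) :
    Continuous fun φ : CircleDiffeo 1 => ∫ t, K (φ.toFun t, φ.derivative t) :=
  continuous_integral_circle.comp
    ((ContinuousMap.continuous_postcomp (⟨K, hK⟩ : C(UnitAddCircle × ℝ, ℝ))).comp continuous_jet)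

/-- Same as `continuous_integral_comp` for functions that are only continuous where the second
variable is positive. -/
theorem continuous_integral_comp_of_pos {K : UnitAddCircle → ℝ → ℝ}
    (hK : Continuous fun p : UnitAddCircle × ℝ => K p.1 |p.2|) :
    Continuous fun φ : CircleDiffeo 1 => ∫ t, K (φ.toFun t) (φ.derivative t) := by
  refine (continuous_integral_comp hK).congr fun φ => ?_
  simp only [abs_of_pos (φ.derivative_pos _)]

theorem continuous_postcomp {m : ℕ} [NeZero m] (ψ : CircleDiffeo m)
    (hψ : Continuous ψ.derivative) : Continuous (postcomp ψ) := by
  rw [isInducing_coordinates.continuous_iff]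
  have h1 : Continuous fun p : UnitAddCircle × ℝ => ψ.derivative p.1 * p.2 := by fun_prop
  exact ((ContinuousMap.continuous_postcomp
      (⟨fun p => ψ.toFun p.1, ψ.continuous_toFun.comp continuous_fst⟩ :
        C(UnitAddCircle × ℝ, UnitAddCircle))).comp continuous_jet).prodMk
    (((ContinuousMap.continuous_postcomp
      (⟨_, h1⟩ : C(UnitAddCircle × ℝ, ℝ))).comp continuous_jet).congr fun φ => by
        ext t
        exact (postcomp_derivative ψ φ t).symm)

theorem pin_derivative (t₀ : UnitAddCircle) (φ : CircleDiffeo 1) :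
    (pin t₀ φ).derivative = φ.derivative := by
  funext t
  obtain ⟨x, rfl⟩ := QuotientAddGroup.mk_surjective t
  obtain ⟨x₀, rfl⟩ := QuotientAddGroup.mk_surjective t₀
  have h := (pin (x₀ : UnitAddCircle) φ).deriv_lift_eq (f := fun x => φ.lift x - φ.lift x₀)
    (φ.isDiffeoLift.contDiff.continuous.sub continuous_const) (fun x => by
      rw [AddCircle.coe_sub, ← φ.toFun_coe, ← φ.toFun_coe]; rfl)
  change deriv _ x = deriv _ x
  rw [h]
  simp

theorem continuous_pin (t₀ : UnitAddCircle) : Continuous (pin t₀) := by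
  rw [isInducing_coordinates.continuous_iff]
  have hfst : Continuous fun φ : CircleDiffeo 1 =>
      (⟨φ.toFun, φ.continuous_toFun⟩ : C(UnitAddCircle, UnitAddCircle)) :=
    continuous_fst.comp isInducing_coordinates.continuous
  have hsnd : Continuous fun φ : CircleDiffeo 1 =>
      (⟨φ.derivative, φ.continuous_derivative⟩ : C(UnitAddCircle, ℝ)) :=
    continuous_snd.comp isInducing_coordinates.continuous
  refine Continuous.prodMk ?_ (hsnd.congr fun φ => ?_)
  · have h1 : Continuous fun φ : CircleDiffeo 1 => φ.toFun t₀ :=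
      (continuous_eval_const t₀).comp hfst
    exact hfst.sub (ContinuousMap.continuous_const'.comp h1)
  · ext t
    exact congrFun (pin_derivative t₀ φ).symm t

/-- The energy `∫_𝕋 φ'² dτ`. -/
noncomputable def energy (φ : CircleDiffeo 1) : ℝ := ∫ t, φ.derivative t ^ 2

theorem energy_eq (φ : CircleDiffeo 1) : energy φ = ∫ τ in (0 : ℝ)..1, deriv φ.lift τ ^ 2 := by
  rw [energy, ← intervalIntegral_circle]
  simp only [derivative_coe]

theorem continuous_energy : Continuous energy :=
  continuous_integral_comp (K := fun p => p.2 ^ 2) (by fun_prop)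

theorem energy_nonneg (φ : CircleDiffeo 1) : 0 ≤ energy φ :=
  integral_nonneg fun _ => sq_nonneg _

end CircleDiffeo

/-! ### The Poisson kernel -/

/-- The Poisson kernel of the unit disk. -/
noncomputable def poisson (z : ℂ) (t : UnitAddCircle) : ℝ :=
  (1 - Complex.normSq z) /
    Complex.normSq (1 - z * starRingEnd ℂ (AddCircle.toCircle t : ℂ))

theorem conj_toCircle_coe (x : ℝ) :
    starRingEnd ℂ (AddCircle.toCircle (x : UnitAddCircle) : ℂ) =
      Complex.exp (-(2 * Real.pi * x * Complex.I)) := by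
  rw [AddCircle.toCircle_apply_mk, Circle.coe_exp, ← Complex.exp_conj]
  congr 1
  simp only [map_mul, Complex.conj_ofReal, Complex.conj_I]
  push_cast
  ring

theorem normSq_toCircle (t : UnitAddCircle) :
    Complex.normSq (AddCircle.toCircle t : ℂ) = 1 := by
  rw [Complex.normSq_eq_norm_sq, Circle.norm_coe, one_pow]

theorem normSq_lt_one {z : ℂ} (hz : ‖z‖ < 1) : Complex.normSq z < 1 := by
  rw [Complex.normSq_eq_norm_sq]
  nlinarith [norm_nonneg z]

theorem poisson_denom_pos {z : ℂ} (hz : ‖z‖ < 1) (t : UnitAddCircle) :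
    0 < Complex.normSq (1 - z * starRingEnd ℂ (AddCircle.toCircle t : ℂ)) := by
  refine Complex.normSq_pos.2 fun h => ?_
  have h1 : ‖z * starRingEnd ℂ (AddCircle.toCircle t : ℂ)‖ = 1 := by
    rw [← sub_eq_zero.1 h, norm_one]
  rw [norm_mul, RCLike.norm_conj, Circle.norm_coe, mul_one] at h1
  exact hz.ne h1

theorem poisson_pos {z : ℂ} (hz : ‖z‖ < 1) (t : UnitAddCircle) : 0 < poisson z t :=
  div_pos (by linarith [normSq_lt_one hz]) (poisson_denom_pos hz t)

theorem continuous_poisson_comp {X : Type*} [TopologicalSpace X] {z : X → ℂ}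
    {t : X → UnitAddCircle} (hz : Continuous z) (hz1 : ∀ x, ‖z x‖ < 1) (ht : Continuous t) :
    Continuous fun x => poisson (z x) (t x) := by
  unfold poisson
  refine Continuous.div ?_ ?_ fun x => (poisson_denom_pos (hz1 x) _).ne'
  · exact continuous_const.sub (Complex.continuous_normSq.comp hz)
  · refine Complex.continuous_normSq.comp (continuous_const.sub (hz.mul ?_))
    exact Complex.continuous_conj.comp
      (continuous_subtype_val.comp (AddCircle.continuous_toCircle.comp ht))

theorem continuous_poisson {z : ℂ} (hz : ‖z‖ < 1) : Continuous (poisson z) :=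
  continuous_poisson_comp continuous_const (fun _ => hz) continuous_id

theorem norm_ofReal_mul_toCircle {ρ : ℝ} (h0 : 0 ≤ ρ) (h1 : ρ < 1) (θ : UnitAddCircle) :
    ‖(ρ : ℂ) * (AddCircle.toCircle θ : ℂ)‖ < 1 := by
  rw [norm_mul, Circle.norm_coe, mul_one, Complex.norm_real, Real.norm_eq_abs, abs_of_nonneg h0]
  exact h1

theorem normSq_ofReal_mul_toCircle (ρ : ℝ) (θ : UnitAddCircle) :
    Complex.normSq ((ρ : ℂ) * (AddCircle.toCircle θ : ℂ)) = ρ ^ 2 := by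
  rw [Complex.normSq_mul, normSq_toCircle, Complex.normSq_ofReal]
  ring

/-- The two denominators are squared moduli of conjugate numbers. This allows integration over the
angle of `z` instead of the boundary point. -/
theorem poisson_symm (ρ : ℝ) (s t : UnitAddCircle) :
    poisson (ρ * (AddCircle.toCircle s : ℂ)) t = poisson (ρ * (AddCircle.toCircle t : ℂ)) s := by
  unfold poisson
  rw [normSq_ofReal_mul_toCircle, normSq_ofReal_mul_toCircle]
  congr 1
  rw [← Complex.normSq_conj]
  congr 1
  simp only [map_sub, map_mul, map_one, Complex.conj_ofReal, Complex.conj_conj]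
  ring

/-- `1 - cos (2π (s - t))`. -/
noncomputable def gap (s t : UnitAddCircle) : ℝ :=
  1 - ((AddCircle.toCircle s : ℂ) * starRingEnd ℂ (AddCircle.toCircle t : ℂ)).re

theorem continuous_gap : Continuous fun p : UnitAddCircle × UnitAddCircle => gap p.1 p.2 := by
  have h : Continuous fun t : UnitAddCircle => (AddCircle.toCircle t : ℂ) :=
    continuous_subtype_val.comp AddCircle.continuous_toCircle
  unfold gap
  exact continuous_const.sub (Complex.continuous_re.comp
    ((h.comp continuous_fst).mul (Complex.continuous_conj.comp (h.comp continuous_snd))))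

theorem gap_eq (s t : UnitAddCircle) : gap s t =
    Complex.normSq ((AddCircle.toCircle s : ℂ) - (AddCircle.toCircle t : ℂ)) / 2 := by
  rw [Complex.normSq_sub, normSq_toCircle, normSq_toCircle, gap]
  ring

theorem gap_nonneg (s t : UnitAddCircle) : 0 ≤ gap s t := by
  rw [gap_eq]
  exact div_nonneg (Complex.normSq_nonneg _) (by norm_num)

theorem gap_pos {s t : UnitAddCircle} (h : s ≠ t) : 0 < gap s t := by
  rw [gap_eq]
  refine div_pos (Complex.normSq_pos.2 fun h0 => h ?_) (by norm_num)
  exact AddCircle.injective_toCircle one_ne_zero (Subtype.ext (sub_eq_zero.1 h0))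

/-- The denominator of the kernel is `(1 - ρ)² + 2 ρ gap`; dropping the square gives the bound. It
is the quantitative form of the concentration of the kernel on the diagonal as `ρ → 1`. -/
theorem poisson_mul_gap_le {ρ : ℝ} (h0 : 0 < ρ) (h1 : ρ < 1) (s t : UnitAddCircle) :
    poisson (ρ * (AddCircle.toCircle s : ℂ)) t * gap s t ≤ (1 - ρ ^ 2) / (2 * ρ) := by
  have hD := poisson_denom_pos (norm_ofReal_mul_toCircle h0.le h1 s) t
  have hD' : Complex.normSq (1 - ρ * (AddCircle.toCircle s : ℂ) *
      starRingEnd ℂ (AddCircle.toCircle t : ℂ)) = (1 - ρ) ^ 2 + 2 * ρ * gap s t := by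
    rw [Complex.normSq_sub, mul_assoc, Complex.normSq_mul, Complex.normSq_mul, Complex.normSq_conj,
      normSq_toCircle, normSq_toCircle, Complex.normSq_ofReal, gap]
    simp
    ring
  unfold poisson
  rw [normSq_ofReal_mul_toCircle, div_mul_eq_mul_div, div_le_div_iff₀ hD (by linarith), hD',
    mul_assoc]
  have : 0 ≤ 1 - ρ ^ 2 := by nlinarith
  refine mul_le_mul_of_nonneg_left ?_ this
  nlinarith [sq_nonneg (1 - ρ)]

/-! ### Möbius transformations and their energies -/

theorem mobius_toFun_coe (z : Complex.UnitDisc) (b x : ℝ) :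
    (mobius z (b : UnitAddCircle)).toFun (x : UnitAddCircle) = ((b + diskAngle z x : ℝ)) := by
  change (b : UnitAddCircle) + _ = _
  rw [AddCircle.coe_add]
  congr 1
  have hn : ‖diskMap z (x : UnitAddCircle)‖ = 1 := by
    rw [diskMap_coe, Complex.norm_exp_ofReal_mul_I]
  have h := Complex.norm_mul_exp_arg_mul_I (diskMap z (x : UnitAddCircle))
  rw [hn, Complex.ofReal_one, one_mul] at h
  nth_rewrite 2 [diskMap_coe] at h
  obtain ⟨n, hn⟩ := Complex.exp_eq_exp_iff_exists_int.1 h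
  have hre : Complex.arg (diskMap z (x : UnitAddCircle)) =
      2 * Real.pi * diskAngle z x + n * (2 * Real.pi) := by
    simpa using congrArg Complex.im hn
  have hq : Complex.arg (diskMap z (x : UnitAddCircle)) / (2 * Real.pi) =
      diskAngle z x + n := by
    rw [hre]; field_simp
  rw [hq, AddCircle.coe_add, add_eq_left, AddCircle.coe_eq_zero_iff]
  exact ⟨n, by simp⟩

theorem mobius_derivative (z : Complex.UnitDisc) (a t : UnitAddCircle) :
    (mobius z a).derivative t = poisson z t := by
  obtain ⟨x, rfl⟩ := QuotientAddGroup.mk_surjective t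
  obtain ⟨b, rfl⟩ := QuotientAddGroup.mk_surjective a
  have h := (mobius z (b : UnitAddCircle)).deriv_lift_eq (f := fun x => b + diskAngle z x)
    (continuous_const.add (isDiffeoLift_diskAngle z).contDiff.continuous) (mobius_toFun_coe z b)
  change deriv (mobius z (b : UnitAddCircle)).lift x = poisson z (x : UnitAddCircle)
  rw [h, deriv_const_add, (hasDerivAt_diskAngle z x).deriv, poisson, conj_toCircle_coe]
  have hn : Complex.normSq (z : ℂ) =
      Complex.normSq ((z : ℂ) * Complex.exp (-(2 * Real.pi * x * Complex.I))) := by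
    rw [Complex.normSq_mul, ← conj_toCircle_coe, Complex.normSq_conj, normSq_toCircle, mul_one]
  rw [hn]
  have hlt := norm_mul_exp_lt z x
  set u : ℂ := (z : ℂ) * Complex.exp (-(2 * Real.pi * x * Complex.I))
  have hne : 1 - u ≠ 0 := by
    intro h
    rw [← sub_eq_zero.1 h] at hlt
    simp at hlt
  have hpos : 0 < Complex.normSq (1 - u) := Complex.normSq_pos.2 hne
  have hpi := Real.pi_pos
  rw [Complex.div_im]
  simp only [Complex.mul_re, Complex.mul_im, Complex.I_re, Complex.I_im, Complex.ofReal_re,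
    Complex.ofReal_im, Complex.sub_re, Complex.sub_im, Complex.one_re, Complex.one_im,
    Complex.re_ofNat, Complex.im_ofNat]
  field_simp
  simp only [Complex.normSq_apply, Complex.sub_re, Complex.sub_im, Complex.one_re,
    Complex.one_im]
  ring

/-- The Poisson kernel is the derivative of a circle diffeomorphism, namely of a Möbius map. -/
theorem integral_poisson {z : ℂ} (hz : ‖z‖ < 1) : ∫ t, poisson z t = 1 := by
  refine Eq.trans ?_ (mobius (Complex.UnitDisc.mk z hz) 0).integral_derivative
  refine integral_congr_ae (Eventually.of_forall fun t => ?_)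
  simp only [mobius_derivative, Complex.UnitDisc.coe_mk]

theorem integral_poisson_sq {z : ℂ} (hz : ‖z‖ < 1) :
    ∫ t, poisson z t ^ 2 = (1 + Complex.normSq z) / (1 - Complex.normSq z) := by
  have hR : 0 < 1 - Complex.normSq z := by linarith [normSq_lt_one hz]
  set R := Complex.normSq z with hRdef
  let u : ℝ → ℂ := fun x => z * Complex.exp (-(2 * Real.pi * x * Complex.I))
  have hu : ∀ x, HasDerivAt u (-(2 * Real.pi * Complex.I) * u x) x := by
    intro x
    have h0 : HasDerivAt (fun y : ℝ => -(2 * (Real.pi : ℂ) * y * Complex.I))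
        (-(2 * (Real.pi : ℂ) * 1 * Complex.I)) x :=
      (((Complex.ofRealCLM.hasDerivAt (x := x)).const_mul _).mul_const _).neg
    refine ((h0.cexp).const_mul z).congr_deriv ?_
    simp only [u]
    ring
  have hre : ∀ x, HasDerivAt (fun x => (u x).re) (2 * Real.pi * (u x).im) x := by
    intro x
    refine (Complex.reCLM.hasFDerivAt.comp_hasDerivAt x (hu x)).congr_deriv ?_
    simp
  have him : ∀ x, HasDerivAt (fun x => (u x).im) (-(2 * Real.pi * (u x).re)) x := by
    intro x
    refine (Complex.imCLM.hasFDerivAt.comp_hasDerivAt x (hu x)).congr_deriv ?_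
    simp
  have hu2 : ∀ x, (u x).re ^ 2 + (u x).im ^ 2 = R := by
    intro x
    have : Complex.normSq (u x) = R := by
      simp only [u]
      rw [Complex.normSq_mul, ← conj_toCircle_coe, Complex.normSq_conj, normSq_toCircle, mul_one]
    rw [← this, Complex.normSq_apply]; ring
  have hP : ∀ x : ℝ, poisson z (x : UnitAddCircle) = (1 - R) / (1 + R - 2 * (u x).re) := by
    intro x
    rw [poisson, conj_toCircle_coe, ← hu2 x, Complex.normSq_sub, ← hRdef, ← hu2 x]
    simp only [map_one, one_mul, Complex.normSq_apply, Complex.conj_re]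
    congr 1
    simp only [u]
    ring
  have hDpos : ∀ x : ℝ, 0 < 1 + R - 2 * (u x).re := by
    intro x
    have h1 := poisson_pos hz (x : UnitAddCircle)
    rw [hP] at h1
    exact (div_pos_iff_of_pos_left hR).1 h1
  -- Up to the factor `π`, this periodic function is a primitive of a combination of `P` and `P²`,
  -- so integrating over a period expresses `∫ P²` through `∫ P = 1`.
  let f : ℝ → ℝ := fun x => (u x).im / (1 + R - 2 * (u x).re)
  have hf : ∀ x : ℝ, HasDerivAt f (Real.pi * ((1 + R) / (1 - R) * poisson z (x : UnitAddCircle) -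
      poisson z (x : UnitAddCircle) ^ 2)) x := by
    intro x
    refine ((him x).div (((hre x).const_mul 2).const_sub (1 + R)) (hDpos x).ne').congr_deriv ?_
    have h1 := (hDpos x).ne'
    have h2 := hu2 x
    rw [hP]
    field_simp
    linear_combination (4 : ℝ) * h2
  have hper : f 1 = f 0 := by
    have : u 1 = u 0 := by
      simp only [u]
      rw [← conj_toCircle_coe, ← conj_toCircle_coe]
      congr 4
      exact (AddCircle.coe_period 1)
    simp only [f, this]
  have hc := (continuous_poisson hz)
  have hcc : Continuous fun x : ℝ => poisson z (x : UnitAddCircle) :=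
    hc.comp (AddCircle.continuous_mk' 1)
  have hI := intervalIntegral.integral_eq_sub_of_hasDerivAt (a := 0) (b := 1)
    (fun x _ => hf x) (Continuous.intervalIntegrable (by fun_prop) _ _)
  rw [hper, sub_self, intervalIntegral_circle
    (fun t => Real.pi * ((1 + R) / (1 - R) * poisson z t - poisson z t ^ 2)),
    integral_const_mul, integral_sub (integrable_of_continuous_circle (by fun_prop))
    (integrable_of_continuous_circle (by fun_prop)), integral_const_mul, integral_poisson hz] at hI
  have := (mul_eq_zero.1 hI).resolve_left Real.pi_ne_zero
  linarith

/-- The energy of `φ_{z,a} ∘ φ`, which does not depend on `a`. -/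
noncomputable def diskEnergy (φ : CircleDiffeo 1) (z : ℂ) : ℝ :=
  ∫ t, (poisson z (φ.toFun t) * φ.derivative t) ^ 2

theorem energy_postcomp_mobius (φ : CircleDiffeo 1) (z : Complex.UnitDisc) (a : UnitAddCircle) :
    (CircleDiffeo.postcomp (mobius z a) φ).energy = diskEnergy φ z := by
  simp only [CircleDiffeo.energy, diskEnergy, CircleDiffeo.postcomp_derivative, mobius_derivative]

/-! ### Integration against the Haar measure -/

theorem measurable_toCircle_coe : Measurable fun t : UnitAddCircle => (AddCircle.toCircle t : ℂ) :=
  (continuous_subtype_val.comp AddCircle.continuous_toCircle).measurable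

theorem measurable_poisson :
    Measurable fun p : ℂ × UnitAddCircle => poisson p.1 p.2 := by
  unfold poisson
  have h1 : Measurable fun p : ℂ × UnitAddCircle => (AddCircle.toCircle p.2 : ℂ) :=
    measurable_toCircle_coe.comp measurable_snd
  have h2 : Measurable fun p : ℂ × UnitAddCircle =>
      starRingEnd ℂ (AddCircle.toCircle p.2 : ℂ) :=
    Complex.continuous_conj.measurable.comp h1
  exact (measurable_const.sub (Complex.continuous_normSq.measurable.comp measurable_fst)).div
    (Complex.continuous_normSq.measurable.comp (measurable_const.sub (measurable_fst.mul h2)))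

theorem measurable_diskEnergy (φ : CircleDiffeo 1) : Measurable (diskEnergy φ) := by
  have h : Measurable fun p : ℂ × UnitAddCircle =>
      (poisson p.1 (φ.toFun p.2) * φ.derivative p.2) ^ 2 :=
    ((measurable_poisson.comp (measurable_fst.prodMk
      (φ.continuous_toFun.measurable.comp measurable_snd))).mul
      (φ.continuous_derivative.measurable.comp measurable_snd)).pow_const 2
  exact (StronglyMeasurable.integral_prod_right' (ν := (volume : Measure UnitAddCircle))
    h.stronglyMeasurable).measurable

theorem lintegral_haarPSL {f : ℂ → ℝ≥0∞} (hf : Measurable f) :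
    ∫⁻ p, f (diskPoint p.1 p.2.1) ∂haarPSL = ∫⁻ ρ in Set.Ico (0 : ℝ) 1,
      ENNReal.ofReal (4 * ρ / (1 - ρ ^ 2) ^ 2) *
        ∫⁻ θ : UnitAddCircle, f (ρ * (AddCircle.toCircle θ : ℂ)) := by
  have hcoe : ∀ ρ θ, ((diskPoint ρ θ : Complex.UnitDisc) : ℂ) =
      ((ρ : ℝ) : ℂ) * (AddCircle.toCircle θ : ℂ) := fun _ _ => rfl
  have hm : Measurable fun p : ℝ × UnitAddCircle => f (p.1 * (AddCircle.toCircle p.2 : ℂ)) :=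
    hf.comp ((Complex.continuous_ofReal.measurable.comp measurable_fst).mul
      (measurable_toCircle_coe.comp measurable_snd))
  have hm1 : Measurable fun p : PSLCoord => f (diskPoint p.1 p.2.1) :=
    hm.comp ((measurable_subtype_coe.comp measurable_fst).prodMk
      (measurable_fst.comp measurable_snd))
  have hd : Measurable fun ρ : ℝ => ENNReal.ofReal (4 * ρ / (1 - ρ ^ 2) ^ 2) := by fun_prop
  have hin : Measurable fun ρ : ℝ => ∫⁻ θ : UnitAddCircle, f (ρ * (AddCircle.toCircle θ : ℂ)) :=
    hm.lintegral_prod_right'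
  unfold haarPSL
  rw [lintegral_prod _ hm1.aemeasurable]
  have hinner : ∀ ρ : Set.Ico (0 : ℝ) 1, ∫⁻ q : UnitAddCircle × UnitAddCircle,
      f (diskPoint ρ q.1) ∂((volume : Measure UnitAddCircle).prod volume) =
      ∫⁻ θ : UnitAddCircle, f (((ρ : ℝ) : ℂ) * (AddCircle.toCircle θ : ℂ)) := by
    intro ρ
    rw [lintegral_prod (fun q : UnitAddCircle × UnitAddCircle => f (diskPoint ρ q.1))
      (hm1.comp measurable_prodMk_left).aemeasurable]
    simp [hcoe]
  simp only [hinner]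
  refine (lintegral_withDensity_eq_lintegral_mul _ (hd.comp measurable_subtype_coe)
    (hin.comp measurable_subtype_coe)).trans ?_
  exact lintegral_subtype_comap measurableSet_Ico (fun ρ : ℝ =>
    ENNReal.ofReal (4 * ρ / (1 - ρ ^ 2) ^ 2) *
        ∫⁻ θ : UnitAddCircle, f (ρ * (AddCircle.toCircle θ : ℂ)))

/-- The radial coordinate `(1 + ρ²) / (1 - ρ²)`, which is the energy of `φ_{z,a}`. -/
noncomputable def radial (ρ : ℝ) : ℝ := (1 + ρ ^ 2) / (1 - ρ ^ 2)

theorem measurable_radial : Measurable radial := by unfold radial; fun_prop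

theorem one_sub_sq_pos {ρ : ℝ} (h0 : 0 ≤ ρ) (h1 : ρ < 1) : 0 < 1 - ρ ^ 2 := by nlinarith

theorem one_le_radial {ρ : ℝ} (h0 : 0 ≤ ρ) (h1 : ρ < 1) : 1 ≤ radial ρ := by
  rw [radial, le_div_iff₀ (one_sub_sq_pos h0 h1)]
  nlinarith

theorem image_radial {a : ℝ} (h0 : 0 ≤ a) (h1 : a < 1) :
    radial '' Set.Ico a 1 = Set.Ici (radial a) := by
  have ha := one_sub_sq_pos h0 h1
  ext u
  constructor
  · rintro ⟨ρ, ⟨h2, h3⟩, rfl⟩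
    have := one_sub_sq_pos (h0.trans h2) h3
    simp only [radial, Set.mem_Ici]
    rw [div_le_div_iff₀ ha this]
    nlinarith
  · intro hu
    have hu' : radial a ≤ u := hu
    have hu1 : 1 ≤ u := (one_le_radial h0 h1).trans hu'
    have hq0 : 0 ≤ (u - 1) / (u + 1) := div_nonneg (by linarith) (by linarith)
    refine ⟨√((u - 1) / (u + 1)), ⟨?_, ?_⟩, ?_⟩
    · refine Real.le_sqrt_of_sq_le ?_
      rw [le_div_iff₀ (by linarith)]
      rw [radial, div_le_iff₀ ha] at hu'
      nlinarith
    · rw [Real.sqrt_lt' one_pos, div_lt_iff₀ (by linarith)]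
      linarith
    · rw [radial, Real.sq_sqrt hq0]
      have : u + 1 ≠ 0 := by linarith
      field_simp
      ring

theorem injOn_radial : Set.InjOn radial (Set.Ico 0 1) := by
  rintro x ⟨h0, h1⟩ y ⟨h2, h3⟩ h
  have hx := one_sub_sq_pos h0 h1
  have hy := one_sub_sq_pos h2 h3
  rw [radial, radial, div_eq_div_iff hx.ne' hy.ne'] at h
  have : x ^ 2 = y ^ 2 := by linarith
  exact (pow_left_inj₀ h0 h2 two_ne_zero).1 this

theorem hasDerivAt_radial {ρ : ℝ} (h0 : 0 ≤ ρ) (h1 : ρ < 1) :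
    HasDerivAt radial (4 * ρ / (1 - ρ ^ 2) ^ 2) ρ := by
  have h := one_sub_sq_pos h0 h1
  have h2 : HasDerivAt (fun x : ℝ => x ^ 2) (2 * ρ) ρ := by simpa using hasDerivAt_pow 2 ρ
  refine ((h2.const_add 1).div (h2.const_sub 1) h.ne').congr_deriv ?_
  congr 1
  ring

/-- The Haar density `4 ρ / (1 - ρ²)²` is the derivative of `radial`, so the substitution `u =
radial ρ` leaves a plain exponential integral over a half-line. -/
theorem lintegral_radial {a : ℝ} (h0 : 0 ≤ a) (h1 : a < 1) {k : ℝ} (hk : 0 < k) :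
    ∫⁻ ρ in Set.Ico a 1, ENNReal.ofReal (4 * ρ / (1 - ρ ^ 2) ^ 2) *
      ENNReal.ofReal (Real.exp (-(k * radial ρ))) =
      ENNReal.ofReal (Real.exp (-(k * radial a)) / k) := by
  have h := lintegral_image_eq_lintegral_abs_deriv_mul (f := radial)
    (f' := fun ρ => 4 * ρ / (1 - ρ ^ 2) ^ 2) (s := Set.Ico a 1) measurableSet_Ico
    (fun ρ hρ => (hasDerivAt_radial (h0.trans hρ.1) hρ.2).hasDerivWithinAt)
    (injOn_radial.mono (Set.Ico_subset_Ico_left h0))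
    (fun u => ENNReal.ofReal (Real.exp (-(k * u))))
  rw [image_radial h0 h1] at h
  have h2 : ∫⁻ ρ in Set.Ico a 1, ENNReal.ofReal (4 * ρ / (1 - ρ ^ 2) ^ 2) *
      ENNReal.ofReal (Real.exp (-(k * radial ρ))) = ∫⁻ ρ in Set.Ico a 1,
      ENNReal.ofReal |4 * ρ / (1 - ρ ^ 2) ^ 2| *
      ENNReal.ofReal (Real.exp (-(k * radial ρ))) := by
    refine setLIntegral_congr_fun measurableSet_Ico fun ρ hρ => ?_
    have : 0 ≤ ρ := h0.trans hρ.1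
    rw [abs_of_nonneg (by positivity)]
  rw [h2, ← h, setLIntegral_congr Ioi_ae_eq_Ici.symm]
  have h3 := integral_exp_mul_Ioi (a := -k) (by linarith) (radial a)
  have h4 := integrableOn_exp_mul_Ioi (a := -k) (by linarith) (radial a)
  simp only [← neg_mul]
  rw [← ofReal_integral_eq_lintegral_ofReal h4
    (Eventually.of_forall fun u => (Real.exp_pos _).le), h3]
  congr 1
  field_simp

/-! ### Bounds on the Haar integral of the Gibbs weight -/

namespace CircleDiffeo

theorem injective_toFun (φ : CircleDiffeo 1) : Function.Injective φ.toFun := by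
  obtain ⟨χ, -, h⟩ := φ.exists_inverse
  exact Function.LeftInverse.injective h

/-- Where `|f s - f t| ≥ ε`, a compact set off the diagonal, the gap is bounded below because `φ` is
injective. This form of uniform continuity is made to be combined with `poisson_mul_gap_le`. -/
theorem exists_abs_sub_le_gap (φ : CircleDiffeo 1) {f : UnitAddCircle → ℝ} (hf : Continuous f)
    {ε : ℝ} (hε : 0 < ε) :
    ∃ C, 0 ≤ C ∧ ∀ s t, |f s - f t| ≤ ε + C * gap (φ.toFun s) (φ.toFun t) := by
  have hd : Continuous fun p : UnitAddCircle × UnitAddCircle => |f p.1 - f p.2| := by fun_prop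
  have hg : Continuous fun p : UnitAddCircle × UnitAddCircle =>
      gap (φ.toFun p.1) (φ.toFun p.2) :=
    continuous_gap.comp ((φ.continuous_toFun.comp continuous_fst).prodMk
      (φ.continuous_toFun.comp continuous_snd))
  set K := {p : UnitAddCircle × UnitAddCircle | ε ≤ |f p.1 - f p.2|} with hK
  have hKc : IsCompact K := (isClosed_le continuous_const hd).isCompact
  rcases K.eq_empty_or_nonempty with hKe | hKn
  · refine ⟨0, le_rfl, fun s t => ?_⟩
    by_contra h
    have : (s, t) ∈ K := by
      simp only [hK, Set.mem_ofPred_eq]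
      linarith
    rw [hKe] at this
    exact this
  · obtain ⟨p, hp, hmin⟩ := hKc.exists_isMinOn hKn hg.continuousOn
    obtain ⟨p', hp', hmax⟩ := hKc.exists_isMaxOn hKn hd.continuousOn
    have hpos : 0 < gap (φ.toFun p.1) (φ.toFun p.2) := by
      refine gap_pos fun h => ?_
      have h1 : p.1 = p.2 := φ.injective_toFun h
      have h2 : ε ≤ |f p.1 - f p.2| := hp
      rw [h1, sub_self, abs_zero] at h2
      linarith
    refine ⟨|f p'.1 - f p'.2| / gap (φ.toFun p.1) (φ.toFun p.2),
      div_nonneg (abs_nonneg _) hpos.le, fun s t => ?_⟩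
    by_cases hst : (s, t) ∈ K
    · have h1 : |f s - f t| ≤ |f p'.1 - f p'.2| := hmax hst
      have h2 : gap (φ.toFun p.1) (φ.toFun p.2) ≤ gap (φ.toFun s) (φ.toFun t) := hmin hst
      have h3 : |f p'.1 - f p'.2| ≤ |f p'.1 - f p'.2| / gap (φ.toFun p.1) (φ.toFun p.2) *
          gap (φ.toFun s) (φ.toFun t) := by
        rw [div_mul_eq_mul_div, le_div_iff₀ hpos]
        exact mul_le_mul_of_nonneg_left h2 (abs_nonneg _)
      linarith
    · have h1 : |f s - f t| < ε := not_le.1 hst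
      have h2 : 0 ≤ |f p'.1 - f p'.2| / gap (φ.toFun p.1) (φ.toFun p.2) *
          gap (φ.toFun s) (φ.toFun t) :=
        mul_nonneg (div_nonneg (abs_nonneg _) hpos.le) (gap_nonneg _ _)
      linarith

end CircleDiffeo

open CircleDiffeo

theorem continuous_diskEnergy_circle (φ : CircleDiffeo 1) {ρ : ℝ} (h0 : 0 ≤ ρ) (h1 : ρ < 1) :
    Continuous fun θ : UnitAddCircle => diskEnergy φ (ρ * (AddCircle.toCircle θ : ℂ)) := by
  have h := continuous_parametric_integral_of_continuous (μ := (volume : Measure UnitAddCircle))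
    (f := fun θ t : UnitAddCircle =>
      (poisson (ρ * (AddCircle.toCircle θ : ℂ)) (φ.toFun t) * φ.derivative t) ^ 2)
    (s := Set.univ) ?_ isCompact_univ
  · simpa only [Measure.restrict_univ, diskEnergy] using h
  · have := φ.continuous_derivative
    have hp : Continuous fun p : UnitAddCircle × UnitAddCircle =>
        poisson (ρ * (AddCircle.toCircle p.1 : ℂ)) (φ.toFun p.2) :=
      continuous_poisson_comp (continuous_const.mul (continuous_subtype_val.comp
        (AddCircle.continuous_toCircle.comp continuous_fst)))
        (fun p => norm_ofReal_mul_toCircle h0 h1 _) (φ.continuous_toFun.comp continuous_snd)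
    exact (hp.mul (this.comp continuous_snd)).pow 2

theorem integral_poisson_sq_radial {ρ : ℝ} (h0 : 0 ≤ ρ) (h1 : ρ < 1) (θ : UnitAddCircle) :
    ∫ t, poisson (ρ * (AddCircle.toCircle θ : ℂ)) t ^ 2 = radial ρ := by
  rw [integral_poisson_sq (norm_ofReal_mul_toCircle h0 h1 θ), normSq_ofReal_mul_toCircle, radial]

/-- Jensen's inequality for the weight `P_z(φ)² φ' / ∫ P_z²`. -/
theorem exp_neg_diskEnergy_le (φ : CircleDiffeo 1) {ρ : ℝ} (h0 : 0 ≤ ρ) (h1 : ρ < 1)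
    (θ : UnitAddCircle) (l : ℝ) :
    Real.exp (-(l * diskEnergy φ (ρ * (AddCircle.toCircle θ : ℂ)))) ≤
      ∫ t, poisson (ρ * (AddCircle.toCircle θ : ℂ)) (φ.toFun t) ^ 2 / radial ρ *
        (φ.derivative t * Real.exp (-(l * radial ρ * φ.derivative t))) := by
  set z : ℂ := ρ * (AddCircle.toCircle θ : ℂ)
  have hU : 0 < radial ρ := zero_lt_one.trans_le (one_le_radial h0 h1)
  have hz : ‖z‖ < 1 := norm_ofReal_mul_toCircle h0 h1 θ
  have hP : Continuous fun t => poisson z (φ.toFun t) :=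
    (continuous_poisson hz).comp φ.continuous_toFun
  have hφ := φ.continuous_derivative
  set m := -(l * diskEnergy φ z) with hm
  have hA : ∫ t, poisson z (φ.toFun t) ^ 2 / radial ρ * φ.derivative t = 1 := by
    rw [φ.integral_comp_mul_derivative (q := fun s => poisson z s ^ 2 / radial ρ)
      (((continuous_poisson hz).pow 2).div_const _), integral_div,
      integral_poisson_sq_radial h0 h1, div_self hU.ne']
  have hB : ∫ t, poisson z (φ.toFun t) ^ 2 / radial ρ * φ.derivative t *
      (l * radial ρ * φ.derivative t) = -m := by
    rw [hm, neg_neg, diskEnergy, ← integral_const_mul]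
    refine integral_congr_ae (Eventually.of_forall fun t => ?_)
    field_simp
  -- By `hA` the weight is a probability density, and by `hB` the weighted mean of the exponent is
  -- `m`. Hence the tangent line of `exp` at `m` integrates to `exp m`, and convexity gives the
  -- inequality pointwise.
  have hC : ∫ t, Real.exp m * (poisson z (φ.toFun t) ^ 2 / radial ρ * φ.derivative t * (1 - m) -
      poisson z (φ.toFun t) ^ 2 / radial ρ * φ.derivative t * (l * radial ρ * φ.derivative t)) =
      Real.exp m := by
    rw [integral_const_mul, integral_sub, integral_mul_const, hA, hB]
    · ring
    · exact integrable_of_continuous_circle (by fun_prop)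
    · exact integrable_of_continuous_circle (by fun_prop)
  rw [← hC]
  refine integral_mono (integrable_of_continuous_circle (by fun_prop))
    (integrable_of_continuous_circle (by fun_prop)) fun t => ?_
  have hw : 0 ≤ poisson z (φ.toFun t) ^ 2 / radial ρ * φ.derivative t :=
    mul_nonneg (div_nonneg (sq_nonneg _) hU.le) (φ.derivative_pos t).le
  have he : Real.exp m * (1 + (-(l * radial ρ * φ.derivative t) - m)) ≤
      Real.exp (-(l * radial ρ * φ.derivative t)) := by
    calc _ ≤ Real.exp m * Real.exp (-(l * radial ρ * φ.derivative t) - m) := by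
          refine mul_le_mul_of_nonneg_left ?_ (Real.exp_pos _).le
          linarith [Real.add_one_le_exp (-(l * radial ρ * φ.derivative t) - m)]
      _ = _ := by rw [← Real.exp_add]; congr 1; ring
  have := mul_le_mul_of_nonneg_left he hw
  calc _ = poisson z (φ.toFun t) ^ 2 / radial ρ * φ.derivative t *
        (Real.exp m * (1 + (-(l * radial ρ * φ.derivative t) - m))) := by ring
    _ ≤ _ := this
    _ = _ := by ring

/-- After averaging the Jensen bound over `θ` and exchanging the integrals, the weight disappears:
by `poisson_symm` its integral over `θ` is again `radial ρ`. -/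
theorem lintegral_exp_neg_diskEnergy_le (φ : CircleDiffeo 1) {ρ : ℝ} (h0 : 0 ≤ ρ) (h1 : ρ < 1)
    (l : ℝ) :
    ∫⁻ θ : UnitAddCircle, ENNReal.ofReal (Real.exp (-(l * diskEnergy φ
      (ρ * (AddCircle.toCircle θ : ℂ))))) ≤
    ∫⁻ t, ENNReal.ofReal (φ.derivative t * Real.exp (-(l * radial ρ * φ.derivative t))) := by
  have hU : 0 < radial ρ := zero_lt_one.trans_le (one_le_radial h0 h1)
  have hφ := φ.continuous_derivative
  have hp : Continuous fun p : UnitAddCircle × UnitAddCircle =>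
      poisson (ρ * (AddCircle.toCircle p.1 : ℂ)) (φ.toFun p.2) :=
    continuous_poisson_comp (continuous_const.mul (continuous_subtype_val.comp
      (AddCircle.continuous_toCircle.comp continuous_fst)))
      (fun p => norm_ofReal_mul_toCircle h0 h1 _) (φ.continuous_toFun.comp continuous_snd)
  have hG : Continuous fun p : UnitAddCircle × UnitAddCircle =>
      poisson (ρ * (AddCircle.toCircle p.1 : ℂ)) (φ.toFun p.2) ^ 2 / radial ρ *
        (φ.derivative p.2 * Real.exp (-(l * radial ρ * φ.derivative p.2))) := by fun_prop
  have hGi : Integrable (fun p : UnitAddCircle × UnitAddCircle =>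
      poisson (ρ * (AddCircle.toCircle p.1 : ℂ)) (φ.toFun p.2) ^ 2 / radial ρ *
        (φ.derivative p.2 * Real.exp (-(l * radial ρ * φ.derivative p.2))))
        ((volume : Measure UnitAddCircle).prod volume) :=
    hG.integrable_of_hasCompactSupport (HasCompactSupport.of_compactSpace _)
  have hG0 : ∀ p : UnitAddCircle × UnitAddCircle, 0 ≤
      poisson (ρ * (AddCircle.toCircle p.1 : ℂ)) (φ.toFun p.2) ^ 2 / radial ρ *
        (φ.derivative p.2 * Real.exp (-(l * radial ρ * φ.derivative p.2))) := fun p =>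
    mul_nonneg (div_nonneg (sq_nonneg _) hU.le)
      (mul_nonneg (φ.derivative_pos _).le (Real.exp_pos _).le)
  calc _ ≤ ∫⁻ θ : UnitAddCircle, ENNReal.ofReal (∫ t,
        poisson (ρ * (AddCircle.toCircle θ : ℂ)) (φ.toFun t) ^ 2 / radial ρ *
        (φ.derivative t * Real.exp (-(l * radial ρ * φ.derivative t)))) :=
        lintegral_mono fun θ => ENNReal.ofReal_le_ofReal (exp_neg_diskEnergy_le φ h0 h1 θ l)
    _ = ENNReal.ofReal (∫ θ : UnitAddCircle, ∫ t,
        poisson (ρ * (AddCircle.toCircle θ : ℂ)) (φ.toFun t) ^ 2 / radial ρ *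
        (φ.derivative t * Real.exp (-(l * radial ρ * φ.derivative t)))) := by
        rw [ofReal_integral_eq_lintegral_ofReal hGi.integral_prod_left
          (Eventually.of_forall fun θ => integral_nonneg fun t => hG0 (θ, t))]
    _ = ENNReal.ofReal (∫ t, φ.derivative t *
          Real.exp (-(l * radial ρ * φ.derivative t))) := by
        rw [integral_integral_swap hGi]
        congr 1
        refine integral_congr_ae (Eventually.of_forall fun t => ?_)
        simp only
        rw [integral_mul_const, integral_div]
        simp only [poisson_symm ρ _ (φ.toFun t)]
        rw [integral_poisson_sq_radial h0 h1, div_self hU.ne', one_mul]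
    _ = _ := ofReal_integral_eq_lintegral_ofReal (integrable_of_continuous_circle (by fun_prop))
        (Eventually.of_forall fun t => mul_nonneg (φ.derivative_pos _).le (Real.exp_pos _).le)

/-- The Haar integral of `exp (-l ∫ (ψ ∘ φ)'²)` over `ψ ∈ PSL(2, ℝ)`. -/
noncomputable def haarWeight (l : ℝ) (φ : CircleDiffeo 1) : ℝ≥0∞ :=
  ∫⁻ p, ENNReal.ofReal (Real.exp (-(l * energy (postcomp p.toDiffeo φ)))) ∂haarPSL

theorem measurable_exp_neg_diskEnergy (l : ℝ) (φ : CircleDiffeo 1) :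
    Measurable fun z => ENNReal.ofReal (Real.exp (-(l * diskEnergy φ z))) := by
  have := measurable_diskEnergy φ
  fun_prop

theorem haarWeight_eq_disk (l : ℝ) (φ : CircleDiffeo 1) : haarWeight l φ =
    ∫⁻ p, ENNReal.ofReal (Real.exp (-(l * diskEnergy φ (diskPoint p.1 p.2.1)))) ∂haarPSL := by
  unfold haarWeight
  refine lintegral_congr fun p => ?_
  rw [PSLCoord.toDiffeo, energy_postcomp_mobius]

theorem haarWeight_eq (l : ℝ) (φ : CircleDiffeo 1) : haarWeight l φ =
    ∫⁻ ρ in Set.Ico (0 : ℝ) 1, ENNReal.ofReal (4 * ρ / (1 - ρ ^ 2) ^ 2) *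
      ∫⁻ θ : UnitAddCircle, ENNReal.ofReal (Real.exp (-(l * diskEnergy φ
      (ρ * (AddCircle.toCircle θ : ℂ))))) := by
  rw [haarWeight_eq_disk]
  exact lintegral_haarPSL (measurable_exp_neg_diskEnergy l φ)

theorem measurable_radial_weight (φ : CircleDiffeo 1) (l : ℝ) :
    Measurable fun p : ℝ × UnitAddCircle => ENNReal.ofReal (4 * p.1 / (1 - p.1 ^ 2) ^ 2) *
        ENNReal.ofReal (φ.derivative p.2 * Real.exp (-(l * radial p.1 * φ.derivative p.2))) := by
  have h1 := φ.continuous_derivative.measurable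
  have h2 := measurable_radial
  fun_prop

/-- The radial integral at fixed `t` produces `1 / (l φ'(t))`, and the prefactor `φ'(t)` cancels
against it. This cancellation is why the limit of `l h_l` does not depend on `φ`. -/
theorem lintegral_radial_weight (φ : CircleDiffeo 1) {l : ℝ} (hl : 0 < l) {a : ℝ} (h0 : 0 ≤ a)
    (h1 : a < 1) :
    ∫⁻ ρ in Set.Ico a 1, ENNReal.ofReal (4 * ρ / (1 - ρ ^ 2) ^ 2) *
      ∫⁻ t, ENNReal.ofReal (φ.derivative t * Real.exp (-(l * radial ρ * φ.derivative t))) =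
    ∫⁻ t, ENNReal.ofReal (Real.exp (-(l * φ.derivative t * radial a)) / l) := by
  have h2 : ∀ ρ : ℝ, ENNReal.ofReal (4 * ρ / (1 - ρ ^ 2) ^ 2) *
      ∫⁻ t, ENNReal.ofReal (φ.derivative t * Real.exp (-(l * radial ρ * φ.derivative t))) =
      ∫⁻ t, ENNReal.ofReal (4 * ρ / (1 - ρ ^ 2) ^ 2) *
        ENNReal.ofReal (φ.derivative t * Real.exp (-(l * radial ρ * φ.derivative t))) := by
    intro ρ
    have := φ.continuous_derivative.measurable
    rw [lintegral_const_mul _ (by fun_prop)]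
  simp only [h2]
  rw [lintegral_lintegral_swap (measurable_radial_weight φ l).aemeasurable]
  refine lintegral_congr fun t => ?_
  have hpos := φ.derivative_pos t
  have h3 : ∀ ρ : ℝ, ENNReal.ofReal (4 * ρ / (1 - ρ ^ 2) ^ 2) *
        ENNReal.ofReal (φ.derivative t * Real.exp (-(l * radial ρ * φ.derivative t))) =
      ENNReal.ofReal (φ.derivative t) * (ENNReal.ofReal (4 * ρ / (1 - ρ ^ 2) ^ 2) *
        ENNReal.ofReal (Real.exp (-(l * φ.derivative t * radial ρ)))) := by
    intro ρ
    rw [ENNReal.ofReal_mul hpos.le, mul_left_comm]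
    congr 5
    ring
  simp only [h3]
  have := measurable_radial
  rw [lintegral_const_mul _ (by fun_prop), lintegral_radial h0 h1 (mul_pos hl hpos),
    ← ENNReal.ofReal_mul hpos.le]
  congr 1
  field_simp

/-- The bound is uniform in `φ`. It serves as the upper half of the limit formula, and it makes the
orbital measures below `π` finite with exponential moments of the energy. -/
theorem haarWeight_le (φ : CircleDiffeo 1) {l : ℝ} (hl : 0 < l) :
    haarWeight l φ ≤ ENNReal.ofReal (1 / l) := by
  rw [haarWeight_eq]
  calc _ ≤ ∫⁻ ρ in Set.Ico (0 : ℝ) 1, ENNReal.ofReal (4 * ρ / (1 - ρ ^ 2) ^ 2) *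
      ∫⁻ t, ENNReal.ofReal (φ.derivative t * Real.exp (-(l * radial ρ * φ.derivative t))) :=
        setLIntegral_mono' measurableSet_Ico fun ρ hρ =>
          mul_le_mul_right (lintegral_exp_neg_diskEnergy_le φ hρ.1 hρ.2 l) _
    _ = ∫⁻ t, ENNReal.ofReal (Real.exp (-(l * φ.derivative t * radial 0)) / l) :=
        lintegral_radial_weight φ hl le_rfl one_pos
    _ ≤ ∫⁻ _ : UnitAddCircle, ENNReal.ofReal (1 / l) := by
        refine lintegral_mono fun t => ENNReal.ofReal_le_ofReal ?_
        refine div_le_div_of_nonneg_right (Real.exp_le_one_iff.2 ?_) hl.le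
        have : 0 ≤ l * φ.derivative t * radial 0 :=
          mul_nonneg (mul_nonneg hl.le (φ.derivative_pos t).le) (by simp [radial])
        linarith
    _ = _ := by simp

/-- One factor `φ'(t)` is replaced by `(1 + ε) φ'(s)` plus a multiple of the gap. The first term is
integrated with `∫ P² = radial ρ`; in the second the gap cancels one factor `P`, which leaves a
bounded error. -/
theorem exists_diskEnergy_le (φ : CircleDiffeo 1) {ε : ℝ} (hε : 0 < ε) :
    ∃ C, 0 ≤ C ∧ ∀ ρ : ℝ, 1 / 2 ≤ ρ → ρ < 1 → ∀ s,
      diskEnergy φ (ρ * (AddCircle.toCircle (φ.toFun s) : ℂ)) ≤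
        (1 + ε) * φ.derivative s * radial ρ + C := by
  have hφ := φ.continuous_derivative
  obtain ⟨s₀, -, hs₀⟩ := isCompact_univ.exists_isMinOn Set.univ_nonempty hφ.continuousOn
  -- The tolerance `ε min φ'` turns an additive error into the factor `1 + ε`.
  obtain ⟨C, hC0, hC⟩ := φ.exists_abs_sub_le_gap hφ (mul_pos hε (φ.derivative_pos s₀))
  refine ⟨C, hC0, fun ρ h0' h1 s => ?_⟩
  have h0 : 0 < ρ := by linarith
  set z : ℂ := ρ * (AddCircle.toCircle (φ.toFun s) : ℂ) with hz
  have hz1 : ‖z‖ < 1 := norm_ofReal_mul_toCircle h0.le h1 _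
  have hP : Continuous fun t => poisson z (φ.toFun t) :=
    (continuous_poisson hz1).comp φ.continuous_toFun
  have hA : ∫ t, poisson z (φ.toFun t) ^ 2 * φ.derivative t = radial ρ := by
    rw [φ.integral_comp_mul_derivative (q := fun s => poisson z s ^ 2)
      ((continuous_poisson hz1).pow 2), integral_poisson_sq_radial h0.le h1]
  have hB : ∫ t, poisson z (φ.toFun t) * φ.derivative t = 1 := by
    rw [φ.integral_comp_mul_derivative (continuous_poisson hz1), integral_poisson hz1]
  have hR : ∫ t, (poisson z (φ.toFun t) ^ 2 * φ.derivative t * ((1 + ε) * φ.derivative s) +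
      C * (poisson z (φ.toFun t) * φ.derivative t)) =
      (1 + ε) * φ.derivative s * radial ρ + C := by
    rw [integral_add (integrable_of_continuous_circle (by fun_prop))
      (integrable_of_continuous_circle (by fun_prop)), integral_mul_const, integral_const_mul,
      hA, hB]
    ring
  rw [← hR, diskEnergy]
  refine integral_mono (integrable_of_continuous_circle (by fun_prop))
    (integrable_of_continuous_circle (by fun_prop)) fun t => ?_
  have hPp := poisson_pos hz1 (φ.toFun t)
  have hdp := φ.derivative_pos t
  have h2 : φ.derivative t ≤
      (1 + ε) * φ.derivative s + C * gap (φ.toFun s) (φ.toFun t) := by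
    have h3 := (abs_le.1 (hC s t)).1
    have h4 : φ.derivative s₀ ≤ φ.derivative s := hs₀ (Set.mem_univ s)
    nlinarith
  -- Here `ρ ≥ 1 / 2` enters: it gives `1 - ρ² ≤ 2 ρ`.
  have h5 : poisson z (φ.toFun t) * gap (φ.toFun s) (φ.toFun t) ≤ 1 := by
    refine (poisson_mul_gap_le h0 h1 _ _).trans ?_
    rw [div_le_one (by linarith)]
    nlinarith
  have h6 : 0 ≤ poisson z (φ.toFun t) * φ.derivative t := (mul_pos hPp hdp).le
  calc _ = poisson z (φ.toFun t) ^ 2 * φ.derivative t * φ.derivative t := by ring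
    _ ≤ poisson z (φ.toFun t) ^ 2 * φ.derivative t *
        ((1 + ε) * φ.derivative s + C * gap (φ.toFun s) (φ.toFun t)) :=
        mul_le_mul_of_nonneg_left h2 (mul_nonneg (sq_nonneg _) hdp.le)
    _ = poisson z (φ.toFun t) ^ 2 * φ.derivative t * ((1 + ε) * φ.derivative s) +
        C * (poisson z (φ.toFun t) * φ.derivative t) *
          (poisson z (φ.toFun t) * gap (φ.toFun s) (φ.toFun t)) := by ring
    _ ≤ _ := by
        have := mul_le_mul_of_nonneg_left h5 (mul_nonneg hC0 h6)
        linarith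

/-- Only radii `ρ ≥ 1 / 2` are kept. Substituting `θ = φ(s)` centres the kernel at `φ(s)`, where
`exists_diskEnergy_le` applies, and the radial integral is again explicit. -/
theorem exists_le_haarWeight (φ : CircleDiffeo 1) {ε : ℝ} (hε : 0 < ε) :
    ∃ C, ∀ l, 0 < l → ENNReal.ofReal (Real.exp (-(l * C)) / ((1 + ε) * l)) ≤ haarWeight l φ := by
  have hφ := φ.continuous_derivative
  obtain ⟨s₀, -, hs₀⟩ := isCompact_univ.exists_isMaxOn Set.univ_nonempty hφ.continuousOn
  obtain ⟨C, hC0, hC⟩ := exists_diskEnergy_le φ hε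
  -- The second summand pays for the lower endpoint `ρ = 1 / 2` of the radial integral, with `φ'`
  -- replaced by its maximum.
  refine ⟨C + (1 + ε) * φ.derivative s₀ * radial (1 / 2), fun l hl => ?_⟩
  rw [haarWeight_eq]
  have hl' : 0 < (1 + ε) * l := by positivity
  have hrad : ∀ ρ ∈ Set.Ico (1 / 2 : ℝ) 1, ENNReal.ofReal (Real.exp (-(l * C))) *
      ∫⁻ t, ENNReal.ofReal (φ.derivative t *
        Real.exp (-((1 + ε) * l * radial ρ * φ.derivative t))) ≤
      ∫⁻ θ : UnitAddCircle, ENNReal.ofReal (Real.exp (-(l * diskEnergy φ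
        (ρ * (AddCircle.toCircle θ : ℂ))))) := by
    intro ρ hρ
    have h0 : 0 ≤ ρ := by linarith [hρ.1]
    have hcont := continuous_diskEnergy_circle φ h0 hρ.2
    have hcont' : Continuous fun t => Real.exp (-(l * diskEnergy φ
        (ρ * (AddCircle.toCircle (φ.toFun t) : ℂ)))) * φ.derivative t := by
      have := hcont.comp φ.continuous_toFun
      simp only [Function.comp_def] at this
      fun_prop
    rw [← ofReal_integral_eq_lintegral_ofReal (f := fun θ : UnitAddCircle =>
      Real.exp (-(l * diskEnergy φ (ρ * (AddCircle.toCircle θ : ℂ)))))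
      (integrable_of_continuous_circle (by fun_prop))
      (Eventually.of_forall fun θ => (Real.exp_pos _).le),
      ← φ.integral_comp_mul_derivative (by fun_prop),
      ofReal_integral_eq_lintegral_ofReal (integrable_of_continuous_circle hcont')
      (Eventually.of_forall fun θ => mul_nonneg (Real.exp_pos _).le (φ.derivative_pos _).le),
      ← lintegral_const_mul _ (by have := hφ.measurable; fun_prop)]
    refine lintegral_mono fun t => ?_
    rw [← ENNReal.ofReal_mul (Real.exp_pos _).le]
    refine ENNReal.ofReal_le_ofReal ?_
    rw [mul_left_comm, mul_comm (φ.derivative t), ← Real.exp_add]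
    refine mul_le_mul_of_nonneg_right (Real.exp_le_exp.2 ?_) (φ.derivative_pos t).le
    have := mul_le_mul_of_nonneg_left (hC ρ hρ.1 hρ.2 t) hl.le
    linarith
  have hmeas : Measurable fun ρ : ℝ => ENNReal.ofReal (4 * ρ / (1 - ρ ^ 2) ^ 2) *
      ∫⁻ t, ENNReal.ofReal (φ.derivative t *
        Real.exp (-((1 + ε) * l * radial ρ * φ.derivative t))) := by
    have h1 := φ.continuous_derivative.measurable
    have h2 := measurable_radial
    have h3 : Measurable fun p : ℝ × UnitAddCircle => ENNReal.ofReal (φ.derivative p.2 *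
        Real.exp (-((1 + ε) * l * radial p.1 * φ.derivative p.2))) := by fun_prop
    exact (by fun_prop : Measurable fun ρ : ℝ =>
      ENNReal.ofReal (4 * ρ / (1 - ρ ^ 2) ^ 2)).mul h3.lintegral_prod_right'
  calc ENNReal.ofReal (Real.exp (-(l * (C + (1 + ε) * φ.derivative s₀ * radial (1 / 2)))) /
        ((1 + ε) * l))
      = ENNReal.ofReal (Real.exp (-(l * C))) * ∫⁻ _ : UnitAddCircle, ENNReal.ofReal
        (Real.exp (-((1 + ε) * l * φ.derivative s₀ * radial (1 / 2))) / ((1 + ε) * l)) := by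
        rw [lintegral_const, measure_univ, mul_one, ← ENNReal.ofReal_mul (Real.exp_pos _).le,
          mul_div_assoc', ← Real.exp_add]
        congr 3
        ring
    _ ≤ ENNReal.ofReal (Real.exp (-(l * C))) * ∫⁻ t, ENNReal.ofReal
        (Real.exp (-((1 + ε) * l * φ.derivative t * radial (1 / 2))) / ((1 + ε) * l)) := by
        refine mul_le_mul_right (lintegral_mono fun t => ENNReal.ofReal_le_ofReal ?_) _
        refine div_le_div_of_nonneg_right (Real.exp_le_exp.2 ?_) hl'.le
        have h2 : φ.derivative t ≤ φ.derivative s₀ := hs₀ (Set.mem_univ t)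
        have h3 : 0 ≤ radial (1 / 2) := by norm_num [radial]
        have h4 := mul_le_mul_of_nonneg_right (mul_le_mul_of_nonneg_left h2 hl'.le) h3
        linarith
    _ = ∫⁻ ρ in Set.Ico (1 / 2 : ℝ) 1, ENNReal.ofReal (Real.exp (-(l * C))) *
        (ENNReal.ofReal (4 * ρ / (1 - ρ ^ 2) ^ 2) *
        ∫⁻ t, ENNReal.ofReal (φ.derivative t *
          Real.exp (-((1 + ε) * l * radial ρ * φ.derivative t)))) := by
        rw [lintegral_const_mul _ hmeas, lintegral_radial_weight φ hl' (by norm_num) (by norm_num)]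
    _ ≤ ∫⁻ ρ in Set.Ico (1 / 2 : ℝ) 1, ENNReal.ofReal (4 * ρ / (1 - ρ ^ 2) ^ 2) *
      ∫⁻ θ : UnitAddCircle, ENNReal.ofReal (Real.exp (-(l * diskEnergy φ
        (ρ * (AddCircle.toCircle θ : ℂ))))) := by
        refine setLIntegral_mono' measurableSet_Ico fun ρ hρ => ?_
        rw [mul_left_comm]
        exact mul_le_mul_right (hrad ρ hρ) _
    _ ≤ _ := lintegral_mono_set (Set.Ico_subset_Ico_left (by norm_num))

theorem tendsto_mul_haarWeight (φ : CircleDiffeo 1) :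
    Tendsto (fun l : ℝ => ENNReal.ofReal l * haarWeight l φ) (𝓝[>] 0) (𝓝 1) := by
  have hpos : ∀ᶠ l : ℝ in 𝓝[>] 0, 0 < l := self_mem_nhdsWithin
  refine tendsto_of_le_liminf_of_limsup_le ?_ ?_
  · refine le_of_forall_lt fun c hc => ?_
    obtain ⟨r, hr0, rfl⟩ : ∃ r : ℝ, 0 ≤ r ∧ c = ENNReal.ofReal r :=
      ⟨c.toReal, ENNReal.toReal_nonneg, (ENNReal.ofReal_toReal hc.ne_top).symm⟩
    have hr1 : r < 1 := by simpa using hc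
    -- Here `r''` will be `1 / (1 + ε)`, the limit of the lower bound. The room between `r'` and
    -- `r''` absorbs `exp (-l C)`, and that between `r` and `r'` keeps the final inequality strict.
    obtain ⟨r', hr, hr'⟩ := exists_between hr1
    obtain ⟨r'', hr'2, hr''⟩ := exists_between hr'
    have hr''0 : 0 < r'' := by linarith
    have hε : 0 < 1 / r'' - 1 := by
      rw [sub_pos, lt_div_iff₀ hr''0]; linarith
    obtain ⟨C, hC⟩ := exists_le_haarWeight φ hε
    have hlim : Tendsto (fun l : ℝ => Real.exp (-(l * C)) * r'') (𝓝[>] 0) (𝓝 r'') := by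
      have : Continuous fun l : ℝ => Real.exp (-(l * C)) * r'' := by fun_prop
      simpa using (this.tendsto 0).mono_left nhdsWithin_le_nhds
    have hev : ∀ᶠ l : ℝ in 𝓝[>] 0, ENNReal.ofReal r' ≤ ENNReal.ofReal l * haarWeight l φ := by
      filter_upwards [hpos, hlim.eventually (lt_mem_nhds hr'2)] with l hl h
      refine le_trans ?_ (mul_le_mul_right (hC l hl) _)
      rw [← ENNReal.ofReal_mul hl.le]
      refine ENNReal.ofReal_le_ofReal (h.le.trans (le_of_eq ?_))
      field_simp
      ring
    refine lt_of_lt_of_le ?_ (le_liminf_of_le (by isBoundedDefault) hev)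
    exact (ENNReal.ofReal_lt_ofReal_iff (by linarith)).2 hr
  · refine limsup_le_of_le (by isBoundedDefault) ?_
    filter_upwards [hpos] with l hl
    calc _ ≤ ENNReal.ofReal l * ENNReal.ofReal (1 / l) := mul_le_mul_right (haarWeight_le φ hl) _
      _ = 1 := by rw [← ENNReal.ofReal_mul hl.le, mul_one_div_cancel hl.ne', ENNReal.ofReal_one]

/-! ### The `PSL(2, ℝ)` orbits -/

open scoped Classical in
theorem tanCoord_coe (x : ℝ) : tanCoord (x : UnitAddCircle) =
    if Real.sin (Real.pi * x) = 0 then OnePoint.infty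
    else ((-Real.cos (Real.pi * x) / Real.sin (Real.pi * x) : ℝ) : OnePoint ℝ) := by
  have h0 : (x : UnitAddCircle) = 0 ↔ Real.sin (Real.pi * x) = 0 := by
    rw [AddCircle.coe_eq_zero_iff, Real.sin_eq_zero_iff]
    refine exists_congr fun n => ?_
    rw [zsmul_eq_mul, mul_one, mul_comm, mul_right_inj' Real.pi_ne_zero]
  unfold tanCoord
  by_cases h : Real.sin (Real.pi * x) = 0
  · rw [if_pos (h0.2 h), if_pos h]
  · rw [if_neg (mt h0.1 h), if_neg h]
    congr 1
    change Real.tan (Real.pi * x - Real.pi / 2) = _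
    rw [Real.tan_eq_sin_div_cos, Real.sin_sub_pi_div_two, Real.cos_sub_pi_div_two]

/-- In homogeneous coordinates the point `x` is `(-cos πx : sin πx)`. The right-hand side is the
vanishing of the cross product of `g` applied to this vector with the vector of `y`; it treats `∞`
like any other point and can be differentiated. -/
theorem tanCoord_eq_smul_iff (g : SL(2, ℝ)) (x y : ℝ) :
    tanCoord (y : UnitAddCircle) = (g : GL (Fin 2) ℝ) • tanCoord (x : UnitAddCircle) ↔
      (-(g 0 0 * Real.cos (Real.pi * x)) + g 0 1 * Real.sin (Real.pi * x)) *
          Real.sin (Real.pi * y) +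
        (-(g 1 0 * Real.cos (Real.pi * x)) + g 1 1 * Real.sin (Real.pi * x)) *
          Real.cos (Real.pi * y) = 0 := by
  rw [tanCoord_coe, tanCoord_coe]
  have hdet : g 0 0 * g 1 1 - g 0 1 * g 1 0 = 1 := by
    rw [← Matrix.det_fin_two]; exact g.2
  have hx := Real.sin_sq_add_cos_sq (Real.pi * x)
  have hy := Real.sin_sq_add_cos_sq (Real.pi * y)
  have hcoe : ∀ i j, (g : GL (Fin 2) ℝ) i j = g i j := fun _ _ => rfl
  generalize Real.sin (Real.pi * x) = sx at *
  generalize Real.cos (Real.pi * x) = cx at *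
  generalize Real.sin (Real.pi * y) = sy at *
  generalize Real.cos (Real.pi * y) = cy at *
  by_cases hsx : sx = 0
  · subst hsx
    have hcx : cx ≠ 0 := by rintro rfl; simp at hx
    rw [if_pos rfl, OnePoint.smul_infty_eq_ite, hcoe, hcoe]
    by_cases hsy : sy = 0
    · subst hsy
      have hcy : cy ≠ 0 := by rintro rfl; simp at hy
      rw [if_pos rfl]
      by_cases hc : g 1 0 = 0
      · simp [hc]
      · simp [hc, hcx, hcy]
    · rw [if_neg hsy]
      by_cases hc : g 1 0 = 0
      · have ha : g 0 0 ≠ 0 := by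
          intro ha; rw [ha, hc] at hdet; simp at hdet
        simp [hc, ha, hcx, hsy]
      · rw [if_neg hc, OnePoint.coe_eq_coe, div_eq_div_iff hsy hc]
        constructor
        · intro h
          linear_combination (-cx) * h * (-1)
        · intro h
          refine mul_left_cancel₀ hcx ?_
          linear_combination h
  · rw [if_neg hsx, OnePoint.smul_some_eq_ite, hcoe, hcoe, hcoe, hcoe]
    have hD : g 1 0 * (-cx / sx) + g 1 1 = (-(g 1 0 * cx) + g 1 1 * sx) / sx := by
      field_simp
    have hN : g 0 0 * (-cx / sx) + g 0 1 = (-(g 0 0 * cx) + g 0 1 * sx) / sx := by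
      field_simp
    -- Since `sx ≠ 0`, this excludes that `N` and `D` vanish together.
    have hND : (-(g 0 0 * cx) + g 0 1 * sx) * g 1 0 - (-(g 1 0 * cx) + g 1 1 * sx) * g 0 0 =
        -sx := by linear_combination (-sx) * hdet
    rw [hD, hN]
    generalize -(g 1 0 * cx) + g 1 1 * sx = D at *
    generalize -(g 0 0 * cx) + g 0 1 * sx = N at *
    by_cases hsy : sy = 0
    · subst hsy
      have hcy : cy ≠ 0 := by rintro rfl; simp at hy
      rw [if_pos rfl]
      by_cases hc : D = 0
      · simp [hc]
      · simp [hc, hcy, hsx]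
    · rw [if_neg hsy]
      by_cases hc : D = 0
      · have hN0 : N ≠ 0 := by
          rintro rfl
          rw [hc] at hND
          simp at hND
          exact hsx hND
        simp [hc, hN0, hsy]
      · rw [if_neg (div_ne_zero hc hsx), OnePoint.coe_eq_coe, div_div_div_cancel_right₀ hsx,
          div_eq_div_iff hsy hc]
        constructor
        · intro h
          linear_combination -h
        · intro h
          linear_combination -h

/-- The disk automorphism by which `PSL(2, ℝ)` acts on the parameter `z` of the Poisson kernel. -/
noncomputable def diskAut (p q z : ℂ) : ℂ :=
  (starRingEnd ℂ p * z - q) / (p - starRingEnd ℂ q * z)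

theorem diskAut_denom_ne_zero {p q : ℂ} (hpq : Complex.normSq p - Complex.normSq q = 1)
    {z : ℂ} (hz : ‖z‖ < 1) : p - starRingEnd ℂ q * z ≠ 0 := by
  intro h
  have h1 : Complex.normSq p = Complex.normSq q * Complex.normSq z := by
    rw [sub_eq_zero.1 h, Complex.normSq_mul, Complex.normSq_conj]
  have h2 := normSq_lt_one hz
  nlinarith [Complex.normSq_nonneg q, Complex.normSq_nonneg z]

theorem one_sub_normSq_diskAut {p q : ℂ} (hpq : Complex.normSq p - Complex.normSq q = 1)
    {z : ℂ} (hz : ‖z‖ < 1) :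
    1 - Complex.normSq (diskAut p q z) =
      (1 - Complex.normSq z) / Complex.normSq (p - starRingEnd ℂ q * z) := by
  have h := Complex.normSq_pos.2 (diskAut_denom_ne_zero hpq hz)
  rw [diskAut, Complex.normSq_div, eq_div_iff h.ne', sub_mul, div_mul_cancel₀ _ h.ne']
  simp only [Complex.normSq_apply, Complex.sub_re, Complex.sub_im, Complex.mul_re, Complex.mul_im,
    Complex.conj_re, Complex.conj_im] at hpq ⊢
  linear_combination (1 - z.re * z.re - z.im * z.im) * hpq

theorem norm_diskAut_lt_one {p q : ℂ} (hpq : Complex.normSq p - Complex.normSq q = 1)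
    {z : ℂ} (hz : ‖z‖ < 1) : ‖diskAut p q z‖ < 1 := by
  have h := one_sub_normSq_diskAut hpq hz
  have h1 : 0 < 1 - Complex.normSq (diskAut p q z) := by
    rw [h]
    exact div_pos (by linarith [normSq_lt_one hz])
      (Complex.normSq_pos.2 (diskAut_denom_ne_zero hpq hz))
  rw [Complex.normSq_eq_norm_sq] at h1
  nlinarith [norm_nonneg (diskAut p q z)]

theorem normSq_conj_neg {p q : ℂ} (hpq : Complex.normSq p - Complex.normSq q = 1) :
    Complex.normSq (starRingEnd ℂ p) - Complex.normSq (-q) = 1 := by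
  rw [Complex.normSq_conj, Complex.normSq_neg, hpq]

theorem diskAut_inverse {p q : ℂ} (hpq : Complex.normSq p - Complex.normSq q = 1)
    {z : ℂ} (hz : ‖z‖ < 1) :
    diskAut (starRingEnd ℂ p) (-q) (diskAut p q z) = z := by
  have h := diskAut_denom_ne_zero hpq hz
  have h2 := diskAut_denom_ne_zero (normSq_conj_neg hpq) (norm_diskAut_lt_one hpq hz)
  rw [diskAut, div_eq_iff h2]
  have h4 : diskAut p q z * (p - starRingEnd ℂ q * z) = starRingEnd ℂ p * z - q :=
    div_mul_cancel₀ _ h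
  refine mul_right_cancel₀ h ?_
  simp only [Complex.conj_conj, map_neg]
  linear_combination (p - z * starRingEnd ℂ q) * h4

theorem hasDerivAt_diskAut {p q : ℂ} (hpq : Complex.normSq p - Complex.normSq q = 1)
    {z : ℂ} (hz : ‖z‖ < 1) :
    HasDerivAt (diskAut p q) (1 / (p - starRingEnd ℂ q * z) ^ 2) z := by
  have h := diskAut_denom_ne_zero hpq hz
  have h3 : (p * starRingEnd ℂ p - q * starRingEnd ℂ q : ℂ) = 1 := by
    rw [Complex.mul_conj, Complex.mul_conj, ← Complex.ofReal_sub, hpq, Complex.ofReal_one]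
  refine ((((hasDerivAt_id z).const_mul (starRingEnd ℂ p)).sub_const q).div
    (((hasDerivAt_id z).const_mul (starRingEnd ℂ q)).const_sub p) h).congr_deriv ?_
  simp only [id]
  congr 1
  linear_combination h3

theorem image_diskAut {p q : ℂ} (hpq : Complex.normSq p - Complex.normSq q = 1) :
    diskAut p q '' Metric.ball 0 1 = Metric.ball 0 1 := by
  ext w
  simp only [Set.mem_image, mem_ball_zero_iff]
  constructor
  · rintro ⟨z, hz, rfl⟩
    exact norm_diskAut_lt_one hpq hz
  · intro hw
    refine ⟨diskAut (starRingEnd ℂ p) (-q) w, norm_diskAut_lt_one (normSq_conj_neg hpq) hw, ?_⟩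
    have := diskAut_inverse (normSq_conj_neg hpq) hw
    rwa [Complex.conj_conj, neg_neg] at this

/-- Hyperbolic area is invariant: the real Jacobian `|p - q̄ z|⁻⁴` of the automorphism cancels
against the squared factor from `one_sub_normSq_diskAut`. -/
theorem lintegral_disk_diskAut {p q : ℂ} (hpq : Complex.normSq p - Complex.normSq q = 1)
    (f : ℂ → ℝ≥0∞) :
    ∫⁻ z in Metric.ball (0 : ℂ) 1, ENNReal.ofReal (1 / (1 - Complex.normSq z) ^ 2) *
      f (diskAut p q z) =
    ∫⁻ z in Metric.ball (0 : ℂ) 1, ENNReal.ofReal (1 / (1 - Complex.normSq z) ^ 2) * f z := by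
  have hdet : ∀ w : ℂ, (((ContinuousLinearMap.toSpanSingleton ℂ w).restrictScalars ℝ).det) =
      Complex.normSq w := by
    intro w
    rw [← Algebra.norm_complex_apply, Algebra.norm_apply]
    unfold ContinuousLinearMap.det
    congr 1
    ext x
    simp [mul_comm]
  have h := lintegral_image_eq_lintegral_abs_det_fderiv_mul (volume : Measure ℂ)
    (s := Metric.ball (0 : ℂ) 1) (f := diskAut p q)
    (f' := fun z => (ContinuousLinearMap.toSpanSingleton ℂ
      (1 / (p - starRingEnd ℂ q * z) ^ 2)).restrictScalars ℝ) measurableSet_ball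
    (fun z hz => ((hasDerivAt_diskAut hpq (mem_ball_zero_iff.1 hz)).hasFDerivAt.restrictScalars
      ℝ).hasFDerivWithinAt)
    (Set.LeftInvOn.injOn (f₁' := diskAut (starRingEnd ℂ p) (-q))
      fun z hz => diskAut_inverse hpq (mem_ball_zero_iff.1 hz))
    (fun z => ENNReal.ofReal (1 / (1 - Complex.normSq z) ^ 2) * f z)
  rw [image_diskAut hpq] at h
  rw [h]
  refine setLIntegral_congr_fun measurableSet_ball fun z hz => ?_
  have hz1 := mem_ball_zero_iff.1 hz
  have hd := Complex.normSq_pos.2 (diskAut_denom_ne_zero hpq hz1)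
  have h1 : 0 < 1 - Complex.normSq z := by linarith [normSq_lt_one hz1]
  rw [hdet, ← mul_assoc, ← ENNReal.ofReal_mul (abs_nonneg _),
    abs_of_nonneg (Complex.normSq_nonneg _), one_sub_normSq_diskAut hpq hz1]
  congr 2
  rw [Complex.normSq_div, Complex.normSq_one, map_pow]
  field_simp

/-! ### Invariance of the Haar integral along `PSL(2, ℝ)` orbits -/

theorem lintegral_angle (G : ℂ → ℝ≥0∞) :
    ∫⁻ α in Set.Ioo (-Real.pi) Real.pi, G (Real.cos α + Real.sin α * Complex.I) =
      ENNReal.ofReal (2 * Real.pi) * ∫⁻ θ : UnitAddCircle, G (AddCircle.toCircle θ) := by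
  have hpi := Real.pi_pos
  have h := lintegral_image_eq_lintegral_abs_deriv_mul (f := fun x : ℝ => 2 * Real.pi * x)
    (f' := fun _ => 2 * Real.pi) (s := Set.Ioo (-(1 / 2) : ℝ) (1 / 2)) measurableSet_Ioo
    (fun x _ => by simpa using ((hasDerivAt_id x).const_mul (2 * Real.pi)).hasDerivWithinAt)
    (fun x _ y _ hxy => by simpa [hpi.ne'] using hxy)
    (fun α => G (Real.cos α + Real.sin α * Complex.I))
  have himg : (fun x : ℝ => 2 * Real.pi * x) '' Set.Ioo (-(1 / 2) : ℝ) (1 / 2) =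
      Set.Ioo (-Real.pi) Real.pi := by
    rw [Set.image_mul_left_Ioo (by positivity)]
    congr 1 <;> ring
  rw [himg] at h
  rw [h, ← UnitAddCircle.lintegral_preimage (-(1 / 2)),
    show (-(1 / 2) + 1 : ℝ) = 1 / 2 by norm_num, setLIntegral_congr Ioo_ae_eq_Ioc,
    abs_of_pos (by positivity), ← lintegral_const_mul' _ _ ENNReal.ofReal_ne_top]
  refine lintegral_congr fun x => ?_
  congr 2
  rw [AddCircle.toCircle_apply_mk, Circle.coe_exp, Complex.exp_mul_I]
  norm_num

/-- In polar coordinates `4 ρ dρ dθ` is `2 / π` times area, as `θ` has period one. Written this way,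
the Haar integral can be moved by disk automorphisms. -/
theorem lintegral_haarPSL_eq_disk {f : ℂ → ℝ≥0∞} (hf : Measurable f) :
    ∫⁻ p, f (diskPoint p.1 p.2.1) ∂haarPSL = ENNReal.ofReal (2 / Real.pi) *
      ∫⁻ z in Metric.ball (0 : ℂ) 1, ENNReal.ofReal (1 / (1 - Complex.normSq z) ^ 2) * f z := by
  have hpi := Real.pi_pos
  have hw : Measurable fun z : ℂ => ENNReal.ofReal (1 / (1 - Complex.normSq z) ^ 2) := by
    have := Complex.continuous_normSq.measurable
    fun_prop
  set h : ℂ → ℝ≥0∞ := (Metric.ball (0 : ℂ) 1).indicator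
    fun z => ENNReal.ofReal (1 / (1 - Complex.normSq z) ^ 2) * f z with hh
  have hm : Measurable h := (hw.mul hf).indicator measurableSet_ball
  rw [lintegral_haarPSL hf, ← lintegral_indicator measurableSet_ball, ← hh,
    ← Complex.lintegral_comp_polarCoord_symm]
  have hm2 : Measurable fun p : ℝ × ℝ => ENNReal.ofReal p.1 *
      h (p.1 * (Real.cos p.2 + Real.sin p.2 * Complex.I)) := by
    refine (by fun_prop : Measurable fun p : ℝ × ℝ => ENNReal.ofReal p.1).mul (hm.comp ?_)
    fun_prop
  simp only [Complex.polarCoord_symm_apply, smul_eq_mul, polarCoord_target]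
  rw [Measure.volume_eq_prod, ← Measure.prod_restrict, lintegral_prod _ hm2.aemeasurable,
    ← setLIntegral_congr Ioo_ae_eq_Ico, ← lintegral_const_mul']
  swap
  · exact ENNReal.ofReal_ne_top
  have hsplit : ∫⁻ ρ in Set.Ioo (0 : ℝ) 1, ENNReal.ofReal (4 * ρ / (1 - ρ ^ 2) ^ 2) *
      ∫⁻ θ : UnitAddCircle, f (ρ * (AddCircle.toCircle θ : ℂ)) =
      ∫⁻ ρ in Set.Ioi (0 : ℝ), (Set.Ioo (0 : ℝ) 1).indicator (fun ρ =>
        ENNReal.ofReal (4 * ρ / (1 - ρ ^ 2) ^ 2) *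
      ∫⁻ θ : UnitAddCircle, f (ρ * (AddCircle.toCircle θ : ℂ))) ρ := by
    rw [lintegral_indicator measurableSet_Ioo, Measure.restrict_restrict measurableSet_Ioo,
      Set.inter_eq_left.2 Set.Ioo_subset_Ioi_self]
  rw [hsplit]
  refine setLIntegral_congr_fun measurableSet_Ioi fun ρ hρ => ?_
  have hρ0 : 0 < ρ := hρ
  have hang := lintegral_angle (fun w => ENNReal.ofReal ρ * h (ρ * w))
  rw [hang, lintegral_const_mul' _ _ ENNReal.ofReal_ne_top]
  by_cases h1 : ρ < 1
  · rw [Set.indicator_of_mem (Set.mem_Ioo.2 ⟨hρ0, h1⟩)]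
    have h2 : ∀ θ : UnitAddCircle, h (ρ * (AddCircle.toCircle θ : ℂ)) =
        ENNReal.ofReal (1 / (1 - ρ ^ 2) ^ 2) * f (ρ * (AddCircle.toCircle θ : ℂ)) := by
      intro θ
      rw [hh, Set.indicator_of_mem (mem_ball_zero_iff.2 (norm_ofReal_mul_toCircle hρ0.le h1 θ)),
        normSq_ofReal_mul_toCircle]
    simp only [h2]
    rw [lintegral_const_mul' _ _ ENNReal.ofReal_ne_top, ← mul_assoc, ← mul_assoc, ← mul_assoc,
      ← ENNReal.ofReal_mul (by positivity), ← ENNReal.ofReal_mul (by positivity),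
      ← ENNReal.ofReal_mul (by positivity)]
    congr 2
    field_simp
    ring
  · have h2 : ∀ θ : UnitAddCircle, h (ρ * (AddCircle.toCircle θ : ℂ)) = 0 := by
      intro θ
      rw [hh, Set.indicator_of_notMem]
      rw [mem_ball_zero_iff, norm_mul, Circle.norm_coe, mul_one, Complex.norm_real,
        Real.norm_eq_abs, abs_of_pos hρ0]
      exact h1
    rw [Set.indicator_of_notMem fun h => h1 (Set.mem_Ioo.1 h).2]
    simp [h2]

/-- The half-angle form: matrices act linearly on `(cos πx, sin πx)`, hence on `e^{iπx}` and its
conjugate. -/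
theorem poisson_coe (z : ℂ) (x : ℝ) : poisson z (x : UnitAddCircle) =
    (1 - Complex.normSq z) / Complex.normSq (Complex.exp (Real.pi * x * Complex.I) -
      z * Complex.exp (-(Real.pi * x * Complex.I))) := by
  rw [poisson, conj_toCircle_coe]
  congr 1
  have h1 : Complex.exp (Real.pi * x * Complex.I) - z * Complex.exp (-(Real.pi * x * Complex.I)) =
      Complex.exp (Real.pi * x * Complex.I) *
        (1 - z * Complex.exp (-(2 * Real.pi * x * Complex.I))) := by
    rw [mul_sub, mul_one, mul_left_comm, ← Complex.exp_add]
    congr 3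
    ring
  rw [h1, Complex.normSq_mul, Complex.normSq_eq_norm_sq (Complex.exp _),
    show (Real.pi : ℂ) * x * Complex.I = ((Real.pi * x : ℝ) : ℂ) * Complex.I by push_cast; ring,
    Complex.norm_exp_ofReal_mul_I, one_pow, one_mul]

/-- The matrix gives `r e^{iπχ} = p e^{iπφ} + q e^{-iπφ}` with a real factor `r`, and
differentiation gives `φ' = χ' r²`. In `P_z(χ) χ'` the powers of `r` cancel, which leaves `P_w(φ)
φ'` with `w = diskAut p q z`. -/
theorem exists_diskAut_of_rel {φ χ : CircleDiffeo 1} (h : pslSetoid φ χ) :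
    ∃ p q : ℂ, Complex.normSq p - Complex.normSq q = 1 ∧ ∀ z : ℂ, ‖z‖ < 1 →
      diskEnergy χ z = diskEnergy φ (diskAut p q z) := by
  obtain ⟨g, hg⟩ := h
  have hdet : g 0 0 * g 1 1 - g 0 1 * g 1 0 = 1 := by
    rw [← Matrix.det_fin_two]; exact g.2
  set a := g 0 0
  set b := g 0 1
  set c := g 1 0
  set d := g 1 1
  -- `p` and `q` are the entries of the Cayley transform of `g` in `SU(1, 1)`.
  set p : ℂ := ⟨(a + d) / 2, (b - c) / 2⟩ with hp
  set q : ℂ := ⟨(a - d) / 2, -(b + c) / 2⟩ with hq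
  have hpq : Complex.normSq p - Complex.normSq q = 1 := by
    simp only [hp, hq, Complex.normSq_mk]
    linear_combination hdet
  refine ⟨p, q, hpq, fun z hz => ?_⟩
  refine integral_congr_ae (Eventually.of_forall fun t => ?_)
  obtain ⟨x, rfl⟩ := QuotientAddGroup.mk_surjective t
  simp only
  congr 1
  have hpi := Real.pi_pos
  let N : ℝ → ℝ := fun y =>
    -(a * Real.cos (Real.pi * φ.lift y)) + b * Real.sin (Real.pi * φ.lift y)
  let D : ℝ → ℝ := fun y =>
    -(c * Real.cos (Real.pi * φ.lift y)) + d * Real.sin (Real.pi * φ.lift y)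
  have hcrit : ∀ y : ℝ, N y * Real.sin (Real.pi * χ.lift y) +
      D y * Real.cos (Real.pi * χ.lift y) = 0 := by
    intro y
    have := hg (y : UnitAddCircle)
    rw [χ.toFun_coe, φ.toFun_coe] at this
    exact (tanCoord_eq_smul_iff g _ _).1 this
  have hφ := (φ.hasDerivAt_lift x).const_mul Real.pi
  have hχ := (χ.hasDerivAt_lift x).const_mul Real.pi
  have hN : HasDerivAt N (Real.pi * φ.derivative (x : UnitAddCircle) *
      (a * Real.sin (Real.pi * φ.lift x) + b * Real.cos (Real.pi * φ.lift x))) x :=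
    (((hφ.cos.const_mul a).neg).add (hφ.sin.const_mul b)).congr_deriv (by ring)
  have hD : HasDerivAt D (Real.pi * φ.derivative (x : UnitAddCircle) *
      (c * Real.sin (Real.pi * φ.lift x) + d * Real.cos (Real.pi * φ.lift x))) x :=
    (((hφ.cos.const_mul c).neg).add (hφ.sin.const_mul d)).congr_deriv (by ring)
  -- The incidence relation holds identically along the curve, so its derivative vanishes; this
  -- links `φ'` and `χ'`.
  have hzero : HasDerivAt (fun y => N y * Real.sin (Real.pi * χ.lift y) +
      D y * Real.cos (Real.pi * χ.lift y)) 0 x := by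
    rw [funext hcrit]
    exact hasDerivAt_const _ _
  have hder := ((hN.mul hχ.sin).add (hD.mul hχ.cos)).unique hzero
  have hcx := hcrit x
  have hNx : N x = -(a * Real.cos (Real.pi * φ.lift x)) + b * Real.sin (Real.pi * φ.lift x) := rfl
  have hDx : D x = -(c * Real.cos (Real.pi * φ.lift x)) + d * Real.sin (Real.pi * φ.lift x) := rfl
  rw [φ.toFun_coe, χ.toFun_coe, poisson_coe, poisson_coe, one_sub_normSq_diskAut hpq hz]
  have hexp : ∀ y : ℝ, Complex.exp (Real.pi * y * Complex.I) =
      ⟨Real.cos (Real.pi * y), Real.sin (Real.pi * y)⟩ := by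
    intro y
    rw [← Complex.ofReal_mul]
    exact Complex.ext (Complex.exp_ofReal_mul_I_re _) (Complex.exp_ofReal_mul_I_im _)
  have hexp' : ∀ y : ℝ, Complex.exp (-(Real.pi * y * Complex.I)) =
      ⟨Real.cos (Real.pi * y), -Real.sin (Real.pi * y)⟩ := by
    intro y
    rw [← Complex.ofReal_mul, ← neg_mul, ← Complex.ofReal_neg]
    refine Complex.ext ((Complex.exp_ofReal_mul_I_re _).trans (Real.cos_neg _))
      ((Complex.exp_ofReal_mul_I_im _).trans (Real.sin_neg _))
  have htφ := Real.sin_sq_add_cos_sq (Real.pi * φ.lift x)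
  have htχ := Real.sin_sq_add_cos_sq (Real.pi * χ.lift x)
  have hposφ : Complex.exp (Real.pi * φ.lift x * Complex.I) -
      diskAut p q z * Complex.exp (-(Real.pi * φ.lift x * Complex.I)) ≠ 0 := by
    intro h0
    have h1 := poisson_pos (norm_diskAut_lt_one hpq hz) ((φ.lift x : ℝ) : UnitAddCircle)
    rw [poisson_coe, h0] at h1
    simp at h1
  have hposχ : Complex.exp (Real.pi * χ.lift x * Complex.I) -
      z * Complex.exp (-(Real.pi * χ.lift x * Complex.I)) ≠ 0 := by
    intro h0
    have h1 := poisson_pos hz ((χ.lift x : ℝ) : UnitAddCircle)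
    rw [poisson_coe, h0] at h1
    simp at h1
  rw [hexp, hexp'] at hposφ hposχ ⊢
  rw [hexp, hexp']
  set Cφ := Real.cos (Real.pi * φ.lift x)
  set Sφ := Real.sin (Real.pi * φ.lift x)
  set Cχ := Real.cos (Real.pi * χ.lift x)
  set Sχ := Real.sin (Real.pi * χ.lift x)
  -- `r` is the factor by which the image `(N, D)` exceeds the unit vector `(-cos πχ, sin πχ)`.
  set r : ℝ := -(N x * Cχ) + D x * Sχ with hr
  have hrD : r * Sχ = D x := by linear_combination (-Cχ) * hcx + D x * htχ
  have hrN : r * Cχ = -N x := by linear_combination Sχ * hcx - N x * htχ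
  have hfr : φ.derivative (x : UnitAddCircle) = χ.derivative (x : UnitAddCircle) * r ^ 2 := by
    refine mul_left_cancel₀ hpi.ne' ?_
    linear_combination r * hder -
      (Real.pi * φ.derivative (x : UnitAddCircle) * (a * Sφ + b * Cφ)) * hrD -
      (Real.pi * φ.derivative (x : UnitAddCircle) * (c * Sφ + d * Cφ)) * hrN -
      (Real.pi * φ.derivative (x : UnitAddCircle)) * hdet - (Real.pi *
        φ.derivative (x : UnitAddCircle) * (a * d - b * c)) * htφ
  have hW : ((r : ℂ)) * ((⟨Cχ, Sχ⟩ : ℂ) - z * ⟨Cχ, -Sχ⟩) =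
      (p - starRingEnd ℂ q * z) * ((⟨Cφ, Sφ⟩ : ℂ) - diskAut p q z * ⟨Cφ, -Sφ⟩) := by
    have h4 : diskAut p q z * (p - starRingEnd ℂ q * z) = starRingEnd ℂ p * z - q :=
      div_mul_cancel₀ _ (diskAut_denom_ne_zero hpq hz)
    have h5 : (r : ℂ) * (⟨Cχ, Sχ⟩ : ℂ) = p * ⟨Cφ, Sφ⟩ + q * ⟨Cφ, -Sφ⟩ := by
      apply Complex.ext
      · simp [hp, hq]
        linear_combination hrN - hNx
      · simp [hp, hq]
        linear_combination hrD + hDx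
    have h6 : (r : ℂ) * (⟨Cχ, -Sχ⟩ : ℂ) =
        starRingEnd ℂ p * ⟨Cφ, -Sφ⟩ + starRingEnd ℂ q * ⟨Cφ, Sφ⟩ := by
      apply Complex.ext
      · simp [hp, hq]
        linear_combination hrN - hNx
      · simp [hp, hq]
        linear_combination -hrD - hDx
    linear_combination h5 - z * h6 + (⟨Cφ, -Sφ⟩ : ℂ) * h4
  have hW2 := congrArg Complex.normSq hW
  rw [Complex.normSq_mul, Complex.normSq_mul, Complex.normSq_ofReal] at hW2
  have hd1 := Complex.normSq_pos.2 (diskAut_denom_ne_zero hpq hz)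
  have hd2 := Complex.normSq_pos.2 hposφ
  have hd3 := Complex.normSq_pos.2 hposχ
  rw [hfr, div_div, ← hW2, div_mul_eq_mul_div, div_mul_eq_mul_div]
  have hr0 : r ≠ 0 := by
    intro h0
    rw [h0, zero_mul, zero_mul] at hW2
    exact (mul_pos hd1 hd2).ne hW2
  field_simp

/-- The lift is written with arbitrarily chosen representatives; invariance along orbits makes the
weight a function on the quotient, to which continuity descends. -/
theorem haarWeight_eq_of_rel (l : ℝ) {φ χ : CircleDiffeo 1} (h : pslSetoid φ χ) :
    haarWeight l χ = haarWeight l φ := by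
  obtain ⟨p, q, hpq, hE⟩ := exists_diskAut_of_rel h
  rw [haarWeight_eq_disk, haarWeight_eq_disk,
    lintegral_haarPSL_eq_disk (measurable_exp_neg_diskEnergy l χ),
    lintegral_haarPSL_eq_disk (measurable_exp_neg_diskEnergy l φ), 
    ← lintegral_disk_diskAut hpq fun z => ENNReal.ofReal (Real.exp (-(l * diskEnergy φ z)))]
  congr 1
  refine setLIntegral_congr_fun measurableSet_ball fun z hz => ?_
  rw [hE z (mem_ball_zero_iff.1 hz)]

/-! ### Möbius maps and pinning stay within a class -/

open CircleDiffeo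

/-- With `E = e^{iπy}` and `B = e^{iπb}`, the image point is represented by `B (E - z Ē) = u cos πy
+ i v sin πy`, which is real-linear in `E`. Its matrix has determinant `Re (u v̄) = 1 - |z|²`,
whence the division by `κ`. -/
theorem rel_postcomp_mobius (z : Complex.UnitDisc) (a : UnitAddCircle) (φ : CircleDiffeo 1) :
    pslSetoid φ (postcomp (mobius z a) φ) := by
  obtain ⟨b, rfl⟩ := QuotientAddGroup.mk_surjective a
  have hz : 0 < 1 - Complex.normSq (z : ℂ) := by linarith [normSq_lt_one z.norm_lt_one]
  set κ := √(1 - Complex.normSq (z : ℂ)) with hκ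
  have hκ0 : 0 < κ := Real.sqrt_pos.2 hz
  have hκ2 : κ ^ 2 = 1 - Complex.normSq (z : ℂ) := Real.sq_sqrt hz.le
  set B : ℂ := Complex.exp ((Real.pi * b : ℝ) * Complex.I) with hB
  have hB1 : Complex.normSq B = 1 := by
    rw [Complex.normSq_eq_norm_sq, hB, Complex.norm_exp_ofReal_mul_I, one_pow]
  set u : ℂ := B - B * z with hu
  set v : ℂ := B + B * z with hv
  have huv : u.re * v.re + u.im * v.im = κ ^ 2 := by
    rw [hκ2]
    rw [Complex.normSq_apply] at hB1 ⊢
    simp only [hu, hv, Complex.sub_re, Complex.add_re, Complex.sub_im, Complex.add_im,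
      Complex.mul_re, Complex.mul_im]
    linear_combination (1 - (z : ℂ).re * (z : ℂ).re - (z : ℂ).im * (z : ℂ).im) * hB1
  let g : SL(2, ℝ) := ⟨!![u.re / κ, v.im / κ; -u.im / κ, v.re / κ], by
    rw [Matrix.det_fin_two_of]
    field_simp
    linear_combination huv⟩
  refine ⟨g, fun t => ?_⟩
  obtain ⟨x, rfl⟩ := QuotientAddGroup.mk_surjective t
  change tanCoord ((mobius z (b : UnitAddCircle)).toFun (φ.toFun (x : UnitAddCircle))) =
    (g : GL (Fin 2) ℝ) • tanCoord (φ.toFun (x : UnitAddCircle))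
  rw [φ.toFun_coe, mobius_toFun_coe, tanCoord_eq_smul_iff]
  set y := φ.lift x
  set w := b + diskAngle z y with hw
  have h00 : g 0 0 = u.re / κ := rfl
  have h01 : g 0 1 = v.im / κ := rfl
  have h10 : g 1 0 = -u.im / κ := rfl
  have h11 : g 1 1 = v.re / κ := rfl
  rw [h00, h01, h10, h11]
  set E : ℂ := Complex.exp ((Real.pi * y : ℝ) * Complex.I) with hE
  set Y : ℂ := Complex.exp ((Real.pi * w : ℝ) * Complex.I) with hY
  have hEre : E.re = Real.cos (Real.pi * y) := Complex.exp_ofReal_mul_I_re _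
  have hEim : E.im = Real.sin (Real.pi * y) := Complex.exp_ofReal_mul_I_im _
  have hYre : Y.re = Real.cos (Real.pi * w) := Complex.exp_ofReal_mul_I_re _
  have hYim : Y.im = Real.sin (Real.pi * w) := Complex.exp_ofReal_mul_I_im _
  have hconj : ∀ r : ℝ, Complex.exp ((r : ℂ) * Complex.I) *
      starRingEnd ℂ (Complex.exp ((r : ℂ) * Complex.I)) = 1 := by
    intro r
    rw [Complex.mul_conj, Complex.normSq_eq_norm_sq, Complex.norm_exp_ofReal_mul_I]
    simp
  have hEc := hconj (Real.pi * y)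
  have hYc := hconj (Real.pi * w)
  have hBc := hconj (Real.pi * b)
  rw [← hE] at hEc
  rw [← hY] at hYc
  rw [← hB] at hBc
  set W : ℂ := B * (E - z * starRingEnd ℂ E) with hW
  -- As `|Y| = 1`, this says that `W / Y` is real, so that `W` and `Y` represent the same projective
  -- point.
  have hmap : Y ^ 2 * starRingEnd ℂ W = W := by
    have h1 := diskMap_coe z y
    have h2 : (AddCircle.toCircle (y : UnitAddCircle) : ℂ) = E ^ 2 := by
      rw [AddCircle.toCircle_apply_mk, Circle.coe_exp, hE, ← Complex.exp_nat_mul]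
      congr 1
      push_cast
      ring
    have h3 : Complex.exp ((2 * Real.pi * diskAngle z y : ℝ) * Complex.I) * B ^ 2 = Y ^ 2 := by
      rw [hB, hY, ← Complex.exp_nat_mul, ← Complex.exp_nat_mul, ← Complex.exp_add]
      congr 1
      rw [hw]
      push_cast
      ring
    rw [← h3, ← h1, diskMap, h2]
    have hne : 1 - starRingEnd ℂ (z : ℂ) * E ^ 2 ≠ 0 := by
      intro h0
      have h4 : ‖starRingEnd ℂ (z : ℂ) * E ^ 2‖ = 1 := by
        rw [← sub_eq_zero.1 h0, norm_one]
      rw [norm_mul, norm_pow, hE, Complex.norm_exp_ofReal_mul_I, RCLike.norm_conj, one_pow,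
        mul_one] at h4
      exact z.norm_lt_one.ne h4
    rw [div_mul_eq_mul_div, div_mul_eq_mul_div, div_eq_iff hne, hW]
    simp only [map_mul, map_sub, Complex.conj_conj]
    linear_combination ((E ^ 2 - z) * B * (starRingEnd ℂ E - starRingEnd ℂ (z : ℂ) * E)) * hBc +
      (E * B * (1 - z * starRingEnd ℂ (z : ℂ))) * hEc
  have him : (starRingEnd ℂ Y * W).im = 0 := by
    have h5 : starRingEnd ℂ (starRingEnd ℂ Y * W) = starRingEnd ℂ Y * W := by
      rw [map_mul, Complex.conj_conj]
      linear_combination starRingEnd ℂ Y * hmap - (Y * starRingEnd ℂ W) * hYc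
    exact Complex.conj_eq_iff_im.1 h5
  rw [← hEre, ← hEim, ← hYre, ← hYim]
  have hfin : -(u.re / κ * E.re) + v.im / κ * E.im = -W.re / κ := by
    simp only [hW, hu, hv, Complex.sub_re, Complex.sub_im, Complex.add_im,
      Complex.mul_re, Complex.mul_im, Complex.conj_re, Complex.conj_im]
    field_simp
    ring
  have hfin2 : -(-u.im / κ * E.re) + v.re / κ * E.im = W.im / κ := by
    simp only [hW, hu, hv, Complex.sub_re, Complex.add_re, Complex.sub_im,
      Complex.mul_re, Complex.mul_im, Complex.conj_re, Complex.conj_im]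
    field_simp
    ring
  rw [hfin, hfin2]
  rw [Complex.mul_im, Complex.conj_re, Complex.conj_im] at him
  field_simp
  linear_combination him

theorem mk_postcomp_mobius (z : Complex.UnitDisc) (a : UnitAddCircle) (φ : CircleDiffeo 1) :
    DiffModPSL.mk (postcomp (mobius z a) φ) = DiffModPSL.mk φ :=
  Quotient.sound (Setoid.symm (rel_postcomp_mobius z a φ))

/-- Pinning is post-composition with the rotation `φ_{0,a}`, which lies in `PSL(2, ℝ)`; therefore it
does not change the class. -/
theorem pin_eq_postcomp (t₀ : UnitAddCircle) (φ : CircleDiffeo 1) :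
    pin t₀ φ = postcomp (mobius 0 (-φ.toFun t₀)) φ := by
  ext t
  obtain ⟨x, rfl⟩ := QuotientAddGroup.mk_surjective t
  obtain ⟨x₀, rfl⟩ := QuotientAddGroup.mk_surjective t₀
  change φ.toFun (x : UnitAddCircle) - φ.toFun (x₀ : UnitAddCircle) =
    (mobius 0 (-φ.toFun (x₀ : UnitAddCircle))).toFun (φ.toFun (x : UnitAddCircle))
  rw [φ.toFun_coe, φ.toFun_coe, ← AddCircle.coe_neg, mobius_toFun_coe, ← AddCircle.coe_sub]
  congr 1
  simp [diskAngle]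
  ring

theorem mk_pin (t₀ : UnitAddCircle) (φ : CircleDiffeo 1) :
    DiffModPSL.mk (pin t₀ φ) = DiffModPSL.mk φ := by
  rw [pin_eq_postcomp, mk_postcomp_mobius]

/-! ### Continuity of the Haar integral -/

theorem continuous_diskEnergy {z : ℂ} (hz : ‖z‖ < 1) :
    Continuous fun φ : CircleDiffeo 1 => diskEnergy φ z := by
  have := continuous_poisson hz
  exact continuous_integral_comp (K := fun p => (poisson z p.1 * p.2) ^ 2) (by fun_prop)

theorem le_diskEnergy {φ : CircleDiffeo 1} {m : ℝ} (hm : ∀ t, m ≤ φ.derivative t) {z : ℂ}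
    (hz : ‖z‖ < 1) :
    m * ((1 + Complex.normSq z) / (1 - Complex.normSq z)) ≤ diskEnergy φ z := by
  have hP := continuous_poisson hz
  have hφ := φ.continuous_derivative
  have hc : Continuous fun t => poisson z (φ.toFun t) := hP.comp φ.continuous_toFun
  rw [← integral_poisson_sq hz, ← φ.integral_comp_mul_derivative (q := fun s => poisson z s ^ 2)
    (hP.pow 2), ← integral_const_mul]
  refine integral_mono (integrable_of_continuous_circle (by fun_prop))
    (integrable_of_continuous_circle (by fun_prop)) fun t => ?_
  have h1 : 0 ≤ poisson z (φ.toFun t) ^ 2 * φ.derivative t :=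
    mul_nonneg (sq_nonneg _) (φ.derivative_pos t).le
  have := mul_le_mul_of_nonneg_right (hm t) h1
  simp only at this ⊢
  linarith

theorem exists_eventually_le_derivative (φ : CircleDiffeo 1) :
    ∃ m, 0 < m ∧ ∀ᶠ χ in 𝓝 φ, ∀ t, m ≤ χ.derivative t := by
  obtain ⟨s₀, -, hs₀⟩ := isCompact_univ.exists_isMinOn Set.univ_nonempty
    φ.continuous_derivative.continuousOn
  have hm := half_pos (φ.derivative_pos s₀)
  refine ⟨φ.derivative s₀ / 2, hm, ?_⟩
  have hsnd : Continuous fun φ : CircleDiffeo 1 =>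
      (⟨φ.derivative, φ.continuous_derivative⟩ : C(UnitAddCircle, ℝ)) :=
    continuous_snd.comp isInducing_coordinates.continuous
  filter_upwards [hsnd.continuousAt.eventually (Metric.ball_mem_nhds _ hm)] with χ hχ t
  have h1 : dist (χ.derivative t) (φ.derivative t) < φ.derivative s₀ / 2 :=
    (ContinuousMap.dist_apply_le_dist t).trans_lt (Metric.mem_ball.1 hχ)
  have h2 : φ.derivative s₀ ≤ φ.derivative t := hs₀ (Set.mem_univ t)
  rw [Real.dist_eq] at h1
  linarith [(abs_lt.1 h1).1]

/-- On a neighbourhood of `φ` all derivatives exceed some `m > 0`, so the energy is at least `m`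
times the radial coordinate. The resulting exponential is Haar integrable and dominates. -/
theorem continuous_haarWeight {l : ℝ} (hl : 0 < l) : Continuous (haarWeight l) := by
  rw [continuous_iff_continuousAt]
  intro φ
  obtain ⟨m, hm, hev⟩ := exists_eventually_le_derivative φ
  have hfun : haarWeight l = fun φ => ∫⁻ p, ENNReal.ofReal (Real.exp (-(l *
      diskEnergy φ (diskPoint p.1 p.2.1)))) ∂haarPSL := funext (haarWeight_eq_disk l)
  have hpt : Measurable fun p : PSLCoord => ((diskPoint p.1 p.2.1 : Complex.UnitDisc) : ℂ) :=
    (Complex.continuous_ofReal.measurable.comp (measurable_subtype_coe.comp measurable_fst)).mul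
      (measurable_toCircle_coe.comp (measurable_fst.comp measurable_snd))
  have hbm : Measurable fun z : ℂ => ENNReal.ofReal (Real.exp (-(l * (m *
      ((1 + Complex.normSq z) / (1 - Complex.normSq z)))))) := by
    have := Complex.continuous_normSq.measurable
    fun_prop
  rw [hfun]
  refine tendsto_lintegral_filter_of_dominated_convergence
    (fun p => ENNReal.ofReal (Real.exp (-(l * (m *
      ((1 + Complex.normSq (diskPoint p.1 p.2.1 : ℂ)) /
        (1 - Complex.normSq (diskPoint p.1 p.2.1 : ℂ)))))))) ?_ ?_ ?_ ?_
  · exact Eventually.of_forall fun χ => (measurable_exp_neg_diskEnergy l χ).comp hpt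
  · filter_upwards [hev] with χ hχ
    refine Eventually.of_forall fun p => ENNReal.ofReal_le_ofReal (Real.exp_le_exp.2 ?_)
    exact neg_le_neg (mul_le_mul_of_nonneg_left
      (le_diskEnergy hχ (diskPoint p.1 p.2.1).norm_lt_one) hl.le)
  · rw [lintegral_haarPSL hbm]
    have h1 := lintegral_radial (a := 0) le_rfl one_pos (mul_pos hl hm)
    refine ne_of_eq_of_ne ?_ (h1 ▸ ENNReal.ofReal_ne_top)
    refine setLIntegral_congr_fun measurableSet_Ico fun ρ _ => ?_
    simp only [normSq_ofReal_mul_toCircle, lintegral_const, measure_univ, mul_one, radial,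
      mul_assoc]
  · refine Eventually.of_forall fun p => ?_
    have := (continuous_diskEnergy (diskPoint p.1 p.2.1).norm_lt_one).tendsto φ
    exact (ENNReal.continuous_ofReal.tendsto _).comp
      ((Real.continuous_exp.tendsto _).comp ((this.const_mul l).neg))

theorem continuous_mk : Continuous DiffModPSL.mk := continuous_coinduced_rng

theorem haarWeight_rep (l : ℝ) (φ : CircleDiffeo 1) :
    haarWeight l (DiffModPSL.mk φ).rep = haarWeight l φ :=
  haarWeight_eq_of_rel l (Setoid.symm (Quotient.mk_out (s := pslSetoid) φ))

theorem continuous_haarWeight_rep {l : ℝ} (hl : 0 < l) :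
    Continuous fun q : DiffModPSL => haarWeight l q.rep := by
  refine continuous_coinduced_dom.2 ((continuous_haarWeight hl).congr fun φ => ?_)
  exact (haarWeight_rep l φ).symm

/-! ### The limit formula -/

theorem measurable_orbitDensity (σ α2 : ℝ) :
    Measurable fun φ : CircleDiffeo 1 => ENNReal.ofReal (Real.exp
      (2 * (α2 - Real.pi ^ 2) / σ ^ 2 * ∫ τ in (0 : ℝ)..1, deriv φ.lift τ ^ 2)) := by
  simp only [← energy_eq]
  have := continuous_energy.measurable
  fun_prop

theorem lintegral_changeOrbit (σ α2 : ℝ) (L : Measure (CircleDiffeo 1))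
    {H : CircleDiffeo 1 → ℝ≥0∞} (hH : Measurable H) :
    ∫⁻ φ, H φ ∂(changeOrbit σ α2 L) = ∫⁻ φ, ENNReal.ofReal (Real.exp
      (-(2 * (Real.pi ^ 2 - α2) / σ ^ 2 * energy φ))) * H φ ∂L := by
  rw [changeOrbit, lintegral_withDensity_eq_lintegral_mul _ (measurable_orbitDensity σ α2) hH]
  refine lintegral_congr fun φ => ?_
  rw [Pi.mul_apply, ← energy_eq]
  congr 4
  ring

/-- A function of the class is constant along the orbit and leaves the inner integral, so only the
Gibbs weight is integrated over the group. -/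
theorem lintegral_lift_mul {M : Measure DiffModPSL} {L : Measure (CircleDiffeo 1)}
    (hL : IsPSLLift M L) (l : ℝ) {F : DiffModPSL → ℝ≥0∞} (hF : Continuous F) :
    ∫⁻ φ, ENNReal.ofReal (Real.exp (-(l * energy φ))) * F (DiffModPSL.mk φ) ∂L =
      ∫⁻ q, haarWeight l q.rep * F q ∂M := by
  have hc : Continuous fun φ : CircleDiffeo 1 =>
      ENNReal.ofReal (Real.exp (-(l * energy φ))) * F (DiffModPSL.mk φ) := by
    have h1 : Continuous fun φ : CircleDiffeo 1 =>
        ENNReal.ofReal (Real.exp (-(l * energy φ))) := by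
      have := continuous_energy
      exact ENNReal.continuous_ofReal.comp (by fun_prop)
    rw [continuous_iff_continuousAt]
    intro φ
    -- `F` may take the values `0` and `∞`; the product is still continuous because the weight is
    -- positive and finite.
    refine ENNReal.Tendsto.mul (h1.tendsto φ) (Or.inl ?_) ((hF.comp continuous_mk).tendsto φ)
      (Or.inr ENNReal.ofReal_ne_top)
    simpa using Real.exp_pos _
  rw [hL _ hc]
  refine lintegral_congr fun q => ?_
  have h2 : ∀ p : PSLCoord, F (DiffModPSL.mk (postcomp p.toDiffeo q.rep)) = F q := by
    intro p
    rw [PSLCoord.toDiffeo, mk_postcomp_mobius]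
    exact congrArg F (Quotient.out_eq (s := pslSetoid) q)
  simp only [h2]
  have hpt : Measurable fun p : PSLCoord => ((diskPoint p.1 p.2.1 : Complex.UnitDisc) : ℂ) :=
    (Complex.continuous_ofReal.measurable.comp (measurable_subtype_coe.comp measurable_fst)).mul
      (measurable_toCircle_coe.comp (measurable_fst.comp measurable_snd))
  rw [lintegral_mul_const]
  · rfl
  · simp only [PSLCoord.toDiffeo, energy_postcomp_mobius]
    exact (measurable_exp_neg_diskEnergy l q.rep).comp hpt

theorem lintegral_pinned {M : Measure DiffModPSL} {L : Measure (CircleDiffeo 1)}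
    (hL : IsPSLLift M L) (σ α2 : ℝ) {F : DiffModPSL → ℝ≥0∞} (hF : Continuous F) :
    ∫⁻ φ, F (DiffModPSL.mk φ) ∂(pinned 0 (changeOrbit σ α2 L)) =
      ∫⁻ q, haarWeight (2 * (Real.pi ^ 2 - α2) / σ ^ 2) q.rep * F q ∂M := by
  have hm : Measurable fun φ => F (DiffModPSL.mk φ) := (hF.comp continuous_mk).measurable
  rw [pinned, lintegral_map hm (continuous_pin 0).measurable]
  simp only [mk_pin]
  rw [lintegral_changeOrbit _ _ _ hm, lintegral_lift_mul hL _ hF]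

/-- Fatou's lemma gives the lower bound and `l h_l ≤ 1` the upper one. No integrability of `F` is
needed, so the case `∞` is included. -/
theorem tendsto_lintegral_haarWeight (M : Measure DiffModPSL) {F : DiffModPSL → ℝ≥0∞}
    (hF : Continuous F) :
    Tendsto (fun l : ℝ => ∫⁻ q, ENNReal.ofReal l * (haarWeight l q.rep * F q) ∂M)
      (𝓝[>] 0) (𝓝 (∫⁻ q, F q ∂M)) := by
  refine tendsto_of_seq_tendsto fun u hu => ?_
  have hpos : ∀ᶠ n in atTop, 0 < u n := hu.eventually self_mem_nhdsWithin
  obtain ⟨n₀, hn₀⟩ := eventually_atTop.1 hpos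
  -- The shift makes every term of the sequence positive, as the measurability in Fatou's lemma is
  -- needed for each index.
  refine (tendsto_add_atTop_iff_nat n₀).1 ?_
  have hu' : Tendsto (fun n => u (n + n₀)) atTop (𝓝[>] 0) := (tendsto_add_atTop_iff_nat n₀).2 hu
  have hpos' : ∀ n, 0 < u (n + n₀) := fun n => hn₀ _ (Nat.le_add_left _ _)
  refine tendsto_of_le_liminf_of_limsup_le ?_ ?_
  · have hlim : ∀ q : DiffModPSL, F q = liminf (fun n => ENNReal.ofReal (u (n + n₀)) *
        (haarWeight (u (n + n₀)) q.rep * F q)) atTop := by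
      intro q
      have h := ENNReal.Tendsto.mul ((tendsto_mul_haarWeight q.rep).comp hu')
        (Or.inl one_ne_zero) (tendsto_const_nhds (x := F q)) (Or.inr ENNReal.one_ne_top)
      rw [one_mul] at h
      refine (h.congr fun n => ?_).liminf_eq.symm
      simp only [Function.comp_apply, mul_assoc]
    rw [lintegral_congr hlim]
    refine lintegral_liminf_le fun n => ?_
    exact ((continuous_haarWeight_rep (hpos' n)).measurable.mul hF.measurable).const_mul _
  · refine limsup_le_of_le (by isBoundedDefault) (Eventually.of_forall fun n => ?_)
    refine lintegral_mono fun q => ?_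
    rw [← mul_assoc]
    calc _ ≤ 1 * F q := by
          refine mul_le_mul_left ?_ _
          calc _ ≤ ENNReal.ofReal (u (n + n₀)) * ENNReal.ofReal (1 / u (n + n₀)) :=
                mul_le_mul_right (haarWeight_le _ (hpos' n)) _
            _ = 1 := by
                rw [← ENNReal.ofReal_mul (hpos' n).le, mul_one_div_cancel (hpos' n).ne',
                  ENNReal.ofReal_one]
      _ = F q := one_mul _

/-- With `l = 2 (π² - α²) / σ²` the prefactor is `l · 2π / (π + α)`, and the second factor tends to
`1`. -/
theorem tendsto_pinned {σ : ℝ} (hσ : 0 < σ) {M : Measure DiffModPSL}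
    {L : Measure (CircleDiffeo 1)} (hL : IsPSLLift M L) {F : DiffModPSL → ℝ≥0∞}
    (hF : Continuous F) :
    Tendsto (fun α : ℝ => ENNReal.ofReal (4 * Real.pi * (Real.pi - α) / σ ^ 2) *
        ∫⁻ φ, F (DiffModPSL.mk φ) ∂(pinned 0 (changeOrbit σ (α ^ 2) L)))
      (𝓝[<] Real.pi) (𝓝 (∫⁻ q, F q ∂M)) := by
  have hpi := Real.pi_pos
  have hl : Tendsto (fun α : ℝ => 2 * (Real.pi ^ 2 - α ^ 2) / σ ^ 2) (𝓝[<] Real.pi)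
      (𝓝[>] 0) := by
    refine tendsto_nhdsWithin_iff.2 ⟨?_, ?_⟩
    · have : Continuous fun α : ℝ => 2 * (Real.pi ^ 2 - α ^ 2) / σ ^ 2 := by fun_prop
      simpa using (this.tendsto Real.pi).mono_left nhdsWithin_le_nhds
    · filter_upwards [Ioo_mem_nhdsLT (show (0 : ℝ) < Real.pi from hpi)] with α hα
      have : 0 < Real.pi ^ 2 - α ^ 2 := by nlinarith [hα.1, hα.2]
      exact Set.mem_Ioi.2 (by positivity)
  have h1 := (tendsto_lintegral_haarWeight M hF).comp hl
  have h2 : Tendsto (fun α : ℝ => ENNReal.ofReal (2 * Real.pi / (Real.pi + α))) (𝓝[<] Real.pi)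
      (𝓝 1) := by
    have h3 : ContinuousAt (fun α : ℝ => 2 * Real.pi / (Real.pi + α)) Real.pi :=
      ContinuousAt.div (by fun_prop) (by fun_prop) (by positivity)
    have h4 := (ENNReal.continuous_ofReal.tendsto _).comp
      (h3.tendsto.mono_left (nhdsWithin_le_nhds (s := Set.Iio Real.pi)))
    have h5 : 2 * Real.pi / (Real.pi + Real.pi) = 1 := by
      field_simp
      ring
    rw [h5, ENNReal.ofReal_one] at h4
    exact h4
  have h3 := ENNReal.Tendsto.mul h2 (Or.inl one_ne_zero) h1 (Or.inr ENNReal.one_ne_top)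
  rw [one_mul] at h3
  refine h3.congr' ?_
  filter_upwards [Ioo_mem_nhdsLT (show (0 : ℝ) < Real.pi from hpi)] with α hα
  have hα0 : 0 < α := hα.1
  have hd : 0 < Real.pi - α := by linarith [hα.2]
  simp only [Function.comp_apply]
  rw [lintegral_pinned hL _ _ hF, lintegral_const_mul' _ _ ENNReal.ofReal_ne_top, ← mul_assoc,
    ← ENNReal.ofReal_mul (by positivity)]
  congr 2
  have : Real.pi + α ≠ 0 := by positivity
  field_simp
  ring

/-! ### Quasi-invariance of the orbital measures -/

/-- `∫_𝕋 q(φ(τ)) φ'(τ)² dτ`. -/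
noncomputable def CircleDiffeo.energyWith (q : UnitAddCircle → ℝ) (φ : CircleDiffeo 1) : ℝ :=
  ∫ t, q (φ.toFun t) * φ.derivative t ^ 2

theorem continuous_energyWith {q : UnitAddCircle → ℝ} (hq : Continuous q) :
    Continuous (energyWith q) :=
  continuous_integral_comp (K := fun p => q p.1 * p.2 ^ 2) (by fun_prop)

theorem integrable_energyWith {q : UnitAddCircle → ℝ} (hq : Continuous q) (φ : CircleDiffeo 1) :
    Integrable fun t => q (φ.toFun t) * φ.derivative t ^ 2 :=
  integrable_of_continuous_circle
    ((hq.comp φ.continuous_toFun).mul (φ.continuous_derivative.pow 2))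

theorem abs_energyWith_le {q : UnitAddCircle → ℝ} {b : ℝ} (hb : ∀ t, |q t| ≤ b)
    (φ : CircleDiffeo 1) : |energyWith q φ| ≤ b * energy φ := by
  rw [energyWith, energy, ← integral_const_mul, ← Real.norm_eq_abs]
  refine norm_integral_le_of_norm_le (integrable_of_continuous_circle
    (continuous_const.mul (φ.continuous_derivative.pow 2))) (Eventually.of_forall fun t => ?_)
  rw [Real.norm_eq_abs, abs_mul, abs_of_nonneg (sq_nonneg (φ.derivative t))]
  exact mul_le_mul_of_nonneg_right (hb _) (sq_nonneg _)

theorem energyWith_sub {q q' : UnitAddCircle → ℝ} (hq : Continuous q) (hq' : Continuous q')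
    (φ : CircleDiffeo 1) :
    energyWith (fun t => q t - q' t) φ = energyWith q φ - energyWith q' φ := by
  rw [energyWith, energyWith, energyWith,
    ← integral_sub (integrable_energyWith hq φ) (integrable_energyWith hq' φ)]
  simp only [sub_mul]

/-- The density exponent of `ψ` with respect to the orbital measure with parameter `α2`, where `s`
is the Schwarzian derivative of `ψ`. -/
noncomputable def CircleDiffeo.exponent (ψ : CircleDiffeo 3) (s : UnitAddCircle → ℝ) (α2 : ℝ)
    (t : UnitAddCircle) : ℝ :=
  s t + 2 * α2 * (ψ.derivative t ^ 2 - 1)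

section

variable {ψ : CircleDiffeo 3} {s : UnitAddCircle → ℝ}

theorem continuous_exponent (hs : Continuous s) (hψ : Continuous ψ.derivative) (α2 : ℝ) :
    Continuous (ψ.exponent s α2) := by
  unfold CircleDiffeo.exponent
  fun_prop

theorem changeDensity_eq (hs' : ∀ x : ℝ, s (x : UnitAddCircle) = schwarzian ψ.lift x)
    (σ α2 : ℝ) (φ : CircleDiffeo 1) : changeDensity σ α2 ψ φ =
      ENNReal.ofReal (Real.exp (1 / σ ^ 2 * energyWith (ψ.exponent s α2) φ)) := by
  rw [changeDensity, energyWith, ← intervalIntegral_circle]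
  simp only [CircleDiffeo.exponent, φ.toFun_coe, hs', derivative_coe]

theorem measurable_exp_energyWith {q : UnitAddCircle → ℝ} (hq : Continuous q) (a : ℝ) :
    Measurable fun φ => ENNReal.ofReal (Real.exp (a * energyWith q φ)) := by
  have := (continuous_energyWith hq).measurable
  fun_prop

theorem lintegral_postcomp {σ α2 : ℝ} {L : Measure (CircleDiffeo 1)}
    (hL : IsOrbitalMeasure σ α2 L) (hs : Continuous s) (hψ : Continuous ψ.derivative)
    (hs' : ∀ x : ℝ, s (x : UnitAddCircle) = schwarzian ψ.lift x)
    {H : CircleDiffeo 1 → ℝ≥0∞} (hH : Measurable H) :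
    ∫⁻ φ, H φ ∂L = ∫⁻ φ, ENNReal.ofReal (Real.exp (1 / σ ^ 2 *
      energyWith (ψ.exponent s α2) φ)) * H (postcomp ψ φ) ∂L := by
  have hD := measurable_exp_energyWith (continuous_exponent hs hψ α2) (1 / σ ^ 2)
  have hp := (continuous_postcomp ψ hψ).measurable
  have hmap : (L.withDensity fun φ => ENNReal.ofReal (Real.exp (1 / σ ^ 2 *
      energyWith (ψ.exponent s α2) φ))).map (postcomp ψ) = L := by
    ext B hB
    rw [Measure.map_apply hp hB, withDensity_apply _ (hp hB)]
    have h := hL.change_of_variables ψ (postcomp ψ ⁻¹' B) (hp hB)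
    rw [Set.image_preimage_eq _ ψ.postcomp_bijective.2] at h
    rw [h]
    exact setLIntegral_congr_fun (hp hB) fun φ _ => (changeDensity_eq hs' σ α2 φ).symm
  conv_lhs => rw [← hmap]
  rw [lintegral_map hH hp]
  exact lintegral_withDensity_eq_lintegral_mul _ hD (hH.comp hp)

/-- The orbital measure with parameter `β2` that belongs to a `π`-orbital measure is
quasi-invariant, with the density of the parameter `β2`. -/
theorem changeOrbit_eq_map {σ : ℝ} (β2 : ℝ) {L : Measure (CircleDiffeo 1)}
    (hL : IsOrbitalMeasure σ (Real.pi ^ 2) L) (hs : Continuous s) (hψ : Continuous ψ.derivative)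
    (hs' : ∀ x : ℝ, s (x : UnitAddCircle) = schwarzian ψ.lift x) :
    ((changeOrbit σ β2 L).withDensity fun φ => ENNReal.ofReal (Real.exp (1 / σ ^ 2 *
      energyWith (ψ.exponent s β2) φ))).map (postcomp ψ) = changeOrbit σ β2 L := by
  have hD := measurable_exp_energyWith (continuous_exponent hs hψ β2) (1 / σ ^ 2)
  have hp := (continuous_postcomp ψ hψ).measurable
  have hE := continuous_energy.measurable
  ext B hB
  rw [Measure.map_apply hp hB, withDensity_apply _ (hp hB),
    ← lintegral_indicator (hp hB), ← lintegral_indicator_one hB,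
    lintegral_changeOrbit _ _ _ (measurable_one.indicator hB),
    lintegral_changeOrbit _ _ _ (hD.indicator (hp hB)),
    lintegral_postcomp hL hs hψ hs' (H := fun φ => ENNReal.ofReal (Real.exp
      (-(2 * (Real.pi ^ 2 - β2) / σ ^ 2 * energy φ))) * B.indicator 1 φ)
      ((by fun_prop : Measurable fun φ : CircleDiffeo 1 =>
      ENNReal.ofReal (Real.exp (-(2 * (Real.pi ^ 2 - β2) / σ ^ 2 * energy φ)))).mul
      (measurable_one.indicator hB))]
  refine lintegral_congr fun φ => Eq.symm ?_
  by_cases hφ : postcomp ψ φ ∈ B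
  · rw [Set.indicator_of_mem hφ, Set.indicator_of_mem (show φ ∈ postcomp ψ ⁻¹' B from hφ),
      ← ENNReal.ofReal_mul (Real.exp_pos _).le, ← Real.exp_add, Pi.one_apply, mul_one,
      ← ENNReal.ofReal_mul (Real.exp_pos _).le, ← Real.exp_add]
    congr 2
    have h1 : energy (postcomp ψ φ) = energyWith (fun t => ψ.derivative t ^ 2) φ := by
      simp only [energy, energyWith, postcomp_derivative, mul_pow]
    have h2 : energy φ = energyWith (fun _ => 1) φ := by
      simp only [energy, energyWith, one_mul]
    -- The parameter enters the exponent only through the change of energy under `ψ`, which is what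
    -- the reweighting by the energy contributes.
    have h3 : energyWith (ψ.exponent s β2) φ - energyWith (ψ.exponent s (Real.pi ^ 2)) φ =
        2 * (β2 - Real.pi ^ 2) * (energy (postcomp ψ φ) - energy φ) := by
      rw [h1, h2, ← energyWith_sub (q := fun t => ψ.derivative t ^ 2) (q' := fun _ => 1) (hψ.pow 2)
          continuous_const,
        ← energyWith_sub (continuous_exponent hs hψ _) (continuous_exponent hs hψ _),
        energyWith, energyWith, ← integral_const_mul]
      refine integral_congr_ae (Eventually.of_forall fun t => ?_)
      simp only [CircleDiffeo.exponent]
      ring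
    linear_combination (-1 / σ ^ 2) * h3
  · rw [Set.indicator_of_notMem hφ, Set.indicator_of_notMem
      (show φ ∉ postcomp ψ ⁻¹' B from hφ)]
    simp

theorem integral_changeOrbit_postcomp {σ : ℝ} (β2 : ℝ) {L : Measure (CircleDiffeo 1)}
    (hL : IsOrbitalMeasure σ (Real.pi ^ 2) L) (hs : Continuous s) (hψ : Continuous ψ.derivative)
    (hs' : ∀ x : ℝ, s (x : UnitAddCircle) = schwarzian ψ.lift x) {H : CircleDiffeo 1 → ℝ}
    (hH : Measurable H) :
    ∫ φ, H (postcomp ψ φ) * Real.exp (1 / σ ^ 2 * energyWith (ψ.exponent s β2) φ)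
      ∂(changeOrbit σ β2 L) = ∫ φ, H φ ∂(changeOrbit σ β2 L) := by
  have hp := (continuous_postcomp ψ hψ).measurable
  have hE := (continuous_energyWith (continuous_exponent hs hψ β2)).measurable
  conv_rhs => rw [← changeOrbit_eq_map β2 hL hs hψ hs']
  rw [integral_map hp.aemeasurable hH.aestronglyMeasurable,
    integral_withDensity_eq_integral_toReal_smul (by fun_prop)
      (Eventually.of_forall fun _ => ENNReal.ofReal_lt_top)]
  refine integral_congr_ae (Eventually.of_forall fun φ => ?_)
  simp only [smul_eq_mul]
  rw [ENNReal.toReal_ofReal (Real.exp_pos _).le, mul_comm]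

end

/-! ### A family of circle diffeomorphisms -/

/-- `t ↦ cos (2πnt - c)`. -/
noncomputable def cosMode (n : ℕ) (c : ℝ) (t : UnitAddCircle) : ℝ :=
  ((AddCircle.toCircle t : ℂ) ^ n * Complex.exp ((-c : ℝ) * Complex.I)).re

/-- `t ↦ sin (2πnt - c)`. -/
noncomputable def sinMode (n : ℕ) (c : ℝ) (t : UnitAddCircle) : ℝ :=
  ((AddCircle.toCircle t : ℂ) ^ n * Complex.exp ((-c : ℝ) * Complex.I)).im

theorem continuous_toCircle_coe :
    Continuous fun t : UnitAddCircle => (AddCircle.toCircle t : ℂ) :=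
  continuous_subtype_val.comp AddCircle.continuous_toCircle

theorem continuous_cosMode (n : ℕ) (c : ℝ) : Continuous (cosMode n c) :=
  Complex.continuous_re.comp ((continuous_toCircle_coe.pow n).mul continuous_const)

theorem continuous_sinMode (n : ℕ) (c : ℝ) : Continuous (sinMode n c) :=
  Complex.continuous_im.comp ((continuous_toCircle_coe.pow n).mul continuous_const)

theorem toCircle_pow_mul_exp (n : ℕ) (c x : ℝ) :
    (AddCircle.toCircle (x : UnitAddCircle) : ℂ) ^ n * Complex.exp ((-c : ℝ) * Complex.I) =
      Complex.exp ((2 * Real.pi * n * x - c : ℝ) * Complex.I) := by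
  rw [AddCircle.toCircle_apply_mk, Circle.coe_exp, ← Complex.exp_nat_mul, ← Complex.exp_add]
  congr 1
  push_cast
  ring

theorem cosMode_coe (n : ℕ) (c x : ℝ) :
    cosMode n c (x : UnitAddCircle) = Real.cos (2 * Real.pi * n * x - c) := by
  rw [cosMode, toCircle_pow_mul_exp, Complex.exp_ofReal_mul_I_re]

theorem sinMode_coe (n : ℕ) (c x : ℝ) :
    sinMode n c (x : UnitAddCircle) = Real.sin (2 * Real.pi * n * x - c) := by
  rw [sinMode, toCircle_pow_mul_exp, Complex.exp_ofReal_mul_I_im]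

theorem sinMode_sq_add_cosMode_sq (n : ℕ) (c : ℝ) (t : UnitAddCircle) :
    sinMode n c t ^ 2 + cosMode n c t ^ 2 = 1 := by
  obtain ⟨x, rfl⟩ := QuotientAddGroup.mk_surjective t
  exact (congrArg₂ (fun a b : ℝ => a ^ 2 + b ^ 2) (sinMode_coe n c x) (cosMode_coe n c x)).trans
    (Real.sin_sq_add_cos_sq _)

theorem abs_cosMode_le_one (n : ℕ) (c : ℝ) (t : UnitAddCircle) : |cosMode n c t| ≤ 1 := by
  rw [← sq_le_one_iff_abs_le_one]
  nlinarith [sinMode_sq_add_cosMode_sq n c t, sq_nonneg (sinMode n c t)]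

/-- The lift `x + ε sin (2πnx - c) / (2πn)`. -/
noncomputable def waveLift (n : ℕ) (c ε x : ℝ) : ℝ :=
  x + ε * Real.sin (2 * Real.pi * n * x - c) / (2 * Real.pi * n)

theorem hasDerivAt_sin_mode (n : ℕ) (c x : ℝ) :
    HasDerivAt (fun x => Real.sin (2 * Real.pi * n * x - c))
      (2 * Real.pi * n * Real.cos (2 * Real.pi * n * x - c)) x := by
  have h : HasDerivAt (fun x => 2 * Real.pi * n * x - c) (2 * Real.pi * n * 1) x :=
    ((hasDerivAt_id x).const_mul (2 * Real.pi * n)).sub_const c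
  refine h.sin.congr_deriv ?_
  ring

theorem hasDerivAt_cos_mode (n : ℕ) (c x : ℝ) :
    HasDerivAt (fun x => Real.cos (2 * Real.pi * n * x - c))
      (-(2 * Real.pi * n * Real.sin (2 * Real.pi * n * x - c))) x := by
  have h : HasDerivAt (fun x => 2 * Real.pi * n * x - c) (2 * Real.pi * n * 1) x :=
    ((hasDerivAt_id x).const_mul (2 * Real.pi * n)).sub_const c
  refine h.cos.congr_deriv ?_
  ring

theorem deriv_waveLift {n : ℕ} (hn : n ≠ 0) (c ε : ℝ) : deriv (waveLift n c ε) =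
    fun x => 1 + ε * Real.cos (2 * Real.pi * n * x - c) := by
  funext x
  refine HasDerivAt.deriv ?_
  have hn' : (n : ℝ) ≠ 0 := by exact_mod_cast hn
  have hpi := Real.pi_ne_zero
  refine ((hasDerivAt_id x).add (((hasDerivAt_sin_mode n c x).const_mul ε).div_const
    (2 * Real.pi * n))).congr_deriv ?_
  field_simp

theorem one_add_mul_pos {ε y : ℝ} (hε : |ε| ≤ 1 / 2) (hy : |y| ≤ 1) : 1 / 2 ≤ 1 + ε * y := by
  have h1 : |ε * y| ≤ 1 / 2 := by
    rw [abs_mul]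
    nlinarith [abs_nonneg ε, abs_nonneg y]
  linarith [(abs_le.1 h1).1]

/-- The circle diffeomorphism `x ↦ x + ε sin (2πnx - c) / (2πn)`. -/
noncomputable def wave (n : ℕ) (hn : n ≠ 0) (c ε : ℝ) (hε : |ε| ≤ 1 / 2) : CircleDiffeo 3 where
  toFun t := t + ((ε * sinMode n c t / (2 * Real.pi * n) : ℝ) : UnitAddCircle)
  exists_lift := by
    refine ⟨waveLift n c ε, ⟨?_, fun x => ?_, fun x => ?_⟩, fun x => ?_⟩
    · unfold waveLift
      fun_prop
    · rw [deriv_waveLift hn]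
      exact lt_of_lt_of_le (by norm_num) (one_add_mul_pos hε (Real.abs_cos_le_one _))
    · have h : 2 * Real.pi * n * (x + 1) - c = 2 * Real.pi * n * x - c + n * (2 * Real.pi) := by
        ring
      rw [waveLift, h, Real.sin_add_nat_mul_two_pi, waveLift]
      ring
    · rw [sinMode_coe, ← AddCircle.coe_add, waveLift]

section

variable {n : ℕ} (hn : n ≠ 0) (c : ℝ) {ε : ℝ} (hε : |ε| ≤ 1 / 2)

theorem wave_toFun_coe (x : ℝ) :
    (wave n hn c ε hε).toFun (x : UnitAddCircle) = (waveLift n c ε x : ℝ) := by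
  change (x : UnitAddCircle) + _ = _
  rw [sinMode_coe, ← AddCircle.coe_add, waveLift]

theorem deriv_wave_lift : deriv (wave n hn c ε hε).lift =
    fun x => 1 + ε * Real.cos (2 * Real.pi * n * x - c) := by
  rw [(wave n hn c ε hε).deriv_lift_eq (f := waveLift n c ε) (by unfold waveLift; fun_prop)
    (wave_toFun_coe hn c hε), deriv_waveLift hn]

theorem wave_derivative (t : UnitAddCircle) :
    (wave n hn c ε hε).derivative t = 1 + ε * cosMode n c t := by
  obtain ⟨x, rfl⟩ := QuotientAddGroup.mk_surjective t
  change deriv (wave n hn c ε hε).lift x = 1 + ε * cosMode n c (x : UnitAddCircle)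
  rw [deriv_wave_lift, cosMode_coe]

theorem continuous_wave_derivative : Continuous (wave n hn c ε hε).derivative := by
  rw [funext (wave_derivative hn c hε)]
  exact continuous_const.add (continuous_const.mul (continuous_cosMode n c))

/-- Owing to the denominator `2πn` in the wave, the phase moves by exactly `ε sin (2πnx - c)`; the
rest is the addition formula. -/
theorem cosMode_wave (t : UnitAddCircle) : cosMode n c ((wave n hn c ε hε).toFun t) =
    cosMode n c t * Real.cos (ε * sinMode n c t) -
      sinMode n c t * Real.sin (ε * sinMode n c t) := by
  obtain ⟨x, rfl⟩ := QuotientAddGroup.mk_surjective t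
  rw [wave_toFun_coe, cosMode_coe, cosMode_coe, sinMode_coe, ← Real.cos_add]
  congr 1
  have hn' : (n : ℝ) ≠ 0 := by exact_mod_cast hn
  have hpi := Real.pi_ne_zero
  rw [waveLift]
  field_simp
  ring

end

/-- The Schwarzian derivative of `wave n hn c ε hε`. -/
noncomputable def waveSchwarzian (n : ℕ) (c ε : ℝ) (t : UnitAddCircle) : ℝ :=
  -(2 * Real.pi * n) ^ 2 * ε * ((cosMode n c t + ε) + ε * sinMode n c t ^ 2 / 2) /
    (1 + ε * cosMode n c t) ^ 2

theorem waveSchwarzian_coe {n : ℕ} (hn : n ≠ 0) (c : ℝ) {ε : ℝ} (hε : |ε| ≤ 1 / 2) (x : ℝ) :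
    waveSchwarzian n c ε (x : UnitAddCircle) = schwarzian (wave n hn c ε hε).lift x := by
  have hpos : ∀ y : ℝ, 1 + ε * Real.cos (2 * Real.pi * n * y - c) ≠ 0 := fun y =>
    (lt_of_lt_of_le (by norm_num) (one_add_mul_pos hε (Real.abs_cos_le_one _))).ne'
  have hd2 : ∀ y, HasDerivAt (deriv (wave n hn c ε hε).lift)
      (ε * -(2 * Real.pi * n * Real.sin (2 * Real.pi * n * y - c))) y := by
    intro y
    rw [deriv_wave_lift]
    exact ((hasDerivAt_cos_mode n c y).const_mul ε).const_add 1
  have hq : (fun y => deriv (deriv (wave n hn c ε hε).lift) y / deriv (wave n hn c ε hε).lift y) =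
      fun y => (ε * -(2 * Real.pi * n * Real.sin (2 * Real.pi * n * y - c))) /
        (1 + ε * Real.cos (2 * Real.pi * n * y - c)) := by
    funext y
    rw [(hd2 y).deriv, deriv_wave_lift]
  have hd3 : HasDerivAt (fun y => (ε * -(2 * Real.pi * n * Real.sin (2 * Real.pi * n * y - c))) /
        (1 + ε * Real.cos (2 * Real.pi * n * y - c))) _ x :=
    (((((hasDerivAt_sin_mode n c x).const_mul (2 * Real.pi * n)).neg).const_mul ε).div
    (((hasDerivAt_cos_mode n c x).const_mul ε).const_add 1) (hpos x))
  rw [schwarzian, hq, (hd2 x).deriv, deriv_wave_lift, hd3.deriv]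
  simp only [Pi.neg_apply]
  rw [waveSchwarzian, cosMode_coe, sinMode_coe]
  have h1 := hpos x
  have h2 := Real.sin_sq_add_cos_sq (2 * Real.pi * n * x - c)
  set C := Real.cos (2 * Real.pi * n * x - c)
  set S := Real.sin (2 * Real.pi * n * x - c)
  field_simp
  linear_combination (2 * ε ^ 2) * h2

theorem continuous_waveSchwarzian (n : ℕ) (c : ℝ) {ε : ℝ} (hε : |ε| ≤ 1 / 2) :
    Continuous (waveSchwarzian n c ε) := by
  have h1 := continuous_cosMode n c
  have h2 := continuous_sinMode n c
  unfold waveSchwarzian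
  refine Continuous.div (by fun_prop) (by fun_prop) fun t => pow_ne_zero 2 ?_
  exact (lt_of_lt_of_le (by norm_num) (one_add_mul_pos hε (abs_cosMode_le_one n c t))).ne'

/-! ### Exponential moments of the energy -/

section

variable {σ : ℝ} {M : Measure DiffModPSL} {L : Measure (CircleDiffeo 1)}

/-- The lift `L` is reduced to the finite measure `M` by integrating out the group, which costs at
most `1 / l`. -/
theorem lintegral_exp_neg_energy_lt_top [IsFiniteMeasure M] (hL : IsPSLLift M L) {l : ℝ}
    (hl : 0 < l) : ∫⁻ φ, ENNReal.ofReal (Real.exp (-(l * energy φ))) ∂L < ∞ := by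
  have h := lintegral_lift_mul hL l (F := fun _ => 1) continuous_const
  simp only [mul_one] at h
  rw [h]
  calc _ ≤ ∫⁻ _, ENNReal.ofReal (1 / l) ∂M := lintegral_mono fun q => haarWeight_le _ hl
    _ < ∞ := by
      rw [lintegral_const]
      exact ENNReal.mul_lt_top ENNReal.ofReal_lt_top (measure_lt_top _ _)

theorem integrable_exp_energy [IsFiniteMeasure M] (hL : IsPSLLift M L) {a : ℝ} (ha : a < 0) :
    Integrable (fun φ => Real.exp (a * energy φ)) L := by
  have hE := continuous_energy
  refine ⟨(by fun_prop : Continuous fun φ : CircleDiffeo 1 =>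
    Real.exp (a * energy φ)).measurable.aestronglyMeasurable, ?_⟩
  rw [hasFiniteIntegral_iff_ofReal (Eventually.of_forall fun _ => (Real.exp_pos _).le)]
  have := lintegral_exp_neg_energy_lt_top hL (neg_pos.2 ha)
  simpa only [neg_mul, neg_neg] using this

theorem integrable_exp_energy_changeOrbit [IsFiniteMeasure M] (hL : IsPSLLift M L) {a β2 : ℝ}
    (ha : a < 2 * (Real.pi ^ 2 - β2) / σ ^ 2) :
    Integrable (fun φ => Real.exp (a * energy φ)) (changeOrbit σ β2 L) := by
  have hE := continuous_energy
  have hE' := continuous_energy.measurable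
  refine ⟨(by fun_prop : Continuous fun φ : CircleDiffeo 1 =>
    Real.exp (a * energy φ)).measurable.aestronglyMeasurable, ?_⟩
  rw [hasFiniteIntegral_iff_ofReal (Eventually.of_forall fun _ => (Real.exp_pos _).le),
    lintegral_changeOrbit _ _ _ (by fun_prop)]
  have := lintegral_exp_neg_energy_lt_top hL (sub_pos.2 ha)
  refine lt_of_eq_of_lt (lintegral_congr fun φ => ?_) this
  rw [← ENNReal.ofReal_mul (Real.exp_pos _).le, ← Real.exp_add]
  congr 2
  ring

theorem isFiniteMeasure_changeOrbit [IsFiniteMeasure M] (hL : IsPSLLift M L) (hσ : 0 < σ)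
    {β2 : ℝ} (hβ : β2 < Real.pi ^ 2) : IsFiniteMeasure (changeOrbit σ β2 L) := by
  have h := integrable_exp_energy_changeOrbit (σ := σ) hL (a := 0) (β2 := β2)
    (div_pos (by linarith) (by positivity))
  simp only [zero_mul, Real.exp_zero] at h
  exact (integrable_const_iff_isFiniteMeasure one_ne_zero).1 h

theorem le_exp_div {x η : ℝ} (hη : 0 < η) : x ≤ Real.exp (η * x) / η := by
  rw [le_div_iff₀ hη]
  linarith [Real.add_one_le_exp (η * x)]

theorem integrable_energy_changeOrbit [IsFiniteMeasure M] (hL : IsPSLLift M L) (hσ : 0 < σ)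
    {β2 : ℝ} (hβ : β2 < Real.pi ^ 2) : Integrable energy (changeOrbit σ β2 L) := by
  have hl : 0 < 2 * (Real.pi ^ 2 - β2) / σ ^ 2 := div_pos (by linarith) (by positivity)
  obtain ⟨η, h0, h1⟩ := exists_between hl
  refine ((integrable_exp_energy_changeOrbit hL h1).div_const η).mono'
    continuous_energy.measurable.aestronglyMeasurable (Eventually.of_forall fun φ => ?_)
  rw [Real.norm_eq_abs, abs_of_nonneg (energy_nonneg φ)]
  exact le_exp_div h0

end

/-! ### First order variations -/

/-- Integrating the expansion, the terms of order zero cancel by `hI`; dividing by `ε` leaves `|∫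
f₁| ≤ ε ∫ B`. -/
theorem integral_eq_zero_of_taylor {Ω : Type*} [MeasurableSpace Ω] {μ : Measure Ω}
    {f : ℝ → Ω → ℝ} {f₀ f₁ B : Ω → ℝ} {r : ℝ} (hr : 0 < r)
    (hf : ∀ ε, 0 < ε → ε < r → AEStronglyMeasurable (f ε) μ) (hf₀ : Integrable f₀ μ)
    (hf₁ : Integrable f₁ μ) (hB : Integrable B μ)
    (h : ∀ ε, 0 < ε → ε < r → ∀ ω, |f ε ω - f₀ ω - ε * f₁ ω| ≤ ε ^ 2 * B ω)
    (hI : ∀ ε, 0 < ε → ε < r → ∫ ω, f ε ω ∂μ = ∫ ω, f₀ ω ∂μ) : ∫ ω, f₁ ω ∂μ = 0 := by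
  have key : ∀ ε, 0 < ε → ε < r → |∫ ω, f₁ ω ∂μ| ≤ ε * ∫ ω, B ω ∂μ := by
    intro ε h0 h1
    have hd : Integrable (fun ω => f ε ω - f₀ ω - ε * f₁ ω) μ :=
      (hB.const_mul (ε ^ 2)).mono' (((hf ε h0 h1).sub hf₀.aestronglyMeasurable).sub
        (hf₁.aestronglyMeasurable.const_mul ε)) (Eventually.of_forall (h ε h0 h1))
    have hfε : Integrable (f ε) μ := by
      refine ((hd.add hf₀).add (hf₁.const_mul ε)).congr (Eventually.of_forall fun ω => ?_)
      simp only [Pi.add_apply]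
      ring
    have h2 : |∫ ω, (f ε ω - f₀ ω - ε * f₁ ω) ∂μ| ≤ ∫ ω, ε ^ 2 * B ω ∂μ := by
      rw [← Real.norm_eq_abs]
      exact norm_integral_le_of_norm_le (hB.const_mul _) (Eventually.of_forall (h ε h0 h1))
    rw [integral_sub (f := fun ω => f ε ω - f₀ ω) (hfε.sub hf₀) (hf₁.const_mul ε),
      integral_sub hfε hf₀, hI ε h0 h1, sub_self,
      zero_sub, abs_neg, integral_const_mul, integral_const_mul, abs_mul, abs_of_pos h0] at h2
    have : ε * |∫ ω, f₁ ω ∂μ| ≤ ε * (ε * ∫ ω, B ω ∂μ) := by linarith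
    exact le_of_mul_le_mul_left this h0
  have hlim : Tendsto (fun ε : ℝ => ε * ∫ ω, B ω ∂μ) (𝓝[>] 0) (𝓝 0) := by
    have : Tendsto (fun ε : ℝ => ε * ∫ ω, B ω ∂μ) (𝓝 0) (𝓝 (0 * ∫ ω, B ω ∂μ)) :=
      tendsto_id.mul_const _
    rw [zero_mul] at this
    exact this.mono_left nhdsWithin_le_nhds
  refine abs_nonpos_iff.1 (ge_of_tendsto hlim ?_)
  filter_upwards [Ioo_mem_nhdsGT hr] with ε hε using key ε hε.1 hε.2

theorem abs_exp_sub_one_sub_le (x : ℝ) : |Real.exp x - 1 - x| ≤ x ^ 2 * Real.exp |x| := by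
  have h := Complex.norm_exp_sub_sum_le_norm_mul_exp (x : ℂ) 2
  simp only [Finset.sum_range_succ, Finset.sum_range_zero] at h
  have e : Complex.exp x - (0 + (x : ℂ) ^ 0 / (Nat.factorial 0) + (x : ℂ) ^ 1 / (Nat.factorial 1)) =
      ((Real.exp x - 1 - x : ℝ) : ℂ) := by
    push_cast
    simp
    ring
  rw [e, Complex.norm_real, Complex.norm_real, Real.norm_eq_abs, Real.norm_eq_abs, sq_abs] at h
  exact h

/-- First order expansion of `H_ε e^X`. -/
theorem abs_mul_exp_sub_le {ε η K A X d ρ H Hε H₁ : ℝ} (hε : 0 < ε) (hε1 : ε ≤ 1)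
    (hη : 0 < η) (hK : 0 < K) (hεη : 2 * K * ε ≤ η) (hA : 0 ≤ A) (hX : X = ε * d + ρ)
    (hd : |d| ≤ K * A) (hρ : |ρ| ≤ ε ^ 2 * (K * A)) (hHε : |Hε| ≤ 1)
    (hH₁ : |H₁| ≤ 2) (hT : |Hε - H - ε * H₁| ≤ 4 * ε ^ 2) :
    |Hε * Real.exp X - H - ε * (H₁ + H * d)| ≤
      ε ^ 2 * ((8 * K ^ 2 / η ^ 2 + 7 * K / η + 4) * Real.exp (2 * η * A)) := by
  have hKA : 0 ≤ K * A := by positivity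
  -- With `2 K ε ≤ η` one factor `e^{ηA}` absorbs `e^{|X|}`. A second one absorbs the powers of `A`,
  -- whence `2 η` in the bound.
  have hXb : |X| ≤ 2 * K * ε * A := by
    rw [hX]
    calc _ ≤ |ε * d| + |ρ| := abs_add_le _ _
      _ ≤ ε * (K * A) + ε ^ 2 * (K * A) := by
        rw [abs_mul, abs_of_pos hε]
        gcongr
      _ ≤ _ := by nlinarith [mul_nonneg hε.le hKA]
  have hexp : Real.exp |X| ≤ Real.exp (η * A) :=
    Real.exp_le_exp.2 (hXb.trans (mul_le_mul_of_nonneg_right hεη hA))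
  have hA1 : A ≤ Real.exp (η * A) / η := le_exp_div hη
  have hA2 : A ^ 2 ≤ 2 * Real.exp (η * A) / η ^ 2 := by
    rw [le_div_iff₀ (by positivity)]
    have := Real.quadratic_le_exp_of_nonneg (mul_nonneg hη.le hA)
    nlinarith [mul_nonneg hη.le hA]
  have hE1 : 1 ≤ Real.exp (η * A) := Real.one_le_exp (by positivity)
  have hE2 : Real.exp (2 * η * A) = Real.exp (η * A) * Real.exp (η * A) := by
    rw [← Real.exp_add]; ring_nf
  set E := Real.exp (η * A)
  have hEE : E ≤ E * E := by nlinarith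
  have h1 : |Real.exp X - 1 - X| ≤ ε ^ 2 * (8 * K ^ 2 / η ^ 2 * (E * E)) := by
    calc _ ≤ |X| ^ 2 * Real.exp |X| := by rw [sq_abs]; exact abs_exp_sub_one_sub_le X
      _ ≤ (2 * K * ε * A) ^ 2 * E := by gcongr
      _ = 4 * K ^ 2 * ε ^ 2 * A ^ 2 * E := by ring
      _ ≤ 4 * K ^ 2 * ε ^ 2 * (2 * E / η ^ 2) * E := by gcongr
      _ = _ := by ring
  have hKE : K * A ≤ K / η * (E * E) := by
    calc K * A ≤ K * (E / η) := by gcongr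
      _ ≤ K * (E * E / η) := by gcongr
      _ = _ := by ring
  have h2 : |Hε - H| ≤ 6 * ε := by
    have e : Hε - H = (Hε - H - ε * H₁) + ε * H₁ := by ring
    rw [e]
    calc _ ≤ |Hε - H - ε * H₁| + |ε * H₁| := abs_add_le _ _
      _ ≤ 4 * ε ^ 2 + ε * 2 := by
        rw [abs_mul ε, abs_of_pos hε]
        gcongr
      _ ≤ _ := by nlinarith
  have e : Hε * Real.exp X - H - ε * (H₁ + H * d) =
      Hε * (Real.exp X - 1 - X) + Hε * ρ + (Hε - H) * (ε * d) + (Hε - H - ε * H₁) := by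
    rw [hX]; ring
  rw [e, hE2]
  calc _ ≤ |Hε * (Real.exp X - 1 - X)| + |Hε * ρ| + |(Hε - H) * (ε * d)| +
        |Hε - H - ε * H₁| :=
        (abs_add_le _ _).trans (by
          gcongr
          exact (abs_add_le _ _).trans (by gcongr; exact abs_add_le _ _))
    _ ≤ 1 * (ε ^ 2 * (8 * K ^ 2 / η ^ 2 * (E * E))) + 1 * (ε ^ 2 * (K * A)) +
        (6 * ε) * (ε * (K * A)) + 4 * ε ^ 2 := by
        simp only [abs_mul, abs_of_pos hε]
        gcongr
    _ = ε ^ 2 * (8 * K ^ 2 / η ^ 2 * (E * E) + 7 * (K * A) + 4) := by ring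
    _ ≤ ε ^ 2 * (8 * K ^ 2 / η ^ 2 * (E * E) + 7 * (K / η * (E * E)) + 4 * (E * E)) := by
        gcongr
        nlinarith
    _ = _ := by ring

/-! ### The variation of the Fourier modes -/

/-- A bounded substitute `y / (y + δ)` for the constant `1`. -/
noncomputable def cutoff (δ y : ℝ) : ℝ := y / (y + δ)

section

variable {δ y : ℝ}

theorem cutoff_nonneg (hδ : 0 < δ) (hy : 0 ≤ y) : 0 ≤ cutoff δ y := by
  unfold cutoff
  positivity

theorem cutoff_le_one (hδ : 0 < δ) (hy : 0 ≤ y) : cutoff δ y ≤ 1 := by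
  unfold cutoff
  rw [div_le_one (by positivity)]
  linarith

theorem abs_cutoff_le_one (hδ : 0 < δ) (hy : 0 ≤ y) : |cutoff δ y| ≤ 1 :=
  abs_le.2 ⟨by linarith [cutoff_nonneg hδ hy], cutoff_le_one hδ hy⟩

theorem continuous_cutoff_abs (hδ : 0 < δ) : Continuous fun y => cutoff δ |y| := by
  unfold cutoff
  exact Continuous.div (by fun_prop) (by fun_prop) fun y => by positivity

theorem continuous_cutoff_derivative (hδ : 0 < δ) (φ : CircleDiffeo 1) :
    Continuous fun t => cutoff δ (φ.derivative t) := by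
  refine ((continuous_cutoff_abs hδ).comp φ.continuous_derivative).congr fun t => ?_
  simp only [Function.comp_apply, abs_of_pos (φ.derivative_pos t)]

/-- The linear term comes from `y k'(y) = k (1 - k)` for `k = cutoff δ`, and the remainder is
computed exactly. -/
theorem abs_cutoff_mul_sub_le (hδ : 0 < δ) (hy : 0 ≤ y) {e : ℝ} (he : |e| ≤ 1 / 2) :
    |cutoff δ ((1 + e) * y) - cutoff δ y - e * (cutoff δ y * (1 - cutoff δ y))| ≤ e ^ 2 := by
  have h1 : 1 / 2 ≤ 1 + e := by linarith [(abs_le.1 he).1]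
  have h2 : 0 < (1 + e) * y + δ := by positivity
  have h3 : 0 < y + δ := by positivity
  have e1 : cutoff δ ((1 + e) * y) - cutoff δ y - e * (cutoff δ y * (1 - cutoff δ y)) =
      -(e ^ 2 * ((y / (y + δ)) ^ 2 * (δ / ((1 + e) * y + δ)))) := by
    unfold cutoff
    field_simp
    ring
  have h4 : (y / (y + δ)) ^ 2 ≤ 1 := pow_le_one₀ (by positivity) (cutoff_le_one hδ hy)
  have h5 : δ / ((1 + e) * y + δ) ≤ 1 := by
    rw [div_le_one h2]
    have : 0 ≤ (1 + e) * y := by positivity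
    linarith
  rw [e1, abs_neg, abs_of_nonneg (by positivity)]
  exact mul_le_of_le_one_right (sq_nonneg e) (mul_le_one₀ h4 (by positivity) h5)

end

theorem abs_rotation_sub_le {C S ε : ℝ} (h : S ^ 2 + C ^ 2 = 1) (hε : 0 < ε) (hε2 : ε ≤ 1 / 2) :
    |C * Real.cos (ε * S) - S * Real.sin (ε * S) - (C - ε * S ^ 2)| ≤ ε ^ 2 := by
  have hC : |C| ≤ 1 := by
    rw [← sq_le_one_iff_abs_le_one]
    nlinarith [sq_nonneg S]
  have hS : |S| ≤ 1 := by
    rw [← sq_le_one_iff_abs_le_one]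
    nlinarith [sq_nonneg C]
  have hx : |ε * S| ≤ ε := by
    rw [abs_mul, abs_of_pos hε]
    exact mul_le_of_le_one_right hε.le hS
  have hx2 : (ε * S) ^ 2 ≤ ε ^ 2 := sq_le_sq' (abs_le.1 hx).1 (abs_le.1 hx).2
  have hc : |Real.cos (ε * S) - 1| ≤ ε ^ 2 / 2 := by
    rw [abs_le]
    constructor
    · linarith [Real.one_sub_sq_div_two_le_cos (x := ε * S)]
    · nlinarith [Real.cos_le_one (ε * S)]
  have hs : |Real.sin (ε * S) - ε * S| ≤ ε ^ 2 / 2 := by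
    have hb := Real.sin_bound (x := ε * S) (by linarith)
    have h3 : |(ε * S) ^ 3 / 6| ≤ ε ^ 3 / 6 := by
      rw [abs_div, abs_pow, abs_of_pos (by norm_num : (0 : ℝ) < 6)]
      gcongr
    have h4 : |ε * S| ^ 5 ≤ ε ^ 5 := by gcongr
    have e : Real.sin (ε * S) - ε * S =
        (Real.sin (ε * S) - (ε * S - (ε * S) ^ 3 / 6)) - (ε * S) ^ 3 / 6 := by ring
    rw [e]
    calc _ ≤ |Real.sin (ε * S) - (ε * S - (ε * S) ^ 3 / 6)| + |(ε * S) ^ 3 / 6| := abs_sub _ _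
      _ ≤ ε ^ 5 / 100 + ε ^ 3 / 6 := add_le_add (hb.trans (by gcongr)) h3
      _ ≤ _ := by
        have h5 : ε ^ 3 ≤ ε ^ 2 / 2 := by nlinarith [sq_nonneg ε]
        have h6 : ε ^ 5 ≤ ε ^ 2 * 1 := by
          rw [show ε ^ 5 = ε ^ 2 * ε ^ 3 by ring]
          gcongr
          exact pow_le_one₀ hε.le (by linarith)
        linarith [sq_nonneg ε]
  have e : C * Real.cos (ε * S) - S * Real.sin (ε * S) - (C - ε * S ^ 2) =
      C * (Real.cos (ε * S) - 1) - S * (Real.sin (ε * S) - ε * S) := by ring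
  rw [e]
  calc _ ≤ |C * (Real.cos (ε * S) - 1)| + |S * (Real.sin (ε * S) - ε * S)| := abs_sub _ _
    _ ≤ 1 * (ε ^ 2 / 2) + 1 * (ε ^ 2 / 2) := by
      rw [abs_mul, abs_mul]
      gcongr
    _ = _ := by ring

/-- First order expansion of the integrand of a Fourier mode. -/
theorem abs_mode_sub_le {C S ε δ y : ℝ} (h : S ^ 2 + C ^ 2 = 1) (hε : 0 < ε) (hε2 : ε ≤ 1 / 2)
    (hδ : 0 < δ) (hy : 0 ≤ y) :
    |(C * Real.cos (ε * S) - S * Real.sin (ε * S)) * cutoff δ ((1 + ε * C) * y) -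
      C * cutoff δ y - ε * (-(S ^ 2 * cutoff δ y) +
        C ^ 2 * (cutoff δ y * (1 - cutoff δ y)))| ≤ 4 * ε ^ 2 := by
  have hC : |C| ≤ 1 := by
    rw [← sq_le_one_iff_abs_le_one]
    nlinarith [sq_nonneg S]
  have hS2 : S ^ 2 ≤ 1 := by nlinarith [sq_nonneg C]
  have he : |ε * C| ≤ 1 / 2 := by
    rw [abs_mul, abs_of_pos hε]
    nlinarith [abs_nonneg C]
  have he2 : (ε * C) ^ 2 ≤ ε ^ 2 := by
    rw [mul_pow]
    exact mul_le_of_le_one_right (sq_nonneg ε) ((sq_le_one_iff_abs_le_one C).2 hC)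
  have h1 := abs_rotation_sub_le h hε hε2
  have h2 := (abs_cutoff_mul_sub_le hδ hy he).trans he2
  have hy' : 0 ≤ (1 + ε * C) * y :=
    mul_nonneg (by linarith [(abs_le.1 he).1]) hy
  have hk' := abs_cutoff_le_one hδ hy'
  have hk0 := cutoff_nonneg hδ hy
  have hk1 := cutoff_le_one hδ hy
  set k := cutoff δ y
  set k' := cutoff δ ((1 + ε * C) * y)
  set R := C * Real.cos (ε * S) - S * Real.sin (ε * S)
  have e : R * k' - C * k - ε * (-(S ^ 2 * k) + C ^ 2 * (k * (1 - k))) =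
      (R - (C - ε * S ^ 2)) * k' + (C - ε * S ^ 2) * (k' - k - ε * C * (k * (1 - k))) -
        ε ^ 2 * (S ^ 2 * C * (k * (1 - k))) := by ring
  have h3 : |C - ε * S ^ 2| ≤ 2 := by
    refine (abs_sub _ _).trans ?_
    rw [abs_mul, abs_of_pos hε, abs_of_nonneg (sq_nonneg S)]
    nlinarith
  have h4 : |S ^ 2 * C * (k * (1 - k))| ≤ 1 := by
    rw [abs_mul, abs_mul, abs_of_nonneg (sq_nonneg S),
      abs_of_nonneg (mul_nonneg hk0 (sub_nonneg.2 hk1))]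
    have : k * (1 - k) ≤ 1 := by nlinarith
    exact mul_le_one₀ (mul_le_one₀ hS2 (abs_nonneg _) hC)
      (mul_nonneg hk0 (sub_nonneg.2 hk1)) this
  rw [e]
  calc _ ≤ |(R - (C - ε * S ^ 2)) * k'| +
        |(C - ε * S ^ 2) * (k' - k - ε * C * (k * (1 - k)))| +
        |ε ^ 2 * (S ^ 2 * C * (k * (1 - k)))| :=
        (abs_sub _ _).trans (add_le_add_left (abs_add_le _ _) _)
    _ ≤ ε ^ 2 * 1 + 2 * ε ^ 2 + ε ^ 2 * 1 := by
        rw [abs_mul, abs_mul, abs_mul (ε ^ 2), abs_of_nonneg (sq_nonneg ε)]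
        gcongr
    _ = _ := by ring

/-- To first order `ψ'' / ψ'` is `ψ''`, so the Schwarzian contributes `-(2πn)² ε cos`, while `2 β2
(ψ'² - 1)` contributes `4 β2 ε cos`. -/
theorem abs_wave_exponent_sub_le {n : ℕ} (hn : n ≠ 0) (c : ℝ) {ε : ℝ} (hε : 0 < ε)
    (hε2 : |ε| ≤ 1 / 2) (β2 : ℝ) (t : UnitAddCircle) :
    |(wave n hn c ε hε2).exponent (waveSchwarzian n c ε) β2 t -
      ε * (4 * β2 - (2 * Real.pi * n) ^ 2) * cosMode n c t| ≤
      ε ^ 2 * (16 * (2 * Real.pi * n) ^ 2 + 2 * |β2|) := by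
  have hε3 : ε ≤ 1 / 2 := (le_abs_self ε).trans hε2
  have h := sinMode_sq_add_cosMode_sq n c t
  have hC := abs_cosMode_le_one n c t
  have hD := one_add_mul_pos hε2 hC
  rw [CircleDiffeo.exponent, wave_derivative, waveSchwarzian]
  set C := cosMode n c t
  set S := sinMode n c t
  set N := 2 * Real.pi * (n : ℝ)
  have hD0 : 1 + ε * C ≠ 0 := by linarith
  have hC2 : C ^ 2 ≤ 1 := (sq_le_one_iff_abs_le_one C).2 hC
  have hS2 : S ^ 2 ≤ 1 := by nlinarith [sq_nonneg C]
  have e : -N ^ 2 * ε * ((C + ε) + ε * S ^ 2 / 2) / (1 + ε * C) ^ 2 +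
      2 * β2 * ((1 + ε * C) ^ 2 - 1) - ε * (4 * β2 - N ^ 2) * C =
      -(ε ^ 2 * (N ^ 2 * ((1 + S ^ 2 / 2 - 2 * C ^ 2 - ε * C ^ 2 * C) / (1 + ε * C) ^ 2))) +
        ε ^ 2 * (2 * β2 * C ^ 2) := by
    field_simp
    ring
  have hq : |1 + S ^ 2 / 2 - 2 * C ^ 2 - ε * C ^ 2 * C| ≤ 4 := by
    have h1 : |ε * C ^ 2 * C| ≤ 1 / 2 := by
      rw [abs_mul, abs_mul, abs_of_pos hε, abs_of_nonneg (sq_nonneg C)]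
      calc ε * C ^ 2 * |C| ≤ 1 / 2 * 1 * 1 := by gcongr
        _ = _ := by norm_num
    have := abs_le.1 h1
    rw [abs_le]
    constructor <;> nlinarith [sq_nonneg S, sq_nonneg C]
  -- The numerator is at most `4`, the denominator at least `1 / 4`.
  have hq2 : |(1 + S ^ 2 / 2 - 2 * C ^ 2 - ε * C ^ 2 * C) / (1 + ε * C) ^ 2| ≤ 16 := by
    rw [abs_div, abs_of_nonneg (sq_nonneg (1 + ε * C)), div_le_iff₀ (by positivity)]
    nlinarith
  rw [e]
  calc _ ≤ |ε ^ 2 * (N ^ 2 * ((1 + S ^ 2 / 2 - 2 * C ^ 2 - ε * C ^ 2 * C) / (1 + ε * C) ^ 2))| +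
        |ε ^ 2 * (2 * β2 * C ^ 2)| := (abs_add_le _ _).trans (by rw [abs_neg])
    _ ≤ ε ^ 2 * (N ^ 2 * 16) + ε ^ 2 * (2 * |β2| * 1) := by
        rw [abs_mul, abs_mul (N ^ 2), abs_mul (ε ^ 2), abs_mul (2 * β2), abs_mul 2 β2,
          abs_of_nonneg (sq_nonneg ε), abs_of_nonneg (sq_nonneg N), abs_of_nonneg (sq_nonneg C),
          abs_of_pos (by norm_num : (0 : ℝ) < 2)]
        gcongr
    _ = _ := by ring

/-- The Fourier mode `∫_𝕋 cos (2πnφ - c) φ' / (φ' + δ) dτ`. -/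
noncomputable def mode (n : ℕ) (c δ : ℝ) (φ : CircleDiffeo 1) : ℝ :=
  ∫ t, cosMode n c (φ.toFun t) * cutoff δ (φ.derivative t)

/-- The variation of `mode n c δ` along `wave n hn c ε hε`. -/
noncomputable def modeVariation (n : ℕ) (c δ : ℝ) (φ : CircleDiffeo 1) : ℝ :=
  ∫ t, (-(sinMode n c (φ.toFun t) ^ 2 * cutoff δ (φ.derivative t)) +
    cosMode n c (φ.toFun t) ^ 2 *
      (cutoff δ (φ.derivative t) * (1 - cutoff δ (φ.derivative t))))

section

variable (n : ℕ) (c : ℝ) {δ : ℝ}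

theorem continuous_mode (hδ : 0 < δ) : Continuous (mode n c δ) :=
  continuous_integral_comp_of_pos (K := fun s y => cosMode n c s * cutoff δ y)
    (((continuous_cosMode n c).comp continuous_fst).mul
      ((continuous_cutoff_abs hδ).comp continuous_snd))

theorem continuous_modeVariation (hδ : 0 < δ) : Continuous (modeVariation n c δ) := by
  have h1 := continuous_cosMode n c
  have h2 := continuous_sinMode n c
  have h3 : Continuous fun p : UnitAddCircle × ℝ => cutoff δ |p.2| :=
    (continuous_cutoff_abs hδ).comp continuous_snd
  exact continuous_integral_comp_of_pos (K := fun s y => -(sinMode n c s ^ 2 * cutoff δ y) +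
    cosMode n c s ^ 2 * (cutoff δ y * (1 - cutoff δ y))) (by fun_prop)

theorem abs_integral_circle_le {f : UnitAddCircle → ℝ} {b : ℝ} (h : ∀ t, |f t| ≤ b) :
    |∫ t, f t| ≤ b := by
  have := norm_integral_le_of_norm_le_const (μ := (volume : Measure UnitAddCircle)) (f := f)
    (C := b) (Eventually.of_forall h)
  simpa using this

theorem abs_mode_le (hδ : 0 < δ) (φ : CircleDiffeo 1) : |mode n c δ φ| ≤ 1 := by
  refine abs_integral_circle_le fun t => ?_
  rw [abs_mul]
  exact mul_le_one₀ (abs_cosMode_le_one _ _ _) (abs_nonneg _)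
    (abs_cutoff_le_one hδ (φ.derivative_pos t).le)

theorem abs_modeVariation_le (hδ : 0 < δ) (φ : CircleDiffeo 1) : |modeVariation n c δ φ| ≤ 2 := by
  refine abs_integral_circle_le fun t => ?_
  have h := sinMode_sq_add_cosMode_sq n c (φ.toFun t)
  have h0 := cutoff_nonneg hδ (φ.derivative_pos t).le
  have h1 := cutoff_le_one hδ (φ.derivative_pos t).le
  set k := cutoff δ (φ.derivative t)
  have h2 : k * (1 - k) ≤ 1 := by nlinarith
  have h3 : 0 ≤ k * (1 - k) := mul_nonneg h0 (sub_nonneg.2 h1)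
  have hS := sq_nonneg (sinMode n c (φ.toFun t))
  have hC := sq_nonneg (cosMode n c (φ.toFun t))
  rw [abs_le]
  constructor <;> nlinarith

theorem continuous_mode_integrand (hδ : 0 < δ) (φ : CircleDiffeo 1) :
    Continuous fun t => cosMode n c (φ.toFun t) * cutoff δ (φ.derivative t) :=
  ((continuous_cosMode n c).comp φ.continuous_toFun).mul (continuous_cutoff_derivative hδ φ)

theorem continuous_modeVariation_integrand (hδ : 0 < δ) (φ : CircleDiffeo 1) :
    Continuous fun t => (-(sinMode n c (φ.toFun t) ^ 2 * cutoff δ (φ.derivative t)) +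
    cosMode n c (φ.toFun t) ^ 2 *
      (cutoff δ (φ.derivative t) * (1 - cutoff δ (φ.derivative t)))) := by
  have h1 := (continuous_cosMode n c).comp φ.continuous_toFun
  have h2 := (continuous_sinMode n c).comp φ.continuous_toFun
  have h3 := continuous_cutoff_derivative hδ φ
  simp only [Function.comp_def] at h1 h2
  fun_prop

theorem abs_mode_postcomp_sub_le (hδ : 0 < δ) {n : ℕ} (hn : n ≠ 0) {ε : ℝ} (hε : 0 < ε)
    (hε2 : |ε| ≤ 1 / 2) (φ : CircleDiffeo 1) :
    |mode n c δ (postcomp (wave n hn c ε hε2) φ) - mode n c δ φ -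
      ε * modeVariation n c δ φ| ≤ 4 * ε ^ 2 := by
  have hi1 := integrable_of_continuous_circle
    (continuous_mode_integrand n c hδ (postcomp (wave n hn c ε hε2) φ))
  have hi2 := integrable_of_continuous_circle (continuous_mode_integrand n c hδ φ)
  have hi3 := integrable_of_continuous_circle (continuous_modeVariation_integrand n c hδ φ)
  have hi12 := hi1.sub hi2
  simp only [Pi.sub_def] at hi12
  rw [mode, mode, modeVariation, ← integral_const_mul, ← integral_sub hi1 hi2,
    ← integral_sub hi12 (hi3.const_mul ε)]
  refine abs_integral_circle_le fun t => ?_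
  rw [postcomp_toFun, postcomp_derivative, wave_derivative, cosMode_wave]
  exact abs_mode_sub_le (sinMode_sq_add_cosMode_sq n c _) hε ((le_abs_self ε).trans hε2) hδ
    (φ.derivative_pos t).le

end

/-! ### The first-order identity for a single Fourier mode -/

section

variable {σ : ℝ} {M : Measure DiffModPSL} {L : Measure (CircleDiffeo 1)}

/-- The first order form of the quasi-invariance of the orbital measure. -/
theorem integral_modeVariation_add (hσ : 0 < σ) (hM : IsSchwarzianMeasure σ M L) {β2 : ℝ}
    (hβ : β2 < Real.pi ^ 2) {n : ℕ} (hn : n ≠ 0) (c : ℝ) {δ : ℝ} (hδ : 0 < δ) :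
    ∫ φ, (modeVariation n c δ φ + mode n c δ φ * (1 / σ ^ 2 * ((4 * β2 - (2 * Real.pi * n) ^ 2) *
      energyWith (cosMode n c) φ))) ∂(changeOrbit σ β2 L) = 0 := by
  have := hM.finite
  have := isFiniteMeasure_changeOrbit hM.lift hσ hβ
  set N : ℝ := 2 * Real.pi * n with hN
  have hN0 : 0 < N := by
    have : (0 : ℝ) < n := by exact_mod_cast Nat.pos_of_ne_zero hn
    positivity
  -- Large enough for both the linear coefficient and the quadratic remainder of the exponent.
  set K : ℝ := 1 / σ ^ 2 * (16 * N ^ 2 + 4 * |β2|) with hK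
  have hK0 : 0 < K := by positivity
  have hl : 0 < 2 * (Real.pi ^ 2 - β2) / σ ^ 2 := div_pos (by linarith) (by positivity)
  obtain ⟨η', h0, h1⟩ := exists_between hl
  -- Halved because the remainder is bounded by `exp (2 η energy)`, which must be integrable.
  set η : ℝ := η' / 2 with hη
  have hη0 : 0 < η := by positivity
  have hη1 : 2 * η < 2 * (Real.pi ^ 2 - β2) / σ ^ 2 := by rw [hη]; linarith
  have hB := integrable_exp_energy_changeOrbit hM.lift hη1
  have hA := integrable_energy_changeOrbit hM.lift hσ hβ
  have hcm := continuous_mode n c hδ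
  have hcv := continuous_modeVariation n c hδ
  have hce := continuous_energyWith (continuous_cosMode n c)
  have hd : ∀ φ, |1 / σ ^ 2 * ((4 * β2 - N ^ 2) * energyWith (cosMode n c) φ)| ≤
      K * energy φ := by
    intro φ
    have h2 := abs_energyWith_le (abs_cosMode_le_one n c) φ
    have h3 : |4 * β2 - N ^ 2| ≤ 16 * N ^ 2 + 4 * |β2| := by
      refine (abs_sub _ _).trans ?_
      rw [abs_mul, abs_of_nonneg (sq_nonneg N), abs_of_pos (by norm_num : (0 : ℝ) < 4)]
      nlinarith [sq_nonneg N]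
    rw [abs_mul, abs_mul, abs_of_pos (by positivity : 0 < 1 / σ ^ 2), hK, mul_assoc]
    have h4 := energy_nonneg φ
    rw [one_mul] at h2
    gcongr
  have hint : Integrable (mode n c δ) (changeOrbit σ β2 L) :=
    (integrable_const (1 : ℝ)).mono' hcm.measurable.aestronglyMeasurable
      (Eventually.of_forall fun φ => abs_mode_le n c hδ φ)
  have hint1 : Integrable (fun φ => modeVariation n c δ φ + mode n c δ φ *
      (1 / σ ^ 2 * ((4 * β2 - N ^ 2) * energyWith (cosMode n c) φ))) (changeOrbit σ β2 L) := by
    refine ((integrable_const (2 : ℝ)).mono' hcv.measurable.aestronglyMeasurable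
      (Eventually.of_forall fun φ => abs_modeVariation_le n c hδ φ)).add
      ((hA.const_mul K).mono' (by fun_prop : Continuous fun φ => mode n c δ φ *
        (1 / σ ^ 2 * ((4 * β2 - N ^ 2) *
          energyWith (cosMode n c) φ))).measurable.aestronglyMeasurable
        (Eventually.of_forall fun φ => ?_))
    rw [Real.norm_eq_abs, abs_mul]
    exact (mul_le_of_le_one_left (abs_nonneg _) (abs_mode_le n c hδ φ)).trans (hd φ)
  have hr : 0 < min (1 / 2) (η / (2 * K)) := by positivity
  have hsmall : ∀ {ε : ℝ}, 0 < ε → ε < min (1 / 2) (η / (2 * K)) → |ε| ≤ 1 / 2 := by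
    intro ε h2 h3
    rw [abs_of_pos h2]
    exact h3.le.trans (min_le_left _ _)
  refine integral_eq_zero_of_taylor (μ := changeOrbit σ β2 L) (f₀ := mode n c δ)
    -- The wave is a diffeomorphism only under the bound on `ε`; the value `0` elsewhere is never
    -- used, since `ε < 1 / 2` in all conditions.
    (f := fun ε φ => if h : |ε| ≤ 1 / 2 then mode n c δ (postcomp (wave n hn c ε h) φ) *
      Real.exp (1 / σ ^ 2 * energyWith ((wave n hn c ε h).exponent (waveSchwarzian n c ε) β2) φ)
      else 0) hr (fun ε h2 h3 => ?_) hint hint1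
    (hB.const_mul (8 * K ^ 2 / η ^ 2 + 7 * K / η + 4)) (fun ε h2 h3 φ => ?_) fun ε h2 h3 => ?_
  · have h4 := hsmall h2 h3
    have h5 := continuous_wave_derivative hn c h4
    have h6 := hcm.comp (continuous_postcomp (wave n hn c ε h4) h5)
    have h7 := continuous_energyWith (continuous_exponent (continuous_waveSchwarzian n c h4) h5 β2)
    simp only [dif_pos h4]
    exact (h6.mul (Real.continuous_exp.comp
      (continuous_const.mul h7))).measurable.aestronglyMeasurable
  · have h4 := hsmall h2 h3
    have h5 := continuous_wave_derivative hn c h4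
    have hq := continuous_exponent (continuous_waveSchwarzian n c h4) h5 β2
    have hq' : Continuous fun t => ε * (4 * β2 - N ^ 2) * cosMode n c t :=
      continuous_const.mul (continuous_cosMode n c)
    simp only [dif_pos h4]
    refine abs_mul_exp_sub_le h2 ((le_abs_self ε).trans (h4.trans (by norm_num))) hη0 hK0 ?_
      (energy_nonneg φ) (ρ := 1 / σ ^ 2 * energyWith (fun t =>
        (wave n hn c ε h4).exponent (waveSchwarzian n c ε) β2 t -
        ε * (4 * β2 - N ^ 2) * cosMode n c t) φ) ?_ (hd φ) ?_ (abs_mode_le n c hδ _)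
      (abs_modeVariation_le n c hδ φ) (abs_mode_postcomp_sub_le c hδ hn h2 h4 φ)
    · have := (h3.trans_le (min_le_right _ _)).le
      rw [le_div_iff₀ (by positivity)] at this
      linarith
    · rw [energyWith_sub hq hq']
      have : energyWith (fun t => ε * (4 * β2 - N ^ 2) * cosMode n c t) φ =
          ε * (4 * β2 - N ^ 2) * energyWith (cosMode n c) φ := by
        rw [energyWith, energyWith, ← integral_const_mul]
        simp only [mul_assoc]
      rw [this]
      ring
    · have h6 := abs_energyWith_le (fun t => abs_wave_exponent_sub_le hn c h2 h4 β2 t) φ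
      rw [abs_mul, abs_of_pos (by positivity : 0 < 1 / σ ^ 2)]
      calc _ ≤ 1 / σ ^ 2 * (ε ^ 2 * (16 * N ^ 2 + 2 * |β2|) * energy φ) := by gcongr
        _ ≤ 1 / σ ^ 2 * (ε ^ 2 * (16 * N ^ 2 + 4 * |β2|) * energy φ) := by
          have := energy_nonneg φ
          gcongr
          norm_num
        _ = _ := by rw [hK]; ring
  · have h4 := hsmall h2 h3
    simp only [dif_pos h4]
    exact integral_changeOrbit_postcomp β2 hM.orbital (continuous_waveSchwarzian n c h4)
      (continuous_wave_derivative hn c h4) (waveSchwarzian_coe hn c h4) hcm.measurable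

end

/-! ### Summation of the Fourier modes -/

theorem hasSum_integral_of_le {Ω : Type*} [MeasurableSpace Ω] {μ : Measure Ω} {F : ℕ → Ω → ℝ}
    {f G : Ω → ℝ} {b : ℕ → ℝ} (hF : ∀ m, AEStronglyMeasurable (F m) μ) (hG : Integrable G μ)
    (hb : Summable b) (h : ∀ m ω, |F m ω| ≤ b m * G ω)
    (hs : ∀ ω, HasSum (fun m => F m ω) (f ω)) :
    HasSum (fun m => ∫ ω, F m ω ∂μ) (∫ ω, f ω ∂μ) := by
  refine hasSum_integral_of_dominated_convergence (fun m ω => b m * G ω) hF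
    (fun m => Eventually.of_forall (h m)) (Eventually.of_forall fun ω => hb.mul_right _) ?_
    (Eventually.of_forall hs)
  simp only [tsum_mul_right]
  exact hG.const_mul _

theorem cosMode_pi_div_two (n : ℕ) (t : UnitAddCircle) :
    cosMode n (Real.pi / 2) t = sinMode n 0 t := by
  obtain ⟨x, rfl⟩ := QuotientAddGroup.mk_surjective t
  exact (cosMode_coe n _ x).trans ((by rw [sub_zero, Real.cos_sub_pi_div_two] :
    Real.cos (2 * Real.pi * n * x - Real.pi / 2) = Real.sin (2 * Real.pi * n * x - 0)).trans
      (sinMode_coe n 0 x).symm)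

theorem sinMode_pi_div_two (n : ℕ) (t : UnitAddCircle) :
    sinMode n (Real.pi / 2) t = -cosMode n 0 t := by
  obtain ⟨x, rfl⟩ := QuotientAddGroup.mk_surjective t
  exact (sinMode_coe n _ x).trans ((by rw [sub_zero, Real.sin_sub_pi_div_two] :
    Real.sin (2 * Real.pi * n * x - Real.pi / 2) = -Real.cos (2 * Real.pi * n * x - 0)).trans
      (congrArg Neg.neg (cosMode_coe n 0 x).symm))

/-- `cos (2πn(s - t))`. -/
noncomputable def cosDiff (n : ℕ) (s t : UnitAddCircle) : ℝ :=
  cosMode n 0 s * cosMode n 0 t + cosMode n (Real.pi / 2) s * cosMode n (Real.pi / 2) t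

theorem re_pow_eq (r : ℝ) (n : ℕ) (s t : UnitAddCircle) :
    ((r * (AddCircle.toCircle s : ℂ) * starRingEnd ℂ (AddCircle.toCircle t : ℂ)) ^ n).re =
      r ^ n * cosDiff n s t := by
  rw [cosDiff, cosMode_pi_div_two, cosMode_pi_div_two, cosMode, cosMode, sinMode, sinMode,
    mul_pow, mul_pow, ← map_pow, ← Complex.ofReal_pow, mul_assoc, Complex.re_ofReal_mul]
  simp only [neg_zero, Complex.ofReal_zero, zero_mul, Complex.exp_zero, mul_one, Complex.mul_re,
    Complex.conj_re, Complex.conj_im]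
  ring

theorem abs_cosDiff_le (n : ℕ) (s t : UnitAddCircle) : |cosDiff n s t| ≤ 2 := by
  refine (abs_add_le _ _).trans ?_
  rw [abs_mul, abs_mul]
  linarith [mul_le_one₀ (abs_cosMode_le_one n 0 s) (abs_nonneg _) (abs_cosMode_le_one n 0 t),
    mul_le_one₀ (abs_cosMode_le_one n (Real.pi / 2) s) (abs_nonneg _)
      (abs_cosMode_le_one n (Real.pi / 2) t)]

/-- This is the real part of the geometric series in `w = r e(s - t)`; the constant mode is the
subtracted `1`, hence the shift to `m + 1`. -/
theorem hasSum_poisson {r : ℝ} (h0 : 0 ≤ r) (h1 : r < 1) (s t : UnitAddCircle) :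
    HasSum (fun m : ℕ => 2 * r ^ (m + 1) * cosDiff (m + 1) s t)
      (poisson (r * (AddCircle.toCircle s : ℂ)) t - 1) := by
  set w : ℂ := r * (AddCircle.toCircle s : ℂ) * starRingEnd ℂ (AddCircle.toCircle t : ℂ) with hw
  have hwn : Complex.normSq w = r ^ 2 := by
    rw [hw, map_mul, Complex.normSq_conj, normSq_ofReal_mul_toCircle, normSq_toCircle, mul_one]
  have hwl : ‖w‖ < 1 := by
    rw [hw, norm_mul, RCLike.norm_conj, Circle.norm_coe, mul_one]
    exact norm_ofReal_mul_toCircle h0 h1 s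
  have hne : 1 - w ≠ 0 := by
    intro h
    rw [← sub_eq_zero.1 h] at hwl
    simp at hwl
  have hg := ((hasSum_geometric_of_norm_lt_one hwl).mul_left w).mapL Complex.reCLM
  have hg2 := hg.mul_left 2
  have e1 : (fun m : ℕ => 2 * Complex.reCLM (w * w ^ m)) =
      fun m : ℕ => 2 * r ^ (m + 1) * cosDiff (m + 1) s t := by
    funext m
    rw [Complex.reCLM_apply, ← pow_succ', hw, re_pow_eq, mul_assoc]
  have e2 : 2 * Complex.reCLM (w * (1 - w)⁻¹) = poisson (r * (AddCircle.toCircle s : ℂ)) t - 1 := by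
    have hn : Complex.normSq (1 - w) ≠ 0 := Complex.normSq_eq_zero.not.2 hne
    rw [poisson, ← hw, normSq_ofReal_mul_toCircle, ← hwn, Complex.reCLM_apply, Complex.mul_re,
      Complex.inv_re, Complex.inv_im]
    field_simp
    simp only [Complex.normSq_apply, Complex.sub_re, Complex.sub_im, Complex.one_re,
      Complex.one_im]
    ring
  rw [e1, e2] at hg2
  exact hg2

/-- `∫_𝕋 ∫_𝕋 φ'(s)² k(φ'(t)) P_{r e(φ(s))}(φ(t)) dt ds`, with `P` the Poisson kernel and `k` the
cutoff. -/
noncomputable def poissonPair (r δ : ℝ) (φ : CircleDiffeo 1) : ℝ :=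
  energyWith (fun s => ∫ t, poisson (r * (AddCircle.toCircle s : ℂ)) (φ.toFun t) *
    cutoff δ (φ.derivative t)) φ

/-- `∫_𝕋 ∫_𝕋 φ'(s)² k(φ'(t)) cos (2πn(φ(s) - φ(t))) dt ds`. -/
noncomputable def modePair (n : ℕ) (δ : ℝ) (φ : CircleDiffeo 1) : ℝ :=
  mode n 0 δ φ * energyWith (cosMode n 0) φ +
    mode n (Real.pi / 2) δ φ * energyWith (cosMode n (Real.pi / 2)) φ

/-- `∫_𝕋 k(φ')^j dt`. -/
noncomputable def cutoffMoment (j : ℕ) (δ : ℝ) (φ : CircleDiffeo 1) : ℝ :=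
  ∫ t, cutoff δ (φ.derivative t) ^ j

section

variable {δ r : ℝ}

theorem abs_modePair_le (n : ℕ) (hδ : 0 < δ) (φ : CircleDiffeo 1) :
    |modePair n δ φ| ≤ 2 * energy φ := by
  have key : ∀ c, |mode n c δ φ * energyWith (cosMode n c) φ| ≤ energy φ := by
    intro c
    rw [abs_mul]
    have h1 := abs_energyWith_le (abs_cosMode_le_one n c) φ
    rw [one_mul] at h1
    exact (mul_le_of_le_one_left (abs_nonneg _) (abs_mode_le n c hδ φ)).trans h1
  refine (abs_add_le _ _).trans ?_
  linarith [key 0, key (Real.pi / 2)]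

theorem continuous_modePair (n : ℕ) (hδ : 0 < δ) : Continuous (modePair n δ) :=
  ((continuous_mode n _ hδ).mul (continuous_energyWith (continuous_cosMode n _))).add
    ((continuous_mode n _ hδ).mul (continuous_energyWith (continuous_cosMode n _)))

theorem continuous_cutoffMoment (j : ℕ) (hδ : 0 < δ) : Continuous (cutoffMoment j δ) :=
  continuous_integral_comp_of_pos (K := fun _ y => cutoff δ y ^ j)
    (((continuous_cutoff_abs hδ).comp continuous_snd).pow j)

theorem abs_cutoffMoment_le (j : ℕ) (hδ : 0 < δ) (φ : CircleDiffeo 1) :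
    |cutoffMoment j δ φ| ≤ 1 := by
  refine abs_integral_circle_le fun t => ?_
  rw [abs_pow]
  exact pow_le_one₀ (abs_nonneg _) (abs_cutoff_le_one hδ (φ.derivative_pos t).le)

theorem summable_two_mul_pow (h0 : 0 ≤ r) (h1 : r < 1) :
    Summable fun m : ℕ => 2 * r ^ (m + 1) * 2 := by
  have := ((summable_geometric_of_lt_one h0 h1).mul_left (4 * r))
  refine this.congr fun m => ?_
  ring

theorem integral_cosDiff_mul_cutoff (n : ℕ) (hδ : 0 < δ) (φ : CircleDiffeo 1)
    (s : UnitAddCircle) : ∫ t, cosDiff n s (φ.toFun t) * cutoff δ (φ.derivative t) =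
      cosMode n 0 s * mode n 0 δ φ + cosMode n (Real.pi / 2) s * mode n (Real.pi / 2) δ φ := by
  have hi : ∀ c, Integrable fun t => cosMode n c (φ.toFun t) * cutoff δ (φ.derivative t) :=
    fun c => integrable_of_continuous_circle (continuous_mode_integrand n c hδ φ)
  rw [mode, mode, ← integral_const_mul, ← integral_const_mul,
    ← integral_add ((hi _).const_mul _) ((hi _).const_mul _)]
  refine integral_congr_ae (Eventually.of_forall fun t => ?_)
  simp only [cosDiff]
  ring

theorem integral_integral_cosDiff (n : ℕ) (hδ : 0 < δ) (φ : CircleDiffeo 1) :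
    energyWith (fun s => ∫ t, cosDiff n s (φ.toFun t) * cutoff δ (φ.derivative t)) φ =
      modePair n δ φ := by
  have hi : ∀ c, Integrable fun t => cosMode n c (φ.toFun t) * φ.derivative t ^ 2 :=
    fun c => integrable_energyWith (continuous_cosMode n c) φ
  rw [modePair, energyWith, energyWith, energyWith, ← integral_const_mul, ← integral_const_mul,
    ← integral_add ((hi _).const_mul _) ((hi _).const_mul _)]
  refine integral_congr_ae (Eventually.of_forall fun t => ?_)
  simp only [integral_cosDiff_mul_cutoff n hδ]
  ring

theorem hasSum_integral_poisson (hδ : 0 < δ) (h0 : 0 ≤ r) (h1 : r < 1) (φ : CircleDiffeo 1)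
    (s : UnitAddCircle) :
    HasSum (fun m : ℕ => 2 * r ^ (m + 1) *
      ∫ t, cosDiff (m + 1) s (φ.toFun t) * cutoff δ (φ.derivative t))
      ((∫ t, poisson (r * (AddCircle.toCircle s : ℂ)) (φ.toFun t) * cutoff δ (φ.derivative t)) -
        cutoffMoment 1 δ φ) := by
  have hk := continuous_cutoff_derivative hδ φ
  have hP : Continuous fun t => poisson (r * (AddCircle.toCircle s : ℂ)) (φ.toFun t) :=
    (continuous_poisson (norm_ofReal_mul_toCircle h0 h1 s)).comp φ.continuous_toFun
  have e : (∫ t, poisson (r * (AddCircle.toCircle s : ℂ)) (φ.toFun t) *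
      cutoff δ (φ.derivative t)) - cutoffMoment 1 δ φ =
      ∫ t, (poisson (r * (AddCircle.toCircle s : ℂ)) (φ.toFun t) - 1) *
        cutoff δ (φ.derivative t) := by
    have hi := integrable_of_continuous_circle (f := fun t =>
      poisson (r * (AddCircle.toCircle s : ℂ)) (φ.toFun t) * cutoff δ (φ.derivative t)) (hP.mul hk)
    simp only [cutoffMoment, pow_one, sub_mul, one_mul]
    exact (integral_sub hi (integrable_of_continuous_circle hk)).symm
  have hc : ∀ m : ℕ, Continuous fun t => 2 * r ^ (m + 1) * cosDiff (m + 1) s (φ.toFun t) *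
      cutoff δ (φ.derivative t) := fun m =>
    (continuous_const.mul ((continuous_const.mul
      ((continuous_cosMode (m + 1) 0).comp φ.continuous_toFun)).add (continuous_const.mul
        ((continuous_cosMode (m + 1) (Real.pi / 2)).comp φ.continuous_toFun)))).mul hk
  have hb : ∀ (m : ℕ) (t : UnitAddCircle), |2 * r ^ (m + 1) * cosDiff (m + 1) s (φ.toFun t) *
      cutoff δ (φ.derivative t)| ≤ 2 * r ^ (m + 1) * 2 * 1 := by
    intro m t
    rw [abs_mul, abs_mul (2 * r ^ (m + 1)), abs_of_nonneg (by positivity : 0 ≤ 2 * r ^ (m + 1))]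
    exact mul_le_mul (mul_le_mul_of_nonneg_left (abs_cosDiff_le _ _ _) (by positivity))
      (abs_cutoff_le_one hδ (φ.derivative_pos t).le) (abs_nonneg _) (by positivity)
  have hs := hasSum_integral_of_le (μ := (volume : Measure UnitAddCircle))
    (fun m => (hc m).aestronglyMeasurable)
    (integrable_const (1 : ℝ)) (summable_two_mul_pow h0 h1) hb
    fun t => (hasSum_poisson h0 h1 s (φ.toFun t)).mul_right (cutoff δ (φ.derivative t))
  rw [e]
  convert! hs using 2 with m
  rw [← integral_const_mul]
  simp only [mul_assoc]

theorem continuous_integral_poisson (hδ : 0 < δ) (h0 : 0 ≤ r) (h1 : r < 1) (φ : CircleDiffeo 1) :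
    Continuous fun s : UnitAddCircle => ∫ t, poisson (r * (AddCircle.toCircle s : ℂ)) (φ.toFun t) *
      cutoff δ (φ.derivative t) := by
  have hk := continuous_cutoff_derivative hδ φ
  have hP : Continuous fun p : UnitAddCircle × UnitAddCircle =>
      poisson (r * (AddCircle.toCircle p.1 : ℂ)) (φ.toFun p.2) :=
    continuous_poisson_comp (continuous_const.mul (continuous_toCircle_coe.comp continuous_fst))
      (fun p => norm_ofReal_mul_toCircle h0 h1 p.1) (φ.continuous_toFun.comp continuous_snd)
  have := continuous_parametric_integral_of_continuous (μ := (volume : Measure UnitAddCircle))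
    (f := fun s t => poisson (r * (AddCircle.toCircle s : ℂ)) (φ.toFun t) *
      cutoff δ (φ.derivative t)) (hP.mul (hk.comp continuous_snd)) isCompact_univ
  simpa only [Measure.restrict_univ] using this

/-- The Fourier series of the Poisson kernel, integrated in both variables; the subtracted product
is the contribution of the constant mode. -/
theorem hasSum_poissonPair (hδ : 0 < δ) (h0 : 0 ≤ r) (h1 : r < 1) (φ : CircleDiffeo 1) :
    HasSum (fun m : ℕ => 2 * r ^ (m + 1) * modePair (m + 1) δ φ)
      (poissonPair r δ φ - cutoffMoment 1 δ φ * energy φ) := by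
  have hc : ∀ m : ℕ, Continuous fun s =>
      ∫ t, cosDiff (m + 1) s (φ.toFun t) * cutoff δ (φ.derivative t) := by
    intro m
    simp only [integral_cosDiff_mul_cutoff _ hδ]
    exact ((continuous_cosMode _ _).mul continuous_const).add
      ((continuous_cosMode _ _).mul continuous_const)
  have e : poissonPair r δ φ - cutoffMoment 1 δ φ * energy φ = ∫ s,
      ((∫ t, poisson (r * (AddCircle.toCircle (φ.toFun s) : ℂ)) (φ.toFun t) *
        cutoff δ (φ.derivative t)) - cutoffMoment 1 δ φ) * φ.derivative s ^ 2 := by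
    have hi := integrable_energyWith (continuous_integral_poisson hδ h0 h1 φ) φ
    have hi2 := integrable_energyWith (q := fun _ => cutoffMoment 1 δ φ) continuous_const φ
    simp only [poissonPair, energyWith, energy, sub_mul]
    rw [integral_sub hi hi2, integral_const_mul]
  rw [e]
  simp only [← integral_integral_cosDiff _ hδ, energyWith, ← integral_const_mul (2 * r ^ _)]
  refine hasSum_integral_of_le (G := fun s => φ.derivative s ^ 2)
    (b := fun m => 2 * r ^ (m + 1) * 2) (fun m => ?_)
    (integrable_of_continuous_circle (φ.continuous_derivative.pow 2))
    (summable_two_mul_pow h0 h1) (fun m s => ?_) fun s => ?_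
  · exact ((integrable_energyWith (hc m) φ).const_mul _).aestronglyMeasurable
  · have h2 : |∫ t, cosDiff (m + 1) (φ.toFun s) (φ.toFun t) * cutoff δ (φ.derivative t)| ≤ 2 := by
      refine abs_integral_circle_le fun t => ?_
      rw [abs_mul]
      nlinarith [abs_cosDiff_le (m + 1) (φ.toFun s) (φ.toFun t),
        abs_nonneg (cosDiff (m + 1) (φ.toFun s) (φ.toFun t)),
        abs_cutoff_le_one hδ (φ.derivative_pos t).le]
    rw [abs_mul (2 * r ^ (m + 1)), abs_of_nonneg (by positivity : 0 ≤ 2 * r ^ (m + 1)), abs_mul,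
      abs_of_nonneg (sq_nonneg (φ.derivative s)), mul_assoc (2 * r ^ (m + 1))]
    gcongr
  · simpa only [mul_assoc] using
      (hasSum_integral_poisson hδ h0 h1 φ (φ.toFun s)).mul_right (φ.derivative s ^ 2)

end

/-- `∫_𝕋 k(φ') φ' dt`. -/
noncomputable def cutoffLength (δ : ℝ) (φ : CircleDiffeo 1) : ℝ :=
  ∫ t, cutoff δ (φ.derivative t) * φ.derivative t

/-! ### Concentration of the Poisson pairing as the radius tends to one -/

section

variable {δ r : ℝ}

theorem cutoff_eq_inv_mul (δ y : ℝ) : cutoff δ y = (y + δ)⁻¹ * y := by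
  rw [cutoff, div_eq_inv_mul]

theorem integral_poisson_comp_mul_derivative (h0 : 0 ≤ r) (h1 : r < 1) (φ : CircleDiffeo 1)
    (s : UnitAddCircle) :
    ∫ t, poisson (r * (AddCircle.toCircle s : ℂ)) (φ.toFun t) * φ.derivative t = 1 := by
  rw [φ.integral_comp_mul_derivative (continuous_poisson (norm_ofReal_mul_toCircle h0 h1 s)),
    integral_poisson (norm_ofReal_mul_toCircle h0 h1 s)]

theorem continuous_inv_derivative_add (hδ : 0 < δ) (φ : CircleDiffeo 1) :
    Continuous fun t => (φ.derivative t + δ)⁻¹ :=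
  (φ.continuous_derivative.add continuous_const).inv₀ fun t =>
    (add_pos (φ.derivative_pos t) hδ).ne'

/-- Here lies the reason for the cutoff. Without it the integral would tend to `1 / φ'`, which is
not bounded uniformly in `φ`; since `cutoff δ y ≤ y / δ`, it is dominated by `∫ P(φ) φ' = 1`. -/
theorem abs_integral_poisson_le (hδ : 0 < δ) (h0 : 0 ≤ r) (h1 : r < 1) (φ : CircleDiffeo 1)
    (s : UnitAddCircle) : |∫ t, poisson (r * (AddCircle.toCircle s : ℂ)) (φ.toFun t) *
      cutoff δ (φ.derivative t)| ≤ 1 / δ := by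
  have hz := norm_ofReal_mul_toCircle h0 h1 s
  have hP : Continuous fun t => poisson (r * (AddCircle.toCircle s : ℂ)) (φ.toFun t) :=
    (continuous_poisson hz).comp φ.continuous_toFun
  have hi : Integrable fun t => 1 / δ *
      (poisson (r * (AddCircle.toCircle s : ℂ)) (φ.toFun t) * φ.derivative t) :=
    (integrable_of_continuous_circle (hP.mul φ.continuous_derivative)).const_mul _
  have h : ‖∫ t, poisson (r * (AddCircle.toCircle s : ℂ)) (φ.toFun t) *
      cutoff δ (φ.derivative t)‖ ≤ ∫ t, 1 / δ *
      (poisson (r * (AddCircle.toCircle s : ℂ)) (φ.toFun t) * φ.derivative t) := by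
    refine norm_integral_le_of_norm_le hi (Eventually.of_forall fun t => ?_)
    have hp := poisson_pos hz (φ.toFun t)
    have hd := φ.derivative_pos t
    rw [Real.norm_eq_abs, abs_of_nonneg (mul_nonneg hp.le (cutoff_nonneg hδ hd.le))]
    have : cutoff δ (φ.derivative t) ≤ 1 / δ * φ.derivative t := by
      rw [cutoff_eq_inv_mul, one_div]
      gcongr
      linarith
    calc _ ≤ poisson (r * (AddCircle.toCircle s : ℂ)) (φ.toFun t) *
          (1 / δ * φ.derivative t) := by gcongr
      _ = _ := by ring
  rwa [integral_const_mul, integral_poisson_comp_mul_derivative h0 h1, mul_one] at h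

theorem abs_poissonPair_le (hδ : 0 < δ) (h0 : 0 ≤ r) (h1 : r < 1) (φ : CircleDiffeo 1) :
    |poissonPair r δ φ| ≤ 1 / δ * energy φ :=
  abs_energyWith_le (fun s => abs_integral_poisson_le hδ h0 h1 φ s) φ

/-- As `cutoff δ y = y / (y + δ)`, the integral is the average of `1 / (φ' + δ)` against the
probability density `P(φ) φ'`, which concentrates at `s`. -/
theorem abs_integral_poisson_sub_le (hδ : 0 < δ) (h0 : 0 < r) (h1 : r < 1) (φ : CircleDiffeo 1)
    {ε C : ℝ} (hC : 0 ≤ C) (h : ∀ s t, |(φ.derivative s + δ)⁻¹ - (φ.derivative t + δ)⁻¹| ≤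
      ε + C * gap (φ.toFun s) (φ.toFun t)) (s : UnitAddCircle) :
    |(∫ t, poisson (r * (AddCircle.toCircle (φ.toFun s) : ℂ)) (φ.toFun t) *
      cutoff δ (φ.derivative t)) - (φ.derivative s + δ)⁻¹| ≤
      ε + C * ((1 - r ^ 2) / (2 * r)) := by
  have hz := norm_ofReal_mul_toCircle h0.le h1 (φ.toFun s)
  set P : UnitAddCircle → ℝ := fun t =>
    poisson (r * (AddCircle.toCircle (φ.toFun s) : ℂ)) (φ.toFun t) with hPdef
  have hP : Continuous P := (continuous_poisson hz).comp φ.continuous_toFun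
  have hd := φ.continuous_derivative
  have hinv := continuous_inv_derivative_add hδ φ
  have hk := continuous_cutoff_derivative hδ φ
  have hI : ∫ t, P t * φ.derivative t = 1 :=
    integral_poisson_comp_mul_derivative h0.le h1 φ (φ.toFun s)
  have e : (∫ t, P t * cutoff δ (φ.derivative t)) - (φ.derivative s + δ)⁻¹ =
      ∫ t, P t * φ.derivative t * ((φ.derivative t + δ)⁻¹ - (φ.derivative s + δ)⁻¹) := by
    have h2 : (φ.derivative s + δ)⁻¹ = ∫ t, P t * φ.derivative t * (φ.derivative s + δ)⁻¹ := by
      rw [integral_mul_const, hI, one_mul]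
    nth_rewrite 1 [h2]
    rw [← integral_sub (integrable_of_continuous_circle
        (f := fun t => P t * cutoff δ (φ.derivative t)) (hP.mul hk))
      (integrable_of_continuous_circle (f := fun t => P t * φ.derivative t * (φ.derivative s + δ)⁻¹)
        ((hP.mul hd).mul continuous_const))]
    refine integral_congr_ae (Eventually.of_forall fun t => ?_)
    simp only [cutoff_eq_inv_mul]
    ring
  have hi : Integrable fun t => ε * (P t * φ.derivative t) +
      C * ((1 - r ^ 2) / (2 * r)) * φ.derivative t :=
    integrable_of_continuous_circle
      ((continuous_const.mul (hP.mul hd)).add (continuous_const.mul hd))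
  have hb : ‖∫ t, P t * φ.derivative t * ((φ.derivative t + δ)⁻¹ - (φ.derivative s + δ)⁻¹)‖ ≤
      ∫ t, (ε * (P t * φ.derivative t) + C * ((1 - r ^ 2) / (2 * r)) * φ.derivative t) := by
    refine norm_integral_le_of_norm_le hi (Eventually.of_forall fun t => ?_)
    have hp : 0 < P t := poisson_pos hz _
    have hdt := φ.derivative_pos t
    rw [Real.norm_eq_abs, abs_mul, abs_of_pos (mul_pos hp hdt), abs_sub_comm]
    calc _ ≤ P t * φ.derivative t * (ε + C * gap (φ.toFun s) (φ.toFun t)) :=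
          mul_le_mul_of_nonneg_left (h s t) (mul_pos hp hdt).le
      _ = ε * (P t * φ.derivative t) +
          C * (P t * gap (φ.toFun s) (φ.toFun t)) * φ.derivative t := by ring
      _ ≤ _ := by
        gcongr
        exact poisson_mul_gap_le h0 h1 _ _
  have hi1 : Integrable fun t => ε * (P t * φ.derivative t) :=
    integrable_of_continuous_circle (continuous_const.mul (hP.mul hd))
  have hi2 : Integrable fun t => C * ((1 - r ^ 2) / (2 * r)) * φ.derivative t :=
    integrable_of_continuous_circle (continuous_const.mul hd)
  rw [integral_add hi1 hi2, integral_const_mul, integral_const_mul, hI, φ.integral_derivative,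
    mul_one, mul_one] at hb
  rw [e]
  exact hb

theorem tendsto_poissonPair (hδ : 0 < δ) (φ : CircleDiffeo 1) :
    Tendsto (fun r => poissonPair r δ φ) (𝓝[<] 1) (𝓝 (cutoffLength δ φ)) := by
  have key : ∀ {r ε C : ℝ}, 0 < r → r < 1 → 0 ≤ C →
      (∀ s t, |(φ.derivative s + δ)⁻¹ - (φ.derivative t + δ)⁻¹| ≤
        ε + C * gap (φ.toFun s) (φ.toFun t)) →
      |poissonPair r δ φ - cutoffLength δ φ| ≤ (ε + C * ((1 - r ^ 2) / (2 * r))) * energy φ := by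
    intro r ε C h0 h1 hC h
    have hi := integrable_energyWith (continuous_integral_poisson hδ h0.le h1 φ) φ
    have hi2 : Integrable fun t => cutoff δ (φ.derivative t) * φ.derivative t :=
      integrable_of_continuous_circle
        ((continuous_cutoff_derivative hδ φ).mul φ.continuous_derivative)
    have hi3 : Integrable fun s => (ε + C * ((1 - r ^ 2) / (2 * r))) * φ.derivative s ^ 2 :=
      integrable_of_continuous_circle (continuous_const.mul (φ.continuous_derivative.pow 2))
    rw [poissonPair, cutoffLength, energyWith, ← integral_sub hi hi2, energy,
      ← integral_const_mul, ← Real.norm_eq_abs]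
    refine norm_integral_le_of_norm_le hi3 (Eventually.of_forall fun s => ?_)
    have h2 := abs_integral_poisson_sub_le hδ h0 h1 φ hC h s
    rw [cutoff_eq_inv_mul, mul_assoc, ← sq, ← sub_mul, Real.norm_eq_abs, abs_mul,
      abs_of_nonneg (sq_nonneg (φ.derivative s))]
    exact mul_le_mul_of_nonneg_right h2 (sq_nonneg _)
  rw [Metric.tendsto_nhds]
  intro η hη
  have hE := energy_nonneg φ
  obtain ⟨C, hC, h⟩ := φ.exists_abs_sub_le_gap (continuous_inv_derivative_add hδ φ)
    (ε := η / (2 * (energy φ + 1))) (by positivity)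
  have hlim : Tendsto (fun r : ℝ => (η / (2 * (energy φ + 1)) +
      C * ((1 - r ^ 2) / (2 * r))) * energy φ) (𝓝[<] 1)
      (𝓝 ((η / (2 * (energy φ + 1)) + C * ((1 - 1 ^ 2) / (2 * 1))) * energy φ)) := by
    have hc : ContinuousAt (fun r : ℝ => (η / (2 * (energy φ + 1)) +
      C * ((1 - r ^ 2) / (2 * r))) * energy φ) 1 := by
      have : ContinuousAt (fun r : ℝ => (1 - r ^ 2) / (2 * r)) 1 :=
        ContinuousAt.div (by fun_prop) (by fun_prop) (by norm_num)
      fun_prop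
    exact hc.tendsto.mono_left nhdsWithin_le_nhds
  have hlt : (η / (2 * (energy φ + 1)) + C * ((1 - 1 ^ 2) / (2 * 1))) * energy φ < η := by
    have : η / (2 * (energy φ + 1)) * energy φ = η * (energy φ / (2 * (energy φ + 1))) := by ring
    have h3 : energy φ / (2 * (energy φ + 1)) < 1 := by
      rw [div_lt_one (by positivity)]
      linarith
    norm_num
    rw [this]
    nlinarith
  filter_upwards [hlim.eventually_lt_const hlt, Ioo_mem_nhdsLT (zero_lt_one' ℝ)] with r h3 h4
  rw [Real.dist_eq]
  exact (key h4.1 h4.2 hC h).trans_lt h3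

end

/-- For the two phases the squares add up to one, and `-k + k (1 - k) = -k²`. -/
theorem modeVariation_add (n : ℕ) {δ : ℝ} (hδ : 0 < δ) (φ : CircleDiffeo 1) :
    modeVariation n 0 δ φ + modeVariation n (Real.pi / 2) δ φ = -cutoffMoment 2 δ φ := by
  rw [modeVariation, modeVariation, ← integral_add
    (integrable_of_continuous_circle (continuous_modeVariation_integrand n _ hδ φ))
    (integrable_of_continuous_circle (continuous_modeVariation_integrand n _ hδ φ)),
    cutoffMoment, ← integral_neg]
  refine integral_congr_ae (Eventually.of_forall fun t => ?_)
  have h := sinMode_sq_add_cosMode_sq n 0 (φ.toFun t)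
  simp only [cosMode_pi_div_two, sinMode_pi_div_two]
  linear_combination (-cutoff δ (φ.derivative t) ^ 2) * h

section

variable {σ : ℝ} {M : Measure DiffModPSL} {L : Measure (CircleDiffeo 1)}

theorem integrable_mode_mul_energyWith (hσ : 0 < σ) (hM : IsSchwarzianMeasure σ M L) {β2 : ℝ}
    (hβ : β2 < Real.pi ^ 2) {δ : ℝ} (hδ : 0 < δ) (n : ℕ) (c : ℝ) :
    Integrable (fun φ => mode n c δ φ * energyWith (cosMode n c) φ) (changeOrbit σ β2 L) := by
  have := hM.finite
  refine (integrable_energy_changeOrbit hM.lift hσ hβ).mono'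
    ((continuous_mode n c hδ).mul
      (continuous_energyWith (continuous_cosMode n c))).measurable.aestronglyMeasurable
    (Eventually.of_forall fun φ => ?_)
  have h1 := abs_energyWith_le (abs_cosMode_le_one n c) φ
  rw [one_mul] at h1
  rw [norm_mul, Real.norm_eq_abs, Real.norm_eq_abs]
  exact (mul_le_of_le_one_left (abs_nonneg _) (abs_mode_le n c hδ φ)).trans h1

/-- The sum of the first-order identities for `c = 0` and `c = π / 2`; only this rotation-invariant
combination has an explicit variation term. -/
theorem integral_modePair (hσ : 0 < σ) (hM : IsSchwarzianMeasure σ M L) {β2 : ℝ}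
    (hβ : β2 < Real.pi ^ 2) {n : ℕ} (hn : n ≠ 0) {δ : ℝ} (hδ : 0 < δ) :
    1 / σ ^ 2 * (4 * β2 - (2 * Real.pi * n) ^ 2) * ∫ φ, modePair n δ φ ∂(changeOrbit σ β2 L) =
      ∫ φ, cutoffMoment 2 δ φ ∂(changeOrbit σ β2 L) := by
  have := hM.finite
  have := isFiniteMeasure_changeOrbit hM.lift hσ hβ
  have hv : ∀ c, Integrable (modeVariation n c δ) (changeOrbit σ β2 L) := fun c =>
    (integrable_const (2 : ℝ)).mono'
      (continuous_modeVariation n c hδ).measurable.aestronglyMeasurable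
      (Eventually.of_forall fun φ => abs_modeVariation_le n c hδ φ)
  have hp := integrable_mode_mul_energyWith hσ hM hβ hδ n
  have key : ∀ c, ∫ φ, modeVariation n c δ φ ∂(changeOrbit σ β2 L) +
      1 / σ ^ 2 * (4 * β2 - (2 * Real.pi * n) ^ 2) *
        ∫ φ, mode n c δ φ * energyWith (cosMode n c) φ ∂(changeOrbit σ β2 L) = 0 := by
    intro c
    rw [← integral_modeVariation_add hσ hM hβ hn c hδ, ← integral_const_mul,
      ← integral_add (hv c) ((hp c).const_mul _)]
    refine integral_congr_ae (Eventually.of_forall fun φ => ?_)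
    ring
  have h1 : ∫ φ, modePair n δ φ ∂(changeOrbit σ β2 L) =
      ∫ φ, mode n 0 δ φ * energyWith (cosMode n 0) φ ∂(changeOrbit σ β2 L) +
      ∫ φ, mode n (Real.pi / 2) δ φ * energyWith (cosMode n (Real.pi / 2)) φ
        ∂(changeOrbit σ β2 L) := integral_add (hp _) (hp _)
  have h2 : -∫ φ, cutoffMoment 2 δ φ ∂(changeOrbit σ β2 L) =
      ∫ φ, modeVariation n 0 δ φ ∂(changeOrbit σ β2 L) +
      ∫ φ, modeVariation n (Real.pi / 2) δ φ ∂(changeOrbit σ β2 L) := by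
    rw [← integral_add (hv _) (hv _), ← integral_neg]
    simp only [modeVariation_add n hδ]
  rw [h1]
  linear_combination key 0 + key (Real.pi / 2) + h2

end

/-! ### The cotangent series -/

theorem sq_sub_pi_mul_sq_neg {β : ℝ} (h0 : 0 < β) (h1 : β < Real.pi) (m : ℕ) :
    β ^ 2 - (Real.pi * (m + 1 : ℕ)) ^ 2 < 0 := by
  have hm : (1 : ℝ) ≤ ((m + 1 : ℕ) : ℝ) := by push_cast; linarith [Nat.cast_nonneg (α := ℝ) m]
  have h2 : β < Real.pi * ((m + 1 : ℕ) : ℝ) := by nlinarith [Real.pi_pos]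
  have := pow_lt_pow_left₀ h2 h0.le two_ne_zero
  linarith

/-- The partial fraction expansion of the cotangent. -/
theorem hasSum_cot {β : ℝ} (h0 : 0 < β) (h1 : β < Real.pi) :
    HasSum (fun m : ℕ => 1 / (β ^ 2 - (Real.pi * (m + 1 : ℕ)) ^ 2))
      ((Real.cos β / Real.sin β - 1 / β) / (2 * β)) := by
  have hpi := Real.pi_pos
  -- The expansion of `π cot (πz)` is applied at `z = β / π`, which lies strictly between `0` and
  -- `1`.
  have hz : ((β / Real.pi : ℝ) : ℂ) ∈ Complex.integerComplement := by
    rw [Complex.mem_integerComplement_iff]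
    rintro ⟨k, hk⟩
    have hk' : (k : ℝ) = β / Real.pi := by exact_mod_cast hk
    have hk0 : (0 : ℝ) < k := by rw [hk']; positivity
    have hk1 : (k : ℝ) < 1 := by rw [hk', div_lt_one hpi]; exact h1
    have hk2 : 0 < k := by exact_mod_cast hk0
    have hk3 : k < 1 := by exact_mod_cast hk1
    omega
  have hs := (summable_cotTerm hz).hasSum
  have hr := cot_series_rep' hz
  have e0 : ∑' n, cotTerm ((β / Real.pi : ℝ) : ℂ) n =
      ((Real.pi * (Real.cos β / Real.sin β) - Real.pi / β : ℝ) : ℂ) := by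
    refine hr.symm.trans ?_
    have : (Real.pi : ℂ) * ((β / Real.pi : ℝ) : ℂ) = (β : ℂ) := by
      rw [← Complex.ofReal_mul]
      congr 1
      field_simp
    rw [this, Complex.cot]
    push_cast
    field_simp
  rw [e0] at hs
  have hs2 := (hs.mapL Complex.reCLM).mul_left (1 / (2 * β * Real.pi))
  convert! hs2 using 1
  · funext m
    have hne := (sq_sub_pi_mul_sq_neg h0 h1 m).ne
    have hc : cotTerm ((β / Real.pi : ℝ) : ℂ) m =
        ((2 * β * Real.pi * (1 / (β ^ 2 - (Real.pi * (m + 1 : ℕ)) ^ 2)) : ℝ) : ℂ) := by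
      rw [cotTerm_identity hz]
      have e : ((((β / Real.pi : ℝ) : ℂ) + (m + 1)) * (((β / Real.pi : ℝ) : ℂ) - (m + 1))) =
          (((β ^ 2 - (Real.pi * ((m + 1 : ℕ) : ℝ)) ^ 2) / Real.pi ^ 2 : ℝ) : ℂ) := by
        push_cast
        field_simp
        ring
      rw [e]
      norm_cast
      rw [one_div_div]
      field_simp
    rw [hc, Complex.reCLM_apply, Complex.ofReal_re]
    field_simp
  · rw [Complex.reCLM_apply, Complex.ofReal_re]
    field_simp

/-! ### Bounds and limits when the cutoff is removed -/

theorem abs_cutoffLength_le {δ : ℝ} (hδ : 0 < δ) (φ : CircleDiffeo 1) :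
    |cutoffLength δ φ| ≤ 1 := by
  rw [← φ.integral_derivative, cutoffLength, ← Real.norm_eq_abs]
  refine norm_integral_le_of_norm_le (integrable_of_continuous_circle φ.continuous_derivative)
    (Eventually.of_forall fun t => ?_)
  have h := (φ.derivative_pos t).le
  rw [norm_mul, Real.norm_eq_abs, Real.norm_eq_abs, abs_of_nonneg h]
  exact mul_le_of_le_one_left h (abs_cutoff_le_one hδ h)

theorem continuous_cutoffLength {δ : ℝ} (hδ : 0 < δ) : Continuous (cutoffLength δ) :=
  continuous_integral_comp_of_pos (K := fun _ y => cutoff δ y * y)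
    (((continuous_cutoff_abs hδ).comp continuous_snd).mul (continuous_abs.comp continuous_snd))

theorem tendsto_cutoff {y : ℝ} (hy : 0 < y) :
    Tendsto (fun δ => cutoff δ y) (𝓝[>] 0) (𝓝 1) := by
  have hc : ContinuousAt (fun δ => cutoff δ y) 0 :=
    ContinuousAt.div (by fun_prop) (by fun_prop) (by simpa using hy.ne')
  have := hc.tendsto.mono_left (nhdsWithin_le_nhds (s := Set.Ioi 0))
  simpa [cutoff, hy.ne'] using this

theorem tendsto_cutoffMoment (j : ℕ) (φ : CircleDiffeo 1) :
    Tendsto (fun δ => cutoffMoment j δ φ) (𝓝[>] 0) (𝓝 1) := by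
  have h : Tendsto (fun δ => cutoffMoment j δ φ) (𝓝[>] 0)
      (𝓝 (∫ _ : UnitAddCircle, (1 : ℝ) ^ j)) := by
    refine tendsto_integral_filter_of_dominated_convergence (fun _ => 1) ?_ ?_
      (integrable_const _)
      (Eventually.of_forall fun t => (tendsto_cutoff (φ.derivative_pos t)).pow j)
    · filter_upwards [self_mem_nhdsWithin] with δ hδ
      exact ((continuous_cutoff_derivative hδ φ).pow j).aestronglyMeasurable
    · filter_upwards [self_mem_nhdsWithin] with δ hδ
      refine Eventually.of_forall fun t => ?_
      rw [norm_pow]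
      exact pow_le_one₀ (norm_nonneg _) (abs_cutoff_le_one hδ (φ.derivative_pos t).le)
  simpa using h

theorem tendsto_cutoffLength (φ : CircleDiffeo 1) :
    Tendsto (fun δ => cutoffLength δ φ) (𝓝[>] 0) (𝓝 1) := by
  have h : Tendsto (fun δ => cutoffLength δ φ) (𝓝[>] 0)
      (𝓝 (∫ t : UnitAddCircle, 1 * φ.derivative t)) := by
    refine tendsto_integral_filter_of_dominated_convergence (fun t => φ.derivative t) ?_ ?_
      (integrable_of_continuous_circle φ.continuous_derivative)
      (Eventually.of_forall fun t => (tendsto_cutoff (φ.derivative_pos t)).mul_const _)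
    · filter_upwards [self_mem_nhdsWithin] with δ hδ
      exact ((continuous_cutoff_derivative hδ φ).mul φ.continuous_derivative).aestronglyMeasurable
    · filter_upwards [self_mem_nhdsWithin] with δ hδ
      refine Eventually.of_forall fun t => ?_
      have h := (φ.derivative_pos t).le
      rw [norm_mul, Real.norm_eq_abs, Real.norm_eq_abs, abs_of_nonneg h]
      exact mul_le_of_le_one_left h (abs_cutoff_le_one hδ h)
  simpa only [one_mul, φ.integral_derivative] using h

/-! ### The mean energy of the orbital measures -/

section

variable {σ : ℝ} {M : Measure DiffModPSL} {L : Measure (CircleDiffeo 1)}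

theorem hasSum_integral_poissonPair (hσ : 0 < σ) (hM : IsSchwarzianMeasure σ M L) {β : ℝ}
    (h0 : 0 < β) (h1 : β < Real.pi) {δ : ℝ} (hδ : 0 < δ) {r : ℝ} (hr0 : 0 ≤ r) (hr1 : r < 1) :
    HasSum (fun m : ℕ => r ^ (m + 1) * (σ ^ 2 / 2 *
        (∫ φ, cutoffMoment 2 δ φ ∂(changeOrbit σ (β ^ 2) L)) *
          (1 / (β ^ 2 - (Real.pi * (m + 1 : ℕ)) ^ 2))))
      (∫ φ, (poissonPair r δ φ - cutoffMoment 1 δ φ * energy φ) ∂(changeOrbit σ (β ^ 2) L)) := by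
  have := hM.finite
  have hβ : β ^ 2 < Real.pi ^ 2 := pow_lt_pow_left₀ h1 h0.le two_ne_zero
  have h := hasSum_integral_of_le (μ := changeOrbit σ (β ^ 2) L)
    (F := fun (m : ℕ) φ => 2 * r ^ (m + 1) * modePair (m + 1) δ φ)
    (fun m => (continuous_const.mul
      (continuous_modePair (m + 1) hδ)).measurable.aestronglyMeasurable)
    (integrable_energy_changeOrbit hM.lift hσ hβ) (summable_two_mul_pow hr0 hr1) (fun m φ => by
      rw [abs_mul, abs_of_nonneg (by positivity : 0 ≤ 2 * r ^ (m + 1)), mul_assoc (2 * r ^ (m + 1))]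
      exact mul_le_mul_of_nonneg_left (abs_modePair_le (m + 1) hδ φ) (by positivity))
    fun φ => hasSum_poissonPair hδ hr0 hr1 φ
  convert! h using 1
  funext m
  have hp := integral_modePair hσ hM hβ (Nat.succ_ne_zero m) hδ
  have hne := (sq_sub_pi_mul_sq_neg h0 h1 m).ne
  have hD : 4 * β ^ 2 - (2 * Real.pi * ((m + 1 : ℕ) : ℝ)) ^ 2 =
      4 * (β ^ 2 - (Real.pi * ((m + 1 : ℕ) : ℝ)) ^ 2) := by ring
  rw [Nat.succ_eq_add_one, hD] at hp
  rw [integral_const_mul, ← hp]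
  set D := β ^ 2 - (Real.pi * ((m + 1 : ℕ) : ℝ)) ^ 2
  field_simp
  ring

/-- Abel summation: `r → 1` in `hasSum_integral_poissonPair`. The left side is dominated by `(1 / δ
+ 1) energy`, the right side by the absolutely convergent cotangent series. -/
theorem integral_cutoffLength (hσ : 0 < σ) (hM : IsSchwarzianMeasure σ M L) {β : ℝ}
    (h0 : 0 < β) (h1 : β < Real.pi) {δ : ℝ} (hδ : 0 < δ) :
    ∫ φ, (cutoffLength δ φ - cutoffMoment 1 δ φ * energy φ) ∂(changeOrbit σ (β ^ 2) L) =
      σ ^ 2 / 2 * (∫ φ, cutoffMoment 2 δ φ ∂(changeOrbit σ (β ^ 2) L)) *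
        ((Real.cos β / Real.sin β - 1 / β) / (2 * β)) := by
  have := hM.finite
  have hβ : β ^ 2 < Real.pi ^ 2 := pow_lt_pow_left₀ h1 h0.le two_ne_zero
  have hA := integrable_energy_changeOrbit hM.lift hσ hβ
  have hm := hasSum_cot h0 h1
  set K := σ ^ 2 / 2 * (∫ φ, cutoffMoment 2 δ φ ∂(changeOrbit σ (β ^ 2) L))
  have hmoment : ∀ φ, |cutoffMoment 1 δ φ * energy φ| ≤ energy φ := fun φ => by
    rw [abs_mul, abs_of_nonneg (energy_nonneg φ)]
    exact mul_le_of_le_one_left (energy_nonneg φ) (abs_cutoffMoment_le 1 hδ φ)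
  have hlim1 : Tendsto (fun r => ∫ φ, (poissonPair r δ φ - cutoffMoment 1 δ φ * energy φ)
      ∂(changeOrbit σ (β ^ 2) L)) (𝓝[<] 1) (𝓝 (∫ φ, (cutoffLength δ φ -
        cutoffMoment 1 δ φ * energy φ) ∂(changeOrbit σ (β ^ 2) L))) := by
    refine tendsto_integral_filter_of_dominated_convergence (fun φ => (1 / δ + 1) * energy φ) ?_ ?_
      (hA.const_mul _) (Eventually.of_forall fun φ => (tendsto_poissonPair hδ φ).sub_const _)
    · filter_upwards [Ioo_mem_nhdsLT (zero_lt_one' ℝ)] with r hr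
      -- `poissonPair` is measurable as a pointwise limit of continuous partial sums.
      refine aestronglyMeasurable_of_tendsto_ae atTop (f := fun (N : ℕ) φ =>
        ∑ m ∈ Finset.range N, 2 * r ^ (m + 1) * modePair (m + 1) δ φ) (fun N => ?_)
        (Eventually.of_forall fun φ => (hasSum_poissonPair hδ hr.1.le hr.2 φ).tendsto_sum_nat)
      exact (continuous_finsetSum _ fun m _ => continuous_const.mul
        (continuous_modePair (m + 1) hδ)).measurable.aestronglyMeasurable
    · filter_upwards [Ioo_mem_nhdsLT (zero_lt_one' ℝ)] with r hr
      refine Eventually.of_forall fun φ => (norm_sub_le _ _).trans ?_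
      rw [add_mul, one_mul]
      exact add_le_add (abs_poissonPair_le hδ hr.1.le hr.2 φ) (hmoment φ)
  have hlim2 : Tendsto (fun r : ℝ => ∑' m : ℕ, r ^ (m + 1) * (K *
      (1 / (β ^ 2 - (Real.pi * (m + 1 : ℕ)) ^ 2)))) (𝓝[<] 1)
      (𝓝 (∑' m : ℕ, 1 ^ (m + 1) * (K * (1 / (β ^ 2 - (Real.pi * (m + 1 : ℕ)) ^ 2))))) := by
    refine tendsto_tsum_of_dominated_convergence (hm.summable.mul_left K).norm (fun m => ?_) ?_
    · exact ((tendsto_id.mono_left nhdsWithin_le_nhds).pow (m + 1)).mul_const _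
    · filter_upwards [Ioo_mem_nhdsLT (zero_lt_one' ℝ)] with r hr m
      rw [norm_mul, norm_pow, Real.norm_eq_abs, abs_of_pos hr.1]
      exact mul_le_of_le_one_left (norm_nonneg _) (pow_le_one₀ hr.1.le hr.2.le)
  simp only [one_pow, one_mul] at hlim2
  rw [(hm.mul_left K).tsum_eq] at hlim2
  refine tendsto_nhds_unique hlim1 (hlim2.congr' ?_)
  filter_upwards [Ioo_mem_nhdsLT (zero_lt_one' ℝ)] with r hr
  exact (hasSum_integral_poissonPair hσ hM h0 h1 hδ hr.1.le hr.2).tsum_eq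

/-- The relation between the total mass and the mean energy of the orbital measures. -/
theorem measureReal_sub_integral_energy (hσ : 0 < σ) (hM : IsSchwarzianMeasure σ M L) {β : ℝ}
    (h0 : 0 < β) (h1 : β < Real.pi) :
    (changeOrbit σ (β ^ 2) L).real Set.univ - ∫ φ, energy φ ∂(changeOrbit σ (β ^ 2) L) =
      σ ^ 2 / 2 * (changeOrbit σ (β ^ 2) L).real Set.univ *
        ((Real.cos β / Real.sin β - 1 / β) / (2 * β)) := by
  have := hM.finite
  have hβ : β ^ 2 < Real.pi ^ 2 := pow_lt_pow_left₀ h1 h0.le two_ne_zero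
  have := isFiniteMeasure_changeOrbit hM.lift hσ hβ
  have hA := integrable_energy_changeOrbit hM.lift hσ hβ
  have hlim1 : Tendsto (fun δ => ∫ φ, (cutoffLength δ φ - cutoffMoment 1 δ φ * energy φ)
      ∂(changeOrbit σ (β ^ 2) L)) (𝓝[>] 0)
      (𝓝 (∫ φ, (1 - 1 * energy φ) ∂(changeOrbit σ (β ^ 2) L))) := by
    refine tendsto_integral_filter_of_dominated_convergence (fun φ => 1 + energy φ) ?_ ?_
      ((integrable_const _).add hA) (Eventually.of_forall fun φ =>
        (tendsto_cutoffLength φ).sub ((tendsto_cutoffMoment 1 φ).mul_const _))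
    · filter_upwards [self_mem_nhdsWithin] with δ hδ
      exact ((continuous_cutoffLength hδ).sub ((continuous_cutoffMoment 1 hδ).mul
        continuous_energy)).measurable.aestronglyMeasurable
    · filter_upwards [self_mem_nhdsWithin] with δ hδ
      refine Eventually.of_forall fun φ => (norm_sub_le _ _).trans
        (add_le_add (abs_cutoffLength_le hδ φ) ?_)
      rw [norm_mul, Real.norm_eq_abs, Real.norm_eq_abs, abs_of_nonneg (energy_nonneg φ)]
      exact mul_le_of_le_one_left (energy_nonneg φ) (abs_cutoffMoment_le 1 hδ φ)
  have hlim2 : Tendsto (fun δ => ∫ φ, cutoffMoment 2 δ φ ∂(changeOrbit σ (β ^ 2) L)) (𝓝[>] 0)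
      (𝓝 (∫ _, 1 ∂(changeOrbit σ (β ^ 2) L))) := by
    refine tendsto_integral_filter_of_dominated_convergence (fun φ => 1) ?_ ?_
      (integrable_const _) (Eventually.of_forall fun φ => tendsto_cutoffMoment 2 φ)
    · filter_upwards [self_mem_nhdsWithin] with δ hδ
      exact (continuous_cutoffMoment 2 hδ).measurable.aestronglyMeasurable
    · filter_upwards [self_mem_nhdsWithin] with δ hδ
      exact Eventually.of_forall fun φ => abs_cutoffMoment_le 2 hδ φ
  have hlim3 := (hlim2.const_mul (σ ^ 2 / 2)).mul_const
    ((Real.cos β / Real.sin β - 1 / β) / (2 * β))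
  have h := tendsto_nhds_unique hlim1 (hlim3.congr' (by
    filter_upwards [self_mem_nhdsWithin] with δ hδ
    exact (integral_cutoffLength hσ hM h0 h1 hδ).symm))
  simp only [one_mul] at h
  rw [integral_sub (integrable_const _) hA] at h
  simpa using h

end

/-! ### The total mass of the orbital measures -/

theorem integral_changeOrbit (σ α2 : ℝ) (L : Measure (CircleDiffeo 1)) (H : CircleDiffeo 1 → ℝ) :
    ∫ φ, H φ ∂(changeOrbit σ α2 L) =
      ∫ φ, H φ * Real.exp (2 * (α2 - Real.pi ^ 2) / σ ^ 2 * energy φ) ∂L := by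
  rw [changeOrbit, integral_withDensity_eq_integral_toReal_smul (measurable_orbitDensity σ α2)
    (Eventually.of_forall fun _ => ENNReal.ofReal_lt_top)]
  refine integral_congr_ae (Eventually.of_forall fun φ => ?_)
  simp only [smul_eq_mul]
  rw [ENNReal.toReal_ofReal (Real.exp_pos _).le, mul_comm, energy_eq]

/-- The mass is a moment generating function of the energy under `L`, so it may be differentiated at
negative arguments, that is for `α2 < π²`. -/
theorem measureReal_changeOrbit (σ α2 : ℝ) (L : Measure (CircleDiffeo 1)) :
    (changeOrbit σ α2 L).real Set.univ =
      ProbabilityTheory.mgf energy L (2 * (α2 - Real.pi ^ 2) / σ ^ 2) := by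
  have h := integral_changeOrbit σ α2 L fun _ => 1
  simpa [ProbabilityTheory.mgf] using h

section

variable {σ : ℝ} {M : Measure DiffModPSL} {L : Measure (CircleDiffeo 1)}

theorem mem_interior_integrableExpSet [IsFiniteMeasure M] (hL : IsPSLLift M L) {a : ℝ}
    (ha : a < 0) : a ∈ interior (ProbabilityTheory.integrableExpSet energy L) := by
  refine mem_interior.2 ⟨Set.Iio 0, fun b hb => ?_, isOpen_Iio, ha⟩
  exact integrable_exp_energy hL hb

theorem orbit_exponent_neg (hσ : 0 < σ) {β2 : ℝ} (hβ : β2 < Real.pi ^ 2) :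
    2 * (β2 - Real.pi ^ 2) / σ ^ 2 < 0 :=
  div_neg_of_neg_of_pos (by linarith) (by positivity)

/-- The total mass of the `β`-orbital measure, divided by its expected growth. -/
noncomputable def massRatio (σ : ℝ) (L : Measure (CircleDiffeo 1)) (β : ℝ) : ℝ :=
  ProbabilityTheory.mgf energy L (2 * (β ^ 2 - Real.pi ^ 2) / σ ^ 2) *
    (Real.sinc β * Real.exp (-(2 * β ^ 2 / σ ^ 2)))

theorem hasDerivAt_mgf_orbit (hσ : 0 < σ) (hM : IsSchwarzianMeasure σ M L) {β : ℝ}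
    (hβ : β ^ 2 < Real.pi ^ 2) :
    HasDerivAt (fun β : ℝ => ProbabilityTheory.mgf energy L (2 * (β ^ 2 - Real.pi ^ 2) / σ ^ 2))
      ((∫ φ, energy φ ∂(changeOrbit σ (β ^ 2) L)) * (4 * β / σ ^ 2)) β := by
  have := hM.finite
  have h := ProbabilityTheory.hasDerivAt_mgf
    (mem_interior_integrableExpSet hM.lift (orbit_exponent_neg hσ hβ))
  rw [← integral_changeOrbit] at h
  have h2 : HasDerivAt (fun β : ℝ => 2 * (β ^ 2 - Real.pi ^ 2) / σ ^ 2) (4 * β / σ ^ 2) β := by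
    refine ((((hasDerivAt_pow 2 β).sub_const (Real.pi ^ 2)).const_mul 2).div_const
      (σ ^ 2)).congr_deriv ?_
    push_cast
    ring
  exact h.comp β h2

/-- The energy relation gives `Z' / Z = 4 β / σ² - cot β + 1 / β`, the logarithmic derivative of `(β
/ sin β) exp (2 β² / σ²)`. -/
theorem hasDerivAt_massRatio (hσ : 0 < σ) (hM : IsSchwarzianMeasure σ M L) {β : ℝ}
    (h0 : 0 < β) (h1 : β < Real.pi) : HasDerivAt (massRatio σ L) 0 β := by
  have hβ : β ^ 2 < Real.pi ^ 2 := pow_lt_pow_left₀ h1 h0.le two_ne_zero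
  have hs : Real.sin β ≠ 0 := (Real.sin_pos_of_pos_of_lt_pi h0 h1).ne'
  have hY := hasDerivAt_mgf_orbit hσ hM hβ
  have hsinc : HasDerivAt Real.sinc ((Real.cos β * β - Real.sin β * 1) / β ^ 2) β := by
    refine ((Real.hasDerivAt_sin β).div (hasDerivAt_id β) h0.ne').congr_of_eventuallyEq ?_
    filter_upwards [eventually_ne_nhds h0.ne'] with x hx
    exact Real.sinc_of_ne_zero hx
  have hexp : HasDerivAt (fun β : ℝ => Real.exp (-(2 * β ^ 2 / σ ^ 2)))
      (Real.exp (-(2 * β ^ 2 / σ ^ 2)) * -(4 * β / σ ^ 2)) β := by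
    refine ((((hasDerivAt_pow 2 β).const_mul 2).div_const (σ ^ 2)).neg.exp).congr_deriv ?_
    push_cast
    simp only [Pi.neg_apply]
    ring
  have hrel := measureReal_sub_integral_energy hσ hM h0 h1
  rw [measureReal_changeOrbit] at hrel
  refine (hY.mul (hsinc.mul hexp)).congr_deriv ?_
  set Y := ProbabilityTheory.mgf energy L (2 * (β ^ 2 - Real.pi ^ 2) / σ ^ 2)
  have hm : ∫ φ, energy φ ∂(changeOrbit σ (β ^ 2) L) = Y - σ ^ 2 / 2 * Y *
      ((Real.cos β / Real.sin β - 1 / β) / (2 * β)) := by linarith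
  simp only [Pi.mul_apply]
  rw [hm, Real.sinc_of_ne_zero h0.ne']
  field_simp
  ring

/-- The ratio is constant on `(0, π)` and, being written with `sinc`, continuous at `0`, where the
normalisation of the `0`-orbital measure gives its value. -/
theorem massRatio_eq (hσ : 0 < σ) (hM : IsSchwarzianMeasure σ M L) {β : ℝ}
    (h0 : 0 < β) (h1 : β < Real.pi) :
    massRatio σ L β = 1 / Real.sqrt (2 * Real.pi * σ ^ 2) := by
  have := hM.finite
  have hpi := Real.pi_pos
  have hconst : ∀ x ∈ Set.Ioo 0 Real.pi, massRatio σ L x = massRatio σ L β := fun x hx =>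
    isOpen_Ioo.is_const_of_deriv_eq_zero isPreconnected_Ioo
      (fun y hy => (hasDerivAt_massRatio hσ hM hy.1 hy.2).differentiableAt.differentiableWithinAt)
      (fun y hy => (hasDerivAt_massRatio hσ hM hy.1 hy.2).deriv) hx ⟨h0, h1⟩
  have hcont : ContinuousAt (massRatio σ L) 0 := by
    refine (hasDerivAt_mgf_orbit hσ hM (by simpa using sq_pos_of_pos hpi)).continuousAt.mul
      (Real.continuous_sinc.continuousAt.mul ?_)
    fun_prop
  have hlim := hcont.tendsto.mono_left (nhdsWithin_le_nhds (s := Set.Ioi 0))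
  have hlim2 : Tendsto (massRatio σ L) (𝓝[>] 0) (𝓝 (massRatio σ L β)) := by
    refine tendsto_const_nhds.congr' ?_
    filter_upwards [Ioo_mem_nhdsGT hpi] with x hx using (hconst x hx).symm
  rw [tendsto_nhds_unique hlim2 hlim]
  have h2 := measureReal_changeOrbit σ 0 L
  rw [measureReal_def, hM.normalised, ENNReal.toReal_ofReal (by positivity)] at h2
  simp [massRatio, h2]

theorem changeOrbit_univ (hσ : 0 < σ) (hM : IsSchwarzianMeasure σ M L) {β : ℝ}
    (h0 : 0 < β) (h1 : β < Real.pi) :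
    changeOrbit σ (β ^ 2) L Set.univ = ENNReal.ofReal
      (1 / Real.sqrt (2 * Real.pi * σ ^ 2) * (β / Real.sin β * Real.exp (2 * β ^ 2 / σ ^ 2))) := by
  have := hM.finite
  have hβ : β ^ 2 < Real.pi ^ 2 := pow_lt_pow_left₀ h1 h0.le two_ne_zero
  have := isFiniteMeasure_changeOrbit hM.lift hσ hβ
  have hs : Real.sin β ≠ 0 := (Real.sin_pos_of_pos_of_lt_pi h0 h1).ne'
  rw [← ENNReal.ofReal_toReal (measure_ne_top (changeOrbit σ (β ^ 2) L) Set.univ),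
    ← measureReal_def, measureReal_changeOrbit, ← massRatio_eq hσ hM h0 h1, massRatio,
    Real.sinc_of_ne_zero h0.ne', Real.exp_neg]
  congr 1
  have := (Real.exp_pos (2 * β ^ 2 / σ ^ 2)).ne'
  field_simp

theorem rpow_three_halves_eq (hσ : 0 < σ) : (2 * Real.pi / σ ^ 2) ^ (3 / 2 : ℝ) =
    4 * Real.pi / σ ^ 2 * (1 / Real.sqrt (2 * Real.pi * σ ^ 2) * Real.pi) := by
  have hpi := Real.pi_pos
  have hx : 0 < 2 * Real.pi / σ ^ 2 := by positivity
  rw [show (3 / 2 : ℝ) = 1 + 1 / 2 by norm_num, Real.rpow_add hx, Real.rpow_one,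
    ← Real.sqrt_eq_rpow, Real.sqrt_div (by positivity), Real.sqrt_sq hσ.le,
    Real.sqrt_mul (by positivity : 0 ≤ 2 * Real.pi) (σ ^ 2), Real.sqrt_sq hσ.le]
  have h := Real.sq_sqrt (by positivity : 0 ≤ 2 * Real.pi)
  have h' : Real.sqrt (2 * Real.pi) ≠ 0 := by positivity
  field_simp
  linear_combination 2 * h

theorem schwarzianMeasure_univ (hσ : 0 < σ) (hM : IsSchwarzianMeasure σ M L) :
    M Set.univ = ENNReal.ofReal ((2 * Real.pi / σ ^ 2) ^ (3 / 2 : ℝ) *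
      Real.exp (2 * Real.pi ^ 2 / σ ^ 2)) := by
  have hpi := Real.pi_pos
  have hlim := tendsto_pinned hσ hM.lift (F := fun _ => 1) continuous_const
  simp only [lintegral_one] at hlim
  -- Because `sin α = sin (π - α)`, the quotient `(π - α) / sin α` is `1 / sinc (π - α)`, which
  -- removes the singularity at `π`.
  have hsinc : ContinuousAt (fun α : ℝ => 1 / Real.sinc (Real.pi - α)) Real.pi := by
    refine continuousAt_const.div (Real.continuous_sinc.comp
      (continuous_const.sub continuous_id)).continuousAt ?_
    simp
  have hc : ContinuousAt (fun α : ℝ => 4 * Real.pi / σ ^ 2 *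
      (1 / Real.sqrt (2 * Real.pi * σ ^ 2) * α) * (1 / Real.sinc (Real.pi - α)) *
        Real.exp (2 * α ^ 2 / σ ^ 2)) Real.pi := by
    fun_prop
  have hlim2 := (ENNReal.continuous_ofReal.continuousAt.comp hc).tendsto.mono_left
    (nhdsWithin_le_nhds (s := Set.Iio Real.pi))
  simp only [Function.comp_apply, sub_self, Real.sinc_zero, div_one, mul_one] at hlim2
  rw [rpow_three_halves_eq hσ]
  refine tendsto_nhds_unique hlim (hlim2.congr' ?_)
  filter_upwards [Ioo_mem_nhdsLT hpi] with α hα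
  have hs : Real.sin α ≠ 0 := (Real.sin_pos_of_pos_of_lt_pi hα.1 hα.2).ne'
  have hα' : 0 < Real.pi - α := sub_pos.2 hα.2
  rw [pinned, Measure.map_apply (continuous_pin 0).measurable MeasurableSet.univ,
    Set.preimage_univ, changeOrbit_univ hσ hM hα.1 hα.2, ← ENNReal.ofReal_mul (by positivity)]
  simp only [Function.comp_apply]
  congr 1
  rw [Real.sinc_of_ne_zero hα'.ne', Real.sin_pi_sub]
  field_simp

end

end SchwarzianTheory

theorem mainTheorem10 (σ : ℝ) (hσ : 0 < σ) (M : Measure DiffModPSL)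
    (L : Measure (CircleDiffeo 1)) (hM : IsSchwarzianMeasure σ M L) :
    (∀ F : DiffModPSL → ℝ≥0∞, Continuous F →
      Tendsto (fun α : ℝ => ENNReal.ofReal (4 * Real.pi * (Real.pi - α) / σ ^ 2) *
          ∫⁻ φ, F (DiffModPSL.mk φ) ∂(pinned 0 (changeOrbit σ (α ^ 2) L)))
        (𝓝[<] Real.pi) (𝓝 (∫⁻ q, F q ∂M))) ∧
    M Set.univ =
      ENNReal.ofReal ((2 * Real.pi / σ ^ 2) ^ (3 / 2 : ℝ) *
        Real.exp (2 * Real.pi ^ 2 / σ ^ 2)) := by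
  exact ⟨fun F hF => tendsto_pinned hσ hM.lift hF, schwarzianMeasure_univ hσ hM⟩
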